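/- Let $n\ge 6$, and let $E_n$ be the graph with vertices $0,1,\dots,n-1$ in which $1,2,\dots,n-1$ form a path in this order and $0$ is joined to $3$ only. Let $W$ be the Coxeter group of this graph, with generators $s_0,\dots,s_{n-1}$, and let $W_c\subseteq W$ be the set of fully commutative elements, that is, those $w$ that cannot be written as a reduced product $x_1\,(sts)\,x_2$ with $s,t$ generators belonging to adjacent vertices. Let $K$ be the field of fractions of $\mathbb Z[[v^{-1}]]$, regarded as a subfield of $\mathbb Q((v^{-1}))$, and put $\delta=v+v^{-1}$. Let $TL_K(E_n)$ be the unital $K$-algebra with generators $b_0,\dots,b_{n-1}$ and relations $b_s^2=\delta b_s$; $b_sb_t=b_tb_s$ if $s\neq t$ are not adjacent; $b_sb_tb_s=b_s$ if $s,t$ are adjacent. For $w\in W_c$ let $b_w$ be the product of the generators along a reduced expression of $w$; it does not depend on the reduced expression, and the elements $b_w$ $(w\in W_c)$ form the monomial basis of $TL_K(E_n)$. For a set $A$ of pairwise non-adjacent vertices let $i(A)=\prod_{s\in A}b_s$. For $w,w'\in W_c$ write $w'\le_L w$ if, for some $x\in W_c$, the element $b_{w'}$ occurs with nonzero coefficient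 in $b_xb_w$, and $w'\le_{LR}w$ if, for some $x,y\in W_c$, $b_xb_wb_y$ is a nonzero multiple of $b_{w'}$. The classes of the associated equivalence relations are the left cells and the two-sided cells. If $T,U$ are left cells contained in the same two-sided cell, there is a unique $w\in W_c$ with $w^{-1}\in T$ and $w\in U$ (so $w$ is the common element of the right cell $T^{-1}$ and the left cell $U$), and $C_{T,U}:=b_w$. A trace on $TL_K(E_n)$ is a $K$-linear map $t:TL_K(E_n)\to K$ with $t(ab)=t(ba)$ for all $a,b$; it is nondegenerate if $a=0$ is the only element with $t(ab)=0$ for all $b$. **Proposition.** There is a unique trace $\mathrm{tr}$ on $TL_K(E_n)$ such that $\mathrm{tr}(i(A))=\delta^{-\#A}$ for every set $A$ of pairwise non-adjacent vertices of $E_n$. This trace is nondegenerate, and whenever $P,Q$ are left cells contained in a common two-sided cell and $R,S$ are left cells contained in a common two-sided cell, $$\mathrm{tr}(C_{P,Q}\,C_{R,S})-\delta_{QR}\,\delta_{PS}\in v^{-1}\mathbb Q[[v^{-1}]],$$ where $\delta_{QR}$ and $\delta_{PS}$ are Kronecker deltas. -/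

import Mathlib

noncomputable section

namespace TLE

/-! ### The ground field -/

/-- The field `K` of fractions of the power series ring `ℤ[[v⁻¹]]`;
the power series variable stands for `v⁻¹`. -/
abbrev K : Type := FractionRing (PowerSeries ℤ)

/-- The element `v` of `K`, the inverse of the power series variable. -/
def v : K := (algebraMap (PowerSeries ℤ) K PowerSeries.X)⁻¹

/-- The element `δ = v + v⁻¹` of `K`. -/
def δ : K := v + v⁻¹

/-- The inclusion of `ℤ[[v⁻¹]]` in the field `ℚ((v⁻¹))` of Laurent series. -/
def intSeriesToLaurent : PowerSeries ℤ →+* LaurentSeries ℚ :=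
  (HahnSeries.ofPowerSeries ℤ ℚ).comp (PowerSeries.map (Int.castRingHom ℚ))

theorem intSeriesToLaurent_injective : Function.Injective intSeriesToLaurent := by
  intro f g h
  have h' : PowerSeries.map (Int.castRingHom ℚ) f = PowerSeries.map (Int.castRingHom ℚ) g :=
    HahnSeries.ofPowerSeries_injective (Γ := ℤ) (R := ℚ) h
  ext k
  have hk := congrArg (PowerSeries.coeff k) h'
  simpa using hk

/-- The expansion of an element of `K` as a Laurent series in `v⁻¹` over `ℚ`: the embedding of
`K` in `ℚ((v⁻¹))` that extends the inclusion of `ℤ[[v⁻¹]]`. -/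
def expand : K →+* LaurentSeries ℚ :=
  IsFractionRing.lift intSeriesToLaurent_injective

/-- `x` lies in `v⁻¹ ℚ[[v⁻¹]]`. -/
def IsSmall (x : K) : Prop :=
  ∃ f : PowerSeries ℚ, expand x = HahnSeries.ofPowerSeries ℤ ℚ (PowerSeries.X * f)

/-! ### The Coxeter group of type `E_n` -/

/-- The Coxeter graph `E_n` on the vertices `0, …, n - 1`: the vertices `1, …, n - 1` form a
path in this order, and `0` is joined to `3` only. -/
def graph (n : ℕ) : SimpleGraph (Fin n) :=
  SimpleGraph.fromRel fun i j =>
    (1 ≤ (i : ℕ) ∧ (j : ℕ) = i + 1) ∨ ((i : ℕ) = 0 ∧ (j : ℕ) = 3)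

open scoped Classical in
/-- The Coxeter matrix of type `E_n`: `3` on edges, `2` on pairs of distinct non-adjacent
vertices. -/
def cox (n : ℕ) : CoxeterMatrix (Fin n) where
  M := Matrix.of fun i j => if i = j then 1 else if (graph n).Adj i j then 3 else 2
  isSymm := by
    ext i j
    simp only [Matrix.transpose_apply, Matrix.of_apply, (graph n).adj_comm j i, eq_comm (a := j)]
  diagonal := by simp
  off_diagonal := by
    intro i j h
    simp only [Matrix.of_apply, if_neg h]
    split_ifs <;> decide

/-- The Coxeter group `W(E_n)`. -/
abbrev W (n : ℕ) : Type := (cox n).Group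

/-- `W(E_n)` with its generating involutions. -/
abbrev cs (n : ℕ) : CoxeterSystem (cox n) (W n) := (cox n).toCoxeterSystem

/-- `w` is complex: it is a reduced product `x₁ (s t s) x₂` with `s`, `t` adjacent vertices
(`s t s` is the longest element of the parabolic subgroup generated by `s` and `t`). -/
def IsComplex {n : ℕ} (w : W n) : Prop :=
  ∃ (x₁ x₂ : W n) (s t : Fin n), (graph n).Adj s t ∧
    w = x₁ * ((cs n).simple s * (cs n).simple t * (cs n).simple s) * x₂ ∧
    (cs n).length w = (cs n).length x₁ +
      (cs n).length ((cs n).simple s * (cs n).simple t * (cs n).simple s) + (cs n).length x₂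

theorem IsComplex.inv {n : ℕ} {w : W n} (h : IsComplex w) : IsComplex w⁻¹ := by
  obtain ⟨x₁, x₂, s, t, hst, hw, hl⟩ := h
  refine ⟨x₂⁻¹, x₁⁻¹, s, t, hst, ?_, ?_⟩
  · rw [hw]
    simp only [mul_inv_rev, CoxeterSystem.inv_simple, mul_assoc]
  · rw [CoxeterSystem.length_inv, CoxeterSystem.length_inv, CoxeterSystem.length_inv, hl]
    omega

/-- The set `W_c` of fully commutative elements. -/
def Wc (n : ℕ) : Type := {w : W n // ¬ IsComplex w}

instance (n : ℕ) : Inv (Wc n) :=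
  ⟨fun w => ⟨w.1⁻¹, fun h => w.2 (by simpa using h.inv)⟩⟩

/-! ### The generalized Temperley-Lieb algebra -/

/-- The defining relations of the generalized Temperley-Lieb algebra of type `E_n`. -/
inductive Rel (n : ℕ) : FreeAlgebra K (Fin n) → FreeAlgebra K (Fin n) → Prop
  | sq (s : Fin n) :
      Rel n (FreeAlgebra.ι K s * FreeAlgebra.ι K s) (δ • FreeAlgebra.ι K s)
  | comm (s t : Fin n) (h : cox n s t = 2) :
      Rel n (FreeAlgebra.ι K s * FreeAlgebra.ι K t) (FreeAlgebra.ι K t * FreeAlgebra.ι K s)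
  | braid (s t : Fin n) (h : cox n s t = 3) :
      Rel n (FreeAlgebra.ι K s * FreeAlgebra.ι K t * FreeAlgebra.ι K s) (FreeAlgebra.ι K s)

/-- The `K`-algebra `TL_K(E_n)`. -/
abbrev TL (n : ℕ) : Type := RingQuot (Rel n)

/-- The generators `b_s` of `TL_K(E_n)`. -/
def gen {n : ℕ} (s : Fin n) : TL n :=
  RingQuot.mkAlgHom K (Rel n) (FreeAlgebra.ι K s)

/-- The monomial basis element `b_w`, the product of the generators along a reduced expression
of `w` (for `w` in `W_c` it does not depend on the reduced expression). -/
def b {n : ℕ} (w : Wc n) : TL n :=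
  (((cs n).exists_isReduced w.1).choose.map gen).prod

/-- The product `i(A)` of the generators at the vertices in `A`, taken in increasing order
(for sets of non-adjacent vertices the order is immaterial). -/
def iProd {n : ℕ} (A : Finset (Fin n)) : TL n :=
  ((A.sort (· ≤ ·)).map gen).prod

/-! ### Monomial cells -/

/-- `w' ≤_L w`: for some `x` in `W_c`, the coefficient of `b_{w'}` in the expansion of
`b_x b_w` in the monomial basis is nonzero. -/
def LeL {n : ℕ} (w' w : Wc n) : Prop :=
  ∃ (x : Wc n) (g : Wc n →₀ K), b x * b w = g.sum (fun z c => c • b z) ∧ g w' ≠ 0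

/-- `w' ≤_LR w`: some product `b_x b_w b_y` is a nonzero multiple of `b_{w'}`. -/
def LeLR {n : ℕ} (w' w : Wc n) : Prop :=
  ∃ (x y : Wc n) (c : K), c ≠ 0 ∧ b x * b w * b y = c • b w'

/-- `T` is a left cell. -/
def IsLeftCell {n : ℕ} (T : Set (Wc n)) : Prop :=
  ∃ w : Wc n, T = {w' | LeL w' w ∧ LeL w w'}

/-- `Λ` is a two-sided cell. -/
def IsTwoSidedCell {n : ℕ} (Λ : Set (Wc n)) : Prop :=
  ∃ w : Wc n, Λ = {w' | LeLR w' w ∧ LeLR w w'}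

/-- `M(Λ)`: the left cells contained in the two-sided cell `Λ`. -/
def M {n : ℕ} (Λ : Set (Wc n)) : Set (Set (Wc n)) :=
  {T | IsLeftCell T ∧ T ⊆ Λ}

open scoped Classical in
/-- For left cells `T` and `U` contained in the same two-sided cell, `C_{T,U}` is `b_w` for the
unique `w` in the intersection of the right cell `T⁻¹` with the left cell `U`. -/
def C {n : ℕ} (T U : Set (Wc n)) : TL n :=
  if h : ∃! w : Wc n, w⁻¹ ∈ T ∧ w ∈ U then b h.choose else 0

/-! ### Traces -/

/-- `t` is a trace. -/
def IsTrace {n : ℕ} (t : TL n →ₗ[K] K) : Prop :=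
  ∀ x y : TL n, t (x * y) = t (y * x)

/-- The trace `t` is nondegenerate: its radical is trivial. -/
def IsNondegenerate {n : ℕ} (t : TL n →ₗ[K] K) : Prop :=
  ∀ x : TL n, (∀ y : TL n, t (x * y) = 0) → x = 0

/-- `t` is a trace with the value `δ^{-#A}` at `i(A)` for each set `A` of pairwise non-adjacent
vertices of `E_n`. -/
def IsTr {n : ℕ} (t : TL n →ₗ[K] K) : Prop :=
  IsTrace t ∧ ∀ A : Finset (Fin n), (graph n).IsIndepSet (A : Set (Fin n)) →
    t (iProd A) = (δ ^ A.card)⁻¹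

end TLE

end

/-! The trace is read off from one matrix representation at the single value `δ = √2`. Attach to the
vertices real symmetric involutions that anticommute along edges and commute otherwise. The matrices
`(1 + cliff s)/√2` satisfy the Temperley-Lieb relations with parameter `√2` (`isTLFamily_cgen`). The
combinatorial input on `E_n` is `cyclicallyReducible_graph`: a cyclic word with two adjacent letters
always contains two cyclically consecutive occurrences of some letter with at most one neighbour in
between. Hence commutations, rotations and the defining relations bring each word to a product of
distinct commuting letters (`CyclicallyReducible.induction`), and the normalized matrix trace of
each word is an integral power of `√2`. The relations change the exponent of `√2` exactly as they
change that of `δ`, so sending a word to the same power of `δ` defines a trace over `K`. The same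
induction gives uniqueness.

Transposing a matrix product reverses the word, so the trace of `w` times the reverse of `w'` comes
from a Frobenius inner product. Star reductions preserve the norm, so the images of fully
commutative words are unit vectors (`FC.nsq_wprod`), and inequivalent words have distinct images
(`FC.commEq_of_wprod_eq`). Distinct unit vectors have inner product below `1`; as this is a power of
`√2`, its exponent is negative. Thus `b w * b w'⁻¹` has trace `1` if `w = w'` and a negative power
of `δ` otherwise. Comparing orders in `v⁻¹` shows that such a nearly orthonormal family is linearly
independent and that the form is nondegenerate (`eq_zero_of_trace`).

Fully commutative words up to commutation are matched with `W_c` by the exchange property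
(`FC.isReduced_and`). For the cells, monomials up to powers of `δ` form a monoid in which `w w⁻¹ w =
w` and the powers of each element stabilize. A Green-type argument then yields exactly one element
in each intersection of a right and a left cell inside a two-sided cell (`existsUnique_of_mem_M`),
so the estimate for the `C P Q` is the one for the `b w`. -/

noncomputable section

namespace TLE

open scoped Classical

/-! ### Words with letters in the vertices of a graph -/

section Words

variable {V : Type*} (G : SimpleGraph V)

/-- Commutation equivalence of words: the congruence generated by the interchange of two
consecutive letters that are distinct and not adjacent. -/
inductive CommEq : List V → List V → Prop
  | refl (u : List V) : CommEq u u
  | swap {s t : V} (h : s ≠ t) (h' : ¬ G.Adj s t) (u : List V) : CommEq (s :: t :: u) (t :: s :: u)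
  | cons (s : V) {u v : List V} (h : CommEq u v) : CommEq (s :: u) (s :: v)
  | trans {u v w : List V} (h : CommEq u v) (h' : CommEq v w) : CommEq u w

/-- The subword of `u` formed by `s` and its neighbours: `true` stands for `s`, and `false` for a
neighbour. -/
def proj (s : V) (u : List V) : List Bool :=
  u.filterMap fun t => if t = s then some true else if G.Adj s t then some false else none

/-- A boolean list is good if it has no factor `true, true` and no factor `true, false, true`. -/
def Good (l : List Bool) : Prop :=
  ¬ [true, true] <:+: l ∧ ¬ [true, false, true] <:+: l

/-- A word is fully commutative if between any two occurrences of a letter there are at least two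
occurrences of its neighbours. -/
def FC (u : List V) : Prop := ∀ s, Good (proj G s u)

/-- The letter `s` commutes with, and is different from, each letter of `u`. -/
def Apart (s : V) (u : List V) : Prop := ∀ t ∈ u, s ≠ t ∧ ¬ G.Adj s t

/-- The letters of `u` are distinct and pairwise non-adjacent. -/
def Indep (u : List V) : Prop := u.Pairwise fun s t => s ≠ t ∧ ¬ G.Adj s t

end Words

/-! ### Boolean lists without forbidden factors -/

namespace Good

theorem nil : Good [] := by simp [Good]

theorem cons_false {l : List Bool} : Good (false :: l) ↔ Good l := by
  simp [Good, List.infix_cons_iff]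

theorem cons_true {l : List Bool} :
    Good (true :: l) ↔ ¬ [true] <+: l ∧ ¬ [false, true] <+: l ∧ Good l := by
  simp only [Good, List.infix_cons_iff, List.cons_prefix_cons, true_and]
  tauto

theorem reverse {l : List Bool} : Good l.reverse ↔ Good l := by
  have h1 := List.reverse_infix (l₁ := [true, true]) (l₂ := l)
  have h2 := List.reverse_infix (l₁ := [true, false, true]) (l₂ := l)
  simp only [List.reverse_cons, List.reverse_nil, List.nil_append, List.cons_append] at h1 h2
  simp only [Good, h1, h2]

theorem of_infix {l l' : List Bool} (h : l <:+: l') (h' : Good l') : Good l :=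
  ⟨fun k => h'.1 (k.trans h), fun k => h'.2 (k.trans h)⟩

theorem of_cons {x : Bool} {l : List Bool} (h : Good (x :: l)) : Good l :=
  h.of_infix (List.suffix_cons x l).isInfix

/-- A forbidden factor lying neither in `P ++ Q` nor in `Q ++ R` contains all of `Q` and a letter on
each side. It has length at most three and its only inner letter is `false`, so `Q` is `[]` or
`[false]`; the last two hypotheses exclude these cases. This is the gluing tool for cyclic words
below. -/
theorem append_append {Q R : List Bool} : ∀ {P : List Bool}, Good (P ++ Q) → Good (Q ++ R) →
    (Q = [] → ¬ [true] <:+ P ∧ ¬ [true] <+: R) →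
    (Q = [false] → ¬ ([true] <:+ P ∧ [true] <+: R)) → Good (P ++ (Q ++ R))
  | [], _, h2, _, _ => h2
  | x :: P, h1, h2, h3, h4 => by
    have hs : P <:+ x :: P := List.suffix_cons x P
    have ih : Good (P ++ (Q ++ R)) := append_append h1.of_cons h2
      (fun h => ⟨fun k => (h3 h).1 (k.trans hs), (h3 h).2⟩)
      (fun h k => h4 h ⟨k.1.trans hs, k.2⟩)
    cases x
    · exact cons_false.2 ih
    · simp only [List.cons_append] at h1 ⊢
      rw [cons_true] at h1 ⊢
      obtain ⟨k1, k2, k3⟩ := h1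
      refine ⟨?_, ?_, ih⟩
      · rcases P with _ | ⟨y, P⟩
        · rcases Q with _ | ⟨z, Q⟩
          · exact absurd (List.suffix_refl _) (h3 rfl).1
          · simpa using k1
        · simpa using k1
      · rcases P with _ | ⟨y, P⟩
        · rcases Q with _ | ⟨z, Q⟩
          · exact absurd (List.suffix_refl _) (h3 rfl).1
          · rcases Q with _ | ⟨z', Q⟩
            · cases z
              · have := h4 rfl
                simp only [List.suffix_refl, true_and] at this
                simpa using this
              · simp
            · simpa using k2
        · rcases P with _ | ⟨y', P⟩
          · rcases Q with _ | ⟨z, Q⟩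
            · have := (h3 rfl).2
              cases y
              · simpa using this
              · simp
            · simpa using k2
          · simpa using k2

end Good

/-! ### Words up to commutation and their projections -/

section Words

variable {V : Type*} {G : SimpleGraph V}

namespace CommEq

theorem symm {u v : List V} (h : CommEq G u v) : CommEq G v u := by
  induction h with
  | refl u => exact .refl u
  | swap h h' u => exact .swap h.symm (fun k => h' k.symm) u
  | cons s _ ih => exact .cons s ih
  | trans _ _ ih ih' => exact .trans ih' ih

theorem append_left (a : List V) {u v : List V} (h : CommEq G u v) :
    CommEq G (a ++ u) (a ++ v) := by
  induction a with
  | nil => exact h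
  | cons s a ih => exact .cons s ih

theorem append_right {u v : List V} (h : CommEq G u v) (a : List V) :
    CommEq G (u ++ a) (v ++ a) := by
  induction h with
  | refl u => exact .refl _
  | swap h h' u => exact .swap h h' _
  | cons s _ ih => exact .cons s ih
  | trans _ _ ih ih' => exact .trans ih ih'

theorem append {u v u' v' : List V} (h : CommEq G u v) (h' : CommEq G u' v') :
    CommEq G (u ++ u') (v ++ v') :=
  (h.append_right u').trans (h'.append_left v)

theorem perm {u v : List V} (h : CommEq G u v) : u.Perm v := by
  induction h with
  | refl u => exact .refl u
  | swap h h' u => exact .swap _ _ _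
  | cons s _ ih => exact .cons s ih
  | trans _ _ ih ih' => exact .trans ih ih'

theorem length {u v : List V} (h : CommEq G u v) : u.length = v.length := h.perm.length_eq

theorem reverse {u v : List V} (h : CommEq G u v) : CommEq G u.reverse v.reverse := by
  induction h with
  | refl u => exact .refl _
  | swap h h' u =>
    simp only [List.reverse_cons, List.append_assoc]
    exact (CommEq.swap h.symm (fun k => h' k.symm) []).append_left _
  | cons s _ ih => simpa using ih.append_right [s]
  | trans _ _ ih ih' => exact .trans ih ih'

theorem reverse_iff {u v : List V} : CommEq G u.reverse v.reverse ↔ CommEq G u v :=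
  ⟨fun h => by simpa using h.reverse, reverse⟩

/-- Two interchanged letters that are both visible must both be neighbours of `s`, and then both are
recorded as `false`. -/
theorem proj_eq {u v : List V} (h : CommEq G u v) (s : V) : proj G s u = proj G s v := by
  induction h with
  | refl u => rfl
  | @swap a b h h' u =>
    have hb : ¬ G.Adj b a := fun k => h' k.symm
    unfold proj
    by_cases h1 : a = s
    · subst h1
      simp [h.symm, h']
    · by_cases h2 : b = s
      · subst h2
        simp [h, hb]
      · by_cases h3 : G.Adj s a <;> by_cases h4 : G.Adj s b <;> simp [h1, h2, h3, h4]
  | cons a _ ih =>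
    unfold proj at ih ⊢
    simp only [List.filterMap_cons, ih]
  | trans _ _ ih ih' => exact ih.trans ih'

theorem fc_iff {u v : List V} (h : CommEq G u v) : FC G u ↔ FC G v := by
  simp only [FC, h.proj_eq]

end CommEq

@[simp] theorem proj_nil (s : V) : proj G s [] = [] := rfl

@[simp] theorem proj_append (s : V) (u v : List V) :
    proj G s (u ++ v) = proj G s u ++ proj G s v := by simp [proj]

@[simp] theorem proj_cons_self (s : V) (u : List V) : proj G s (s :: u) = true :: proj G s u := by
  simp [proj]

theorem proj_cons_adj {s t : V} (h : G.Adj s t) (u : List V) :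
    proj G s (t :: u) = false :: proj G s u := by
  simp [proj, h, h.ne']

theorem proj_cons_apart {s t : V} (h : s ≠ t) (h' : ¬ G.Adj s t) (u : List V) :
    proj G s (t :: u) = proj G s u := by
  simp [proj, h.symm, h']

theorem proj_cons (s t : V) (u : List V) : proj G s (t :: u) = proj G s [t] ++ proj G s u := by
  rw [← proj_append]; rfl

@[simp] theorem proj_reverse (s : V) (u : List V) :
    proj G s u.reverse = (proj G s u).reverse := by simp [proj, List.filterMap_reverse]

theorem proj_eq_nil_iff {s : V} {u : List V} : proj G s u = [] ↔ Apart G s u := by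
  simp only [proj, List.filterMap_eq_nil_iff, Apart]
  refine forall₂_congr fun t _ => ?_
  by_cases h : t = s
  · simp [h]
  · by_cases h' : G.Adj s t <;> simp [h, h', Ne.symm h]

theorem true_mem_proj {s : V} {u : List V} : true ∈ proj G s u ↔ s ∈ u := by
  simp only [proj, List.mem_filterMap]
  constructor
  · rintro ⟨t, ht, h⟩
    by_cases h1 : t = s
    · exact h1 ▸ ht
    · by_cases h2 : G.Adj s t <;> simp [h1, h2] at h
  · intro h
    exact ⟨s, h, by simp⟩

theorem false_mem_proj {s : V} {u : List V} : false ∈ proj G s u ↔ ∃ t ∈ u, G.Adj s t := by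
  simp only [proj, List.mem_filterMap]
  constructor
  · rintro ⟨t, ht, h⟩
    refine ⟨t, ht, ?_⟩
    by_cases h1 : t = s
    · simp [h1] at h
    · by_cases h2 : G.Adj s t
      · exact h2
      · simp [h1, h2] at h
  · rintro ⟨t, ht, h⟩
    exact ⟨t, ht, by simp [h, h.ne']⟩

/-- Splitting of a word at the first letter visible in a projection. -/
theorem proj_eq_cons {s : V} {x : Bool} {l : List Bool} {u : List V}
    (h : proj G s u = x :: l) : ∃ a t c, u = a ++ t :: c ∧ Apart G s a ∧
      (if x = true then t = s else G.Adj s t) ∧ proj G s c = l := by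
  obtain ⟨a, t, c, rfl, ha, ht, hc⟩ := List.filterMap_eq_cons_iff.1 h
  refine ⟨a, t, c, rfl, proj_eq_nil_iff.1 (List.filterMap_eq_nil_iff.2 ha), ?_, hc⟩
  by_cases h1 : t = s
  · subst h1; simp at ht; simp [← ht]
  · by_cases h2 : G.Adj s t
    · simp [h1, h2] at ht; simp [← ht, h2]
    · simp [h1, h2] at ht

theorem proj_eq_append {s : V} {l l' : List Bool} {u : List V}
    (h : proj G s u = l ++ l') : ∃ a c, u = a ++ c ∧ proj G s a = l ∧ proj G s c = l' :=
  List.filterMap_eq_append_iff.1 h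

theorem Apart.symm_comm {s : V} {u : List V} (h : Apart G s u) : CommEq G (s :: u) (u ++ [s]) := by
  induction u with
  | nil => exact .refl _
  | cons t u ih =>
    have ht := h t (by simp)
    exact (CommEq.swap ht.1 ht.2 u).trans (.cons t (ih fun r hr => h r (by simp [hr])))

theorem Apart.comm {s : V} {u : List V} (h : Apart G s u) (v : List V) :
    CommEq G (u ++ s :: v) (s :: u ++ v) := by
  have := (h.symm_comm.append_right v).symm
  simpa using this

theorem Apart.append {s : V} {u v : List V} : Apart G s (u ++ v) ↔ Apart G s u ∧ Apart G s v := by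
  simp only [Apart, List.mem_append]
  exact ⟨fun h => ⟨fun t ht => h t (.inl ht), fun t ht => h t (.inr ht)⟩,
    fun h t ht => ht.elim (h.1 t) (h.2 t)⟩

/-- All letters before the first visible one commute with `s`. Thus a projection that begins with
`true` expresses that `s` is maximal in the word; likewise a projection ending in `true` expresses
that `s` is minimal. -/
theorem exists_cons_of_proj {s : V} {u : List V} (h : [true] <+: proj G s u) :
    ∃ v, CommEq G u (s :: v) := by
  obtain ⟨l, hl⟩ := h
  obtain ⟨a, t, c, rfl, ha, ht, -⟩ := proj_eq_cons hl.symm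
  obtain rfl : t = s := by simpa using ht
  exact ⟨a ++ c, ha.comm c⟩

theorem exists_concat_of_proj {s : V} {u : List V} (h : [true] <:+ proj G s u) :
    ∃ v, CommEq G u (v ++ [s]) := by
  have : [true] <+: proj G s u.reverse := by
    rw [proj_reverse]
    simpa using List.reverse_prefix.2 h
  obtain ⟨v, hv⟩ := exists_cons_of_proj this
  exact ⟨v.reverse, by simpa using hv.reverse⟩

/-- The letters of a forbidden factor are separated only by letters that commute with `s`, so the
occurrences of `s` can be moved up to one another, or up to the one neighbour between them. -/
theorem exists_sq_or_braid {s : V} {u : List V} (h : ¬ Good (proj G s u)) :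
    (∃ a c, CommEq G u (a ++ s :: s :: c)) ∨
      ∃ a c t, G.Adj s t ∧ CommEq G u (a ++ s :: t :: s :: c) := by
  rw [Good, not_and_or, not_not, not_not] at h
  rcases h with ⟨p, q, h⟩ | ⟨p, q, h⟩
  · left
    rw [List.append_assoc] at h
    obtain ⟨a, u, rfl, -, hu⟩ := proj_eq_append h.symm
    obtain ⟨m, t, u, rfl, -, ht, hu⟩ := proj_eq_cons hu
    obtain rfl : t = s := by simpa using ht
    obtain ⟨m', t', u, rfl, hm', ht, hu⟩ := proj_eq_cons hu
    obtain rfl : t' = t := by simpa using ht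
    refine ⟨a ++ m, m' ++ u, ?_⟩
    simpa using (((hm'.comm u).cons t').append_left (a ++ m))
  · right
    rw [List.append_assoc] at h
    obtain ⟨a, u, rfl, -, hu⟩ := proj_eq_append h.symm
    obtain ⟨m, t, u, rfl, -, ht, hu⟩ := proj_eq_cons hu
    obtain rfl : t = s := by simpa using ht
    obtain ⟨m', r, u, rfl, hm', hr, hu⟩ := proj_eq_cons hu
    obtain ⟨m'', t', u, rfl, hm'', ht', hu⟩ := proj_eq_cons hu
    obtain rfl : t' = t := by simpa using ht'
    refine ⟨a ++ m ++ m', m'' ++ u, r, by simpa using hr, ?_⟩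
    have h1 := ((hm''.comm u).cons r).append_left (a ++ m ++ t' :: m')
    have h2 := (hm'.comm (r :: t' :: (m'' ++ u))).symm.append_left (a ++ m)
    simp only [List.append_assoc, List.cons_append] at h1 h2 ⊢
    exact h1.trans h2

namespace FC

theorem of_commEq {u v : List V} (hu : FC G u) (h : CommEq G u v) : FC G v := h.fc_iff.1 hu

theorem reverse {u : List V} (h : FC G u) : FC G u.reverse := fun s => by
  rw [proj_reverse, Good.reverse]; exact h s

theorem of_infix {u v : List V} (h : u <:+: v) (hv : FC G v) : FC G u := fun s =>
  (hv s).of_infix (h.filterMap _)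

theorem of_cons {s : V} {u : List V} (h : FC G (s :: u)) : FC G u :=
  h.of_infix (List.suffix_cons s u).isInfix

theorem of_append_left {u v : List V} (h : FC G (u ++ v)) : FC G u :=
  h.of_infix (List.prefix_append u v).isInfix

/-- Only the projection to `s` can become bad: every other projection gains a leading `false` or
nothing. -/
theorem cons {s : V} {u : List V} (h : FC G u) (h1 : ¬ [true] <+: proj G s u)
    (h2 : ¬ [false, true] <+: proj G s u) : FC G (s :: u) := fun t => by
  by_cases hst : t = s
  · subst hst
    rw [proj_cons_self, Good.cons_true]
    exact ⟨h1, h2, h t⟩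
  · by_cases ha : G.Adj t s
    · rw [proj_cons_adj ha, Good.cons_false]
      exact h t
    · rw [proj_cons_apart hst ha]
      exact h t

theorem not_sq {s : V} {a c : List V} : ¬ FC G (a ++ s :: s :: c) := fun h =>
  (h s).1 ⟨proj G s a, proj G s c, by simp⟩

theorem not_braid {s t : V} (hst : G.Adj s t) {a c : List V} :
    ¬ FC G (a ++ s :: t :: s :: c) := fun h =>
  (h s).2 ⟨proj G s a, proj G s c, by simp [proj_cons_adj hst]⟩

theorem sq_or_braid {u : List V} (h : ¬ FC G u) :
    (∃ a c s, CommEq G u (a ++ s :: s :: c)) ∨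
      ∃ a c s t, G.Adj s t ∧ CommEq G u (a ++ s :: t :: s :: c) := by
  rw [FC, not_forall] at h
  obtain ⟨s, hs⟩ := h
  rcases exists_sq_or_braid hs with ⟨a, c, h⟩ | ⟨a, c, t, h, h'⟩
  · exact .inl ⟨a, c, s, h⟩
  · exact .inr ⟨a, c, s, t, h, h'⟩

end FC

namespace Indep

theorem commEq_of_perm {u v : List V} (hu : Indep G u) (h : u.Perm v) : CommEq G u v := by
  induction h with
  | nil => exact .refl _
  | cons s _ ih => exact .cons s (ih (List.pairwise_cons.1 hu).2)
  | swap s t u =>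
    have := (List.pairwise_cons.1 hu).1 s (by simp)
    exact .swap this.1 this.2 u
  | trans h1 _ ih ih' =>
    refine (ih hu).trans (ih' ?_)
    exact (h1.pairwise_iff fun h => ⟨h.1.symm, fun k => h.2 k.symm⟩).1 hu

theorem of_perm {u v : List V} (hu : Indep G u) (h : u.Perm v) : Indep G v :=
  (h.pairwise_iff fun h => ⟨h.1.symm, fun k => h.2 k.symm⟩).1 hu

theorem nodup {u : List V} (hu : Indep G u) : u.Nodup := hu.imp fun h => h.1

theorem cons_iff {s : V} {u : List V} : Indep G (s :: u) ↔ Apart G s u ∧ Indep G u :=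
  List.pairwise_cons

theorem proj_self {u : List V} (hu : Indep G u) {s : V} (hs : s ∈ u) : proj G s u = [true] := by
  obtain ⟨a, c, rfl⟩ := List.append_of_mem hs
  have hp : (a ++ s :: c).Perm (s :: (a ++ c)) := List.perm_middle
  have h1 := hu.of_perm hp
  rw [(hu.commEq_of_perm hp).proj_eq, proj_cons_self, proj_eq_nil_iff.2 (cons_iff.1 h1).1]

theorem proj_of_notMem {u : List V} {s : V} (hs : s ∉ u) (x : Bool) (hx : x ∈ proj G s u) :
    x = false := by
  cases x
  · rfl
  · exact absurd (true_mem_proj.1 hx) hs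

theorem fc {u : List V} (hu : Indep G u) : FC G u := fun s => by
  by_cases hs : s ∈ u
  · rw [hu.proj_self hs]; simp [Good.cons_true, Good.nil]
  · constructor
    · intro h
      have := proj_of_notMem hs true (h.subset (by simp))
      simp at this
    · intro h
      have := proj_of_notMem hs true (h.subset (by simp))
      simp at this

end Indep

/-- If no letter of a fully commutative word has a neighbour in the word, then the letters are
distinct and pairwise non-adjacent. -/
theorem FC.indep {u : List V} (hu : FC G u) (h : ∀ s ∈ u, ∀ t ∈ u, ¬ G.Adj s t) : Indep G u := by
  induction u with
  | nil => exact List.Pairwise.nil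
  | cons s u ih =>
    refine Indep.cons_iff.2 ⟨?_, ih hu.of_cons fun a ha b hb => h a (by simp [ha]) b (by simp [hb])⟩
    intro t ht
    refine ⟨?_, h s (by simp) t (by simp [ht])⟩
    rintro rfl
    have h1 := hu s
    rw [proj_cons_self, Good.cons_true] at h1
    have h2 : true ∈ proj G s u := true_mem_proj.2 ht
    rcases h3 : proj G s u with _ | ⟨x, l⟩
    · simp [h3] at h2
    · cases x
      · have : false ∈ proj G s u := by simp [h3]
        obtain ⟨r, hr, hr'⟩ := false_mem_proj.1 this
        exact h s (by simp) r (by simp [hr]) hr'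
      · rw [h3] at h1; simp at h1

end Words

/-! ### Periodic words in type `E_n` -/

/-- Adjacency in the infinite graph `E_∞`, on the natural numbers. -/
def NatAdj (a b : ℕ) : Prop :=
  (1 ≤ a ∧ b = a + 1) ∨ (1 ≤ b ∧ a = b + 1) ∨ (a = 0 ∧ b = 3) ∨ (a = 3 ∧ b = 0)

theorem graph_adj_iff {n : ℕ} (i j : Fin n) : (graph n).Adj i j ↔ NatAdj i j := by
  simp only [graph, SimpleGraph.fromRel_adj, NatAdj, ne_eq, Fin.ext_iff]
  omega

section Sequence

variable (y : ℕ → ℕ)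

/-- Two consecutive occurrences `i < j` of the letter `a`. -/
def Consec (a i j : ℕ) : Prop :=
  i < j ∧ y i = a ∧ y j = a ∧ ∀ k, i < k → k < j → y k ≠ a

/-- Each letter that has a neighbour in the sequence `y` has at least two neighbours strictly
between any two of its consecutive occurrences. -/
def GapCondition : Prop :=
  ∀ a i j, Consec y a i j → (∃ k, NatAdj a (y k)) →
    ∃ k l, i < k ∧ k < l ∧ l < j ∧ NatAdj a (y k) ∧ NatAdj a (y l)

variable {y}

theorem exists_consec (hrec : ∀ i N, ∃ j, N ≤ j ∧ y j = y i) (i : ℕ) :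
    ∃ j, Consec y (y i) i j := by
  have h : ∃ j, i < j ∧ y j = y i := by
    obtain ⟨j, hj, h⟩ := hrec i (i + 1)
    exact ⟨j, hj, h⟩
  refine ⟨Nat.find h, (Nat.find_spec h).1, rfl, (Nat.find_spec h).2, fun k hk hk' hy => ?_⟩
  exact Nat.find_min h hk' ⟨hk, hy⟩

theorem exists_consec_of_lt {a i j : ℕ} (hij : i < j) (hi : y i = a) (hj : y j = a) :
    ∃ k, Consec y a i k ∧ k ≤ j := by
  have h : ∃ k, i < k ∧ y k = a := ⟨j, hij, hj⟩
  refine ⟨Nat.find h, ⟨(Nat.find_spec h).1, hi, (Nat.find_spec h).2, fun k hk hk' hy => ?_⟩, ?_⟩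
  · exact Nat.find_min h hk' ⟨hk, hy⟩
  · exact Nat.find_min' h ⟨hij, hj⟩

/-- Two occurrences of a letter on the long arm are separated by its inner neighbour. -/
theorem exists_inner_between {n : ℕ} (hy : ∀ i, y i < n) (hg : GapCondition y) {m : ℕ}
    (hm : 4 ≤ m) : ∀ i j, i < j → y i = m → y j = m → (∃ k, NatAdj m (y k)) →
      ∃ k, i < k ∧ k < j ∧ y k = m - 1 := by
  by_cases hmn : n ≤ m
  · intro i j _ hi
    have := hy i
    omega
  -- Induction on the distance from the free end of the arm. At the end the inner neighbour is the
  -- only one; further in, two outer neighbours in a gap would enclose another `m`.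
  · obtain ⟨d, hd⟩ : ∃ d, n = m + 1 + d := ⟨n - (m + 1), by omega⟩
    induction d generalizing m with
    | zero =>
      intro i j hij hi hj hk
      obtain ⟨j', hj', hle⟩ := exists_consec_of_lt hij hi hj
      obtain ⟨k, l, h1, h2, h3, h4, -⟩ := hg _ _ _ hj' hk
      refine ⟨k, h1, by omega, ?_⟩
      have := hy k
      unfold NatAdj at h4
      omega
    | succ d ih =>
      intro i j hij hi hj hk
      obtain ⟨j', hj', hle⟩ := exists_consec_of_lt hij hi hj
      obtain ⟨k, l, h1, h2, h3, h4, h5⟩ := hg _ _ _ hj' hk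
      by_contra! hcon
      have hk' : y k = m + 1 := by
        have := hcon k h1 (by omega)
        unfold NatAdj at h4
        omega
      have hl' : y l = m + 1 := by
        have := hcon l (by omega) (by omega)
        unfold NatAdj at h5
        omega
      obtain ⟨p, hp1, hp2, hp3⟩ := ih (m := m + 1) (by omega) (by omega) (by omega) k l h2 hk' hl'
        ⟨i, by unfold NatAdj; omega⟩
      exact hj'.2.2.2 p (by omega) (by omega) (by simpa using hp3)

/-- The vertex `1` is a leaf, so the two neighbours that the gap condition provides are both `2`. -/
theorem exists_two_between_one (hg : GapCondition y) {i j : ℕ} (hij : i < j) (hi : y i = 1)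
    (hj : y j = 1) (hk : ∃ k, y k = 2) :
    ∃ k l, i < k ∧ k < l ∧ l < j ∧ y k = 2 ∧ y l = 2 := by
  obtain ⟨j', hj', hle⟩ := exists_consec_of_lt hij hi hj
  obtain ⟨r, hr⟩ := hk
  obtain ⟨k, l, h1, h2, h3, h4, h5⟩ := hg _ _ _ hj' ⟨r, by unfold NatAdj; omega⟩
  refine ⟨k, l, h1, h2, by omega, ?_, ?_⟩ <;> unfold NatAdj at h4 h5 <;> omega

/-- Otherwise both neighbours in a gap of `2` are `1`, and between two letters `1` there is a
further `2`. -/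
theorem exists_three_between_two (hg : GapCondition y) {i j : ℕ} (hij : i < j) (hi : y i = 2)
    (hj : y j = 2) (hk : ∃ k, NatAdj 2 (y k)) : ∃ k, i < k ∧ k < j ∧ y k = 3 := by
  obtain ⟨j', hj', hle⟩ := exists_consec_of_lt hij hi hj
  obtain ⟨k, l, h1, h2, h3, h4, h5⟩ := hg _ _ _ hj' hk
  by_contra! hcon
  have hk' : y k = 1 := by
    have := hcon k h1 (by omega)
    unfold NatAdj at h4
    omega
  have hl' : y l = 1 := by
    have := hcon l (by omega) (by omega)
    unfold NatAdj at h5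
    omega
  obtain ⟨p, q, hp1, hp2, hp3, hp4, -⟩ := exists_two_between_one hg h2 hk' hl' ⟨i, hi⟩
  exact hj'.2.2.2 p (by omega) (by omega) hp4

theorem exists_threes_between_zero (hg : GapCondition y) {i j : ℕ} (hij : i < j) (hi : y i = 0)
    (hj : y j = 0) (hk : ∃ k, y k = 3) :
    ∃ k l, i < k ∧ k < l ∧ l < j ∧ y k = 3 ∧ y l = 3 := by
  obtain ⟨j', hj', hle⟩ := exists_consec_of_lt hij hi hj
  obtain ⟨r, hr⟩ := hk
  obtain ⟨k, l, h1, h2, h3, h4, h5⟩ := hg _ _ _ hj' ⟨r, by unfold NatAdj; omega⟩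
  refine ⟨k, l, h1, h2, by omega, ?_, ?_⟩ <;> unfold NatAdj at h4 h5 <;> omega

/-- Adjacent gaps of a gap of the letter `3` that contains `0` contain `2`. -/
theorem exists_two_of_gap {n : ℕ} (hy : ∀ i, y i < n) (hg : GapCondition y) {a b : ℕ}
    (hab : Consec y 3 a b) (h0 : ∀ k, a < k → k < b → y k ≠ 0) (hk : ∃ k, NatAdj 3 (y k)) :
    ∃ k, a < k ∧ k < b ∧ y k = 2 := by
  obtain ⟨k, l, h1, h2, h3, h4, h5⟩ := hg _ _ _ hab hk
  by_contra! hcon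
  have hk' : y k = 4 := by
    have := hcon k h1 (by omega)
    have := h0 k h1 (by omega)
    unfold NatAdj at h4
    omega
  have hl' : y l = 4 := by
    have := hcon l (by omega) (by omega)
    have := h0 l (by omega) (by omega)
    unfold NatAdj at h5
    omega
  obtain ⟨p, hp1, hp2, hp3⟩ := exists_inner_between hy hg le_rfl k l h2 hk' hl'
    ⟨a, by have := hab.2.1; unfold NatAdj; omega⟩
  exact hab.2.2.2 p (by omega) (by omega) (by simpa using hp3)

/-- Every gap of the letter `3` that has a predecessor contains `4`. -/
theorem exists_four_of_gap {n : ℕ} (hy : ∀ i, y i < n) (hrec : ∀ i N, ∃ j, N ≤ j ∧ y j = y i)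
    (hg : GapCondition y) {a a' b : ℕ} (haa : Consec y 3 a' a)
    (hab : Consec y 3 a b) (hk : ∃ k, NatAdj 3 (y k)) :
    ∃ k, a < k ∧ k < b ∧ y k = 4 := by
  by_contra! hcon
  obtain ⟨b', hbb⟩ : ∃ b', Consec y 3 b b' := by
    have := exists_consec hrec b
    rwa [hab.2.2.1] at this
  have ha3 := hab.2.1
  have hb3 := hab.2.2.1
  have hn2 : ∃ k, NatAdj 2 (y k) := ⟨a, by unfold NatAdj; omega⟩
  -- Without `4`, the two neighbours in the gap are among `0` and `2`. Equal ones would be separated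
  -- by a `3`, so there is one of each.
  have key : ∃ p q, (a < p ∧ p < b ∧ y p = 0) ∧ (a < q ∧ q < b ∧ y q = 2) := by
    obtain ⟨k, l, h1, h2, h3, h4, h5⟩ := hg _ _ _ hab hk
    have h6 := hcon k h1 (by omega)
    have h7 := hcon l (by omega) (by omega)
    have h8 : y k = 0 ∨ y k = 2 := by unfold NatAdj at h4; omega
    have h9 : y l = 0 ∨ y l = 2 := by unfold NatAdj at h5; omega
    rcases h8 with h8 | h8 <;> rcases h9 with h9 | h9
    · obtain ⟨p, q, hp1, hp2, hp3, hp4, -⟩ := exists_threes_between_zero hg h2 h8 h9 ⟨a, ha3⟩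
      exact absurd hp4 (hab.2.2.2 p (by omega) (by omega))
    · exact ⟨k, l, ⟨h1, by omega, h8⟩, ⟨by omega, h3, h9⟩⟩
    · exact ⟨l, k, ⟨by omega, h3, h9⟩, ⟨h1, by omega, h8⟩⟩
    · obtain ⟨p, hp1, hp2, hp3⟩ := exists_three_between_two hg h2 h8 h9 hn2
      exact absurd hp3 (hab.2.2.2 p (by omega) (by omega))
  obtain ⟨p, q, ⟨hp1, hp2, hp3⟩, ⟨hq1, hq2, hq3⟩⟩ := key
  -- a gap next to the one that contains `0` at `p` cannot contain `0`
  obtain ⟨q', hq1', hq2', hq3'⟩ := exists_two_of_gap hy hg haa (fun k hk1 hk2 hk3 => by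
    obtain ⟨r, r', h1, h2, h3, h4, h5⟩ :=
      exists_threes_between_zero hg (show k < p by omega) hk3 hp3 ⟨a, ha3⟩
    have e1 : r = a := by
      rcases lt_trichotomy r a with h | h | h
      · exact absurd h4 (haa.2.2.2 r (by omega) h)
      · exact h
      · exact absurd h4 (hab.2.2.2 r h (by omega))
    exact hab.2.2.2 r' (by omega) (by omega) h5) hk
  obtain ⟨q'', hq1'', hq2'', hq3''⟩ := exists_two_of_gap hy hg hbb (fun k hk1 hk2 hk3 => by
    obtain ⟨r, r', h1, h2, h3, h4, h5⟩ :=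
      exists_threes_between_zero hg (show p < k by omega) hp3 hk3 ⟨a, ha3⟩
    have e1 : r' = b := by
      rcases lt_trichotomy r' b with h | h | h
      · exact absurd h5 (hab.2.2.2 r' (by omega) h)
      · exact h
      · exact absurd h5 (hbb.2.2.2 r' h (by omega))
    exact hab.2.2.2 r (by omega) (by omega) h4) hk
  -- Two letters `2` are separated by a `3`, so each of the three successive gaps holds at most one
  -- `2`.
  have no_two : ∀ k, q' < k → k < q'' → y k = 2 → k = q := by
    intro k h1 h2 h3
    by_contra hne
    have h5 : ∃ r, r ≠ a ∧ r ≠ b ∧ a' < r ∧ r < b' ∧ y r = 3 := by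
      rcases lt_trichotomy k a with h | h | h
      · obtain ⟨r, hr1, hr2, hr3⟩ := exists_three_between_two hg h1 hq3' h3 hn2
        exact ⟨r, by omega, by omega, by omega, by omega, hr3⟩
      · subst h; omega
      · rcases lt_trichotomy k b with h' | h' | h'
        · rcases lt_or_gt_of_ne hne with h4 | h4
          · obtain ⟨r, hr1, hr2, hr3⟩ := exists_three_between_two hg h4 h3 hq3 hn2
            exact ⟨r, by omega, by omega, by omega, by omega, hr3⟩
          · obtain ⟨r, hr1, hr2, hr3⟩ := exists_three_between_two hg h4 hq3 h3 hn2
            exact ⟨r, by omega, by omega, by omega, by omega, hr3⟩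
        · subst h'; omega
        · obtain ⟨r, hr1, hr2, hr3⟩ := exists_three_between_two hg h2 h3 hq3'' hn2
          exact ⟨r, by omega, by omega, by omega, by omega, hr3⟩
    obtain ⟨r, hr1, hr2, hr3, hr4, hr5⟩ := h5
    rcases lt_or_gt_of_ne hr1 with h | h
    · exact haa.2.2.2 r hr3 h hr5
    · rcases lt_or_gt_of_ne hr2 with h' | h'
      · exact hab.2.2.2 r h h' hr5
      · exact hbb.2.2.2 r h' hr4 hr5
  -- A gap of `2` with a single `3` in it must get its second neighbour from the letter `1`.
  have one_between : ∀ i j c, Consec y 2 i j → i < c → c < j → y c = 3 →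
      (∀ k, i < k → k < j → y k = 3 → k = c) → ∃ k, i < k ∧ k < j ∧ y k = 1 := by
    intro i j c hij _ _ _ hc
    obtain ⟨k, l, h1, h2, h3, h4, h5⟩ := hg _ _ _ hij hn2
    by_contra! hcon
    have e1 := hc k h1 (by omega) (by
      have := hcon k h1 (by omega)
      unfold NatAdj at h4; omega)
    have e2 := hc l (by omega) (by omega) (by
      have := hcon l (by omega) (by omega)
      unfold NatAdj at h5; omega)
    omega
  obtain ⟨r, hr1, hr2, hr3⟩ := one_between q' q a
    ⟨by omega, hq3', hq3, fun k h1 h2 h3 => by have := no_two k h1 (by omega) h3; omega⟩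
    (by omega) (by omega) ha3 (fun k h1 h2 h3 => by
      rcases lt_trichotomy k a with h | h | h
      · exact absurd h3 (haa.2.2.2 k (by omega) h)
      · exact h
      · exact absurd h3 (hab.2.2.2 k h (by omega)))
  obtain ⟨r', hr1', hr2', hr3'⟩ := one_between q q'' b
    ⟨by omega, hq3, hq3'', fun k h1 h2 h3 => by have := no_two k (by omega) h2 h3; omega⟩
    (by omega) (by omega) hb3 (fun k h1 h2 h3 => by
      rcases lt_trichotomy k b with h | h | h
      · exact absurd h3 (hab.2.2.2 k (by omega) h)
      · exact h
      · exact absurd h3 (hbb.2.2.2 k h (by omega)))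
  -- The letters `1` found on both sides of `q` require two letters `2` between them, but only the
  -- one at `q` is available.
  obtain ⟨k, l, h1, h2, h3, h4, h5⟩ :=
    exists_two_between_one hg (show r < r' by omega) hr3 hr3' ⟨q, hq3⟩
  have e1 := no_two k (by omega) (by omega) h4
  have e2 := no_two l (by omega) (by omega) h5
  omega

/-- Every gap of `3` with a predecessor contains `4`. Inductively, far enough out, any two
occurrences of `m` are separated by `m + 1`: two letters `m` inside a gap of `m + 1` would enclose
another `m + 1`, so the gap must contain `m + 2`. The letters would then climb along the arm beyond
its end. -/
theorem not_gap_of_three {n : ℕ} (hy : ∀ i, y i < n) (hrec : ∀ i N, ∃ j, N ≤ j ∧ y j = y i)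
    (hg : GapCondition y) {i : ℕ} (hi : y i = 3) (hk : ∃ k, NatAdj 3 (y k)) : False := by
  have next : ∀ c, y c = 3 → ∃ d, Consec y 3 c d := fun c hc => by
    have := exists_consec hrec c
    rwa [hc] at this
  -- for `3 ≤ m`, consecutive occurrences of `m` beyond a bound are separated by `m + 1`
  have key : ∀ m, 3 ≤ m → (∃ k, y k = m) ∧ (∃ k, NatAdj m (y k)) ∧
      ∃ N, ∀ a b, N ≤ a → a < b → y a = m → y b = m → ∃ k, a < k ∧ k < b ∧ y k = m + 1 := by
    intro m hm
    induction m, hm using Nat.le_induction with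
    | base =>
      -- The bound `i + 1` makes the occurrence at `i` precede `a`, which guarantees the predecessor
      -- gap.
      refine ⟨⟨i, hi⟩, hk, i + 1, fun a b hN hlt ha hb => ?_⟩
      obtain ⟨b', hb', hle⟩ := exists_consec_of_lt hlt ha hb
      -- the predecessor of `a`
      have hpre : ∃ a', Consec y 3 a' a := by
        have hP : ∃ d, d < a ∧ y (a - 1 - d) = 3 := ⟨a - 1 - i, by omega, by
          rw [show a - 1 - (a - 1 - i) = i by omega]; exact hi⟩
        refine ⟨a - 1 - Nat.find hP, ?_, (Nat.find_spec hP).2, ha, fun k h1 h2 h3 => ?_⟩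
        · have := (Nat.find_spec hP).1
          omega
        · refine Nat.find_min hP (m := a - 1 - k) (by omega) ⟨by omega, ?_⟩
          rw [show a - 1 - (a - 1 - k) = k by omega]; exact h3
      obtain ⟨a', ha'⟩ := hpre
      obtain ⟨k, h1, h2, h3⟩ := exists_four_of_gap hy hrec hg ha' hb' hk
      exact ⟨k, h1, by omega, h3⟩
    | succ m hm ih =>
      obtain ⟨⟨p, hp⟩, -, N, hN⟩ := ih
      obtain ⟨p', hp', hpm⟩ := hrec p N
      obtain ⟨p'', hp''⟩ := exists_consec hrec p'
      rw [hpm, hp] at hp''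
      obtain ⟨c, hc1, hc2, hc3⟩ := hN p' p'' hp' hp''.1 hp''.2.1 hp''.2.2.1
      have hna : ∃ k, NatAdj (m + 1) (y k) := ⟨p, by unfold NatAdj; omega⟩
      refine ⟨⟨c, hc3⟩, hna, N, fun a b hNa hlt ha hb => ?_⟩
      obtain ⟨b', hb', hle⟩ := exists_consec_of_lt hlt ha hb
      obtain ⟨k, l, h1, h2, h3, h4, h5⟩ := hg _ _ _ hb' hna
      by_contra! hcon
      have e1 : y k = m := by
        have := hcon k h1 (by omega)
        unfold NatAdj at h4
        omega
      have e2 : y l = m := by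
        have := hcon l (by omega) (by omega)
        unfold NatAdj at h5
        omega
      obtain ⟨q, hq1, hq2, hq3⟩ := hN k l (by omega) h2 e1 e2
      exact hb'.2.2.2 q (by omega) (by omega) hq3
  have h3n : 3 < n := hi ▸ hy i
  obtain ⟨⟨k, hk⟩, -⟩ := key n (by omega)
  have := hy k
  omega

/-- A sequence in which each letter recurs and which satisfies the gap condition has no two
adjacent letters. -/
theorem not_adj_of_gapCondition {n : ℕ} (hy : ∀ i, y i < n)
    (hrec : ∀ i N, ∃ j, N ≤ j ∧ y j = y i) (hg : GapCondition y) (i k : ℕ) :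
    ¬ NatAdj (y i) (y k) := by
  have h3 : ∀ i, y i = 3 → ∀ k, ¬ NatAdj 3 (y k) := fun i hi k hk =>
    not_gap_of_three hy hrec hg hi ⟨k, hk⟩
  have h2 : ∀ i, y i = 2 → ∀ k, ¬ NatAdj 2 (y k) := by
    intro i hi k hk
    obtain ⟨j, hj⟩ := exists_consec hrec i
    rw [hi] at hj
    obtain ⟨r, -, -, hr⟩ := exists_three_between_two hg hj.1 hj.2.1 hj.2.2.1 ⟨k, hk⟩
    exact h3 r hr i (by unfold NatAdj; omega)
  have harm : ∀ m, 4 ≤ m → ∀ i, y i = m → ∀ k, ¬ NatAdj m (y k) := by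
    intro m hm
    induction m, hm using Nat.le_induction with
    | base =>
      intro i hi k hk
      obtain ⟨j, hj⟩ := exists_consec hrec i
      rw [hi] at hj
      obtain ⟨r, -, -, hr⟩ := exists_inner_between hy hg le_rfl _ _ hj.1 hj.2.1 hj.2.2.1 ⟨k, hk⟩
      exact h3 r hr i (by unfold NatAdj; omega)
    | succ m hm ih =>
      intro i hi k hk
      obtain ⟨j, hj⟩ := exists_consec hrec i
      rw [hi] at hj
      obtain ⟨r, -, -, hr⟩ :=
        exists_inner_between hy hg (by omega) _ _ hj.1 hj.2.1 hj.2.2.1 ⟨k, hk⟩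
      exact ih r (by omega) i (by unfold NatAdj; omega)
  intro h
  have hsym : NatAdj (y k) (y i) := by unfold NatAdj at h ⊢; omega
  rcases (show y i = 2 ∨ y i = 3 ∨ 4 ≤ y i ∨ y k = 2 ∨ y k = 3 by unfold NatAdj at h; omega) with
    e | e | e | e | e
  · exact h2 i e k (e ▸ h)
  · exact h3 i e k (e ▸ h)
  · exact harm _ e i rfl k h
  · exact h2 k e i (e ▸ hsym)
  · exact h3 k e i (e ▸ hsym)

end Sequence

/-- Each word in which some letter has a neighbour can be rotated to `s :: u`, such that there is
at most one neighbour of `s` between the first `s` and its next cyclic occurrence, where the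
letter `s` has a neighbour in `u`. -/
def CyclicallyReducible {V : Type*} (G : SimpleGraph V) : Prop :=
  ∀ w : List V, (∃ s ∈ w, ∃ t ∈ w, G.Adj s t) →
    ∃ s u, (s :: u) ~r w ∧ false ∈ proj G s u ∧
      (proj G s u = [false] ∨ [true] <+: proj G s u ∨ [false, true] <+: proj G s u)

/-- Unroll the cyclic word into a periodic sequence. Every letter recurs, so adjacent letters force
the gap condition to fail; a gap that violates it marks where to cut the cyclic word. -/
theorem cyclicallyReducible_graph (n : ℕ) : CyclicallyReducible (graph n) := by
  rintro w ⟨s₀, hs₀, t₀, ht₀, hst₀⟩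
  have hp : 0 < w.length := List.length_pos_of_mem hs₀
  set p := w.length with hpdef
  let x : ℕ → Fin n := fun i => w[i % p]'(Nat.mod_lt _ hp)
  have hx : ∀ t ∈ w, ∃ i, x i = t := fun t ht => by
    obtain ⟨i, hi, rfl⟩ := List.getElem_of_mem ht
    exact ⟨i, by simp only [x, Nat.mod_eq_of_lt (show i < p from hi)]⟩
  have hper : ∀ i k, x (i + p * k) = x i := fun i k => by simp [x]
  have hxw : ∀ i, x i ∈ w := fun i => List.getElem_mem _
  have hng : ¬ GapCondition (fun i => (x i : ℕ)) := by
    intro hg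
    obtain ⟨i, hi⟩ := hx s₀ hs₀
    obtain ⟨k, hk⟩ := hx t₀ ht₀
    refine not_adj_of_gapCondition (n := n) (fun i => (x i).2) (fun i N => ⟨i + p * N, ?_, ?_⟩)
      hg i k ?_
    · nlinarith
    · simp [hper]
    · simp only [hi, hk]
      exact (graph_adj_iff _ _).1 hst₀
  simp only [GapCondition, not_forall] at hng
  obtain ⟨a, i, j, ⟨hij, hi, hj, hno⟩, ⟨r, hr⟩, hgap⟩ := hng
  replace hi : (x i : ℕ) = a := hi
  replace hj : (x j : ℕ) = a := hj
  set s := x i with hs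
  have hxj : x j = s := Fin.ext (hj.trans hi.symm)
  have hno' : ∀ k, i < k → k < j → x k ≠ s := fun k h1 h2 h3 => hno k h1 h2 (by
    simp only [h3]; exact hi)
  have hgap' : ∀ k l, i < k → k < l → l < j → (graph n).Adj s (x k) →
      ¬ (graph n).Adj s (x l) := by
    intro k l h1 h2 h3 h4 h5
    refine hgap ⟨k, l, h1, h2, h3, ?_, ?_⟩
    · rw [← hi]; exact (graph_adj_iff _ _).1 h4
    · rw [← hi]; exact (graph_adj_iff _ _).1 h5
  -- The letter at `i` returns after one full period, so the violating gap fits into a single turn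
  -- of the cyclic word.
  have hjp : j ≤ i + p := by
    by_contra! h
    exact hno' (i + p) (by omega) h (by simpa using hper i 1)
  set cw := w.rotate i with hc
  have hclen : cw.length = p := by simp [hc, hpdef]
  have hcx : ∀ k, (hk : k < cw.length) → cw[k]'hk = x (i + k) := by
    intro k hk
    simp only [hc, List.getElem_rotate, x]
    congr 2
    rw [add_comm]
  obtain ⟨u, hu⟩ : ∃ u, cw = s :: u := by
    rcases hcu : cw with _ | ⟨s', u⟩
    · rw [hcu] at hclen; simp at hclen; omega
    · have := hcx 0 (by omega)
      simp only [hcu, List.getElem_cons_zero, add_zero] at this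
      exact ⟨u, by rw [this, hs]⟩
  have hulen : u.length + 1 = p := by rw [← hclen, hu]; simp
  have hux : ∀ k, (hk : k < u.length) → u[k]'hk = x (i + 1 + k) := by
    intro k hk
    have := hcx (k + 1) (by omega)
    simp only [hu, List.getElem_cons_succ] at this
    rw [this]
    congr 1
    omega
  have hrot : (s :: u) ~r w := by
    rw [← hu]
    exact (List.IsRotated.symm ⟨i, rfl⟩)
  refine ⟨s, u, hrot, ?_, ?_⟩
  · rw [false_mem_proj]
    have h1 : x r ∈ s :: u := (hrot.mem_iff).2 (hxw r)
    have h2 : (graph n).Adj s (x r) := (graph_adj_iff _ _).2 (by rw [hi]; exact hr)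
    rcases List.mem_cons.1 h1 with h3 | h3
    · exact absurd h3 h2.ne'
    · exact ⟨_, h3, h2⟩
  -- the part of `u` before the next occurrence of `s`
  set d := j - i - 1 with hd
  set m := u.take d with hm
  have hmlen : m.length = d := by simp [hm]; omega
  have hmx : ∀ k t, m[k]? = some t → k < d ∧ x (i + 1 + k) = t := by
    intro k t hkt
    obtain ⟨hk, h⟩ := List.getElem?_eq_some_iff.1 hkt
    refine ⟨by omega, ?_⟩
    rw [← hux k (by omega), ← h]
    simp [hm]
  have hsm : s ∉ m := fun h => by
    obtain ⟨k, hk⟩ := List.mem_iff_getElem?.1 h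
    obtain ⟨h1, h2⟩ := hmx k s hk
    exact hno' _ (by omega) (by omega) h2
  have hmproj : proj (graph n) s m = [] ∨ proj (graph n) s m = [false] := by
    rcases h1 : proj (graph n) s m with _ | ⟨b, l⟩
    · exact .inl rfl
    · right
      have hfalse : ∀ b ∈ proj (graph n) s m, b = false := fun b hb => by
        cases b
        · rfl
        · exact absurd (true_mem_proj.1 hb) hsm
      obtain rfl : b = false := hfalse b (by simp [h1])
      rcases l with _ | ⟨b, l⟩
      · rfl
      · obtain rfl : b = false := hfalse b (by simp [h1])
        exfalso
        obtain ⟨a₁, t₁, c₁, hm₁, -, ht₁, hc₁⟩ := proj_eq_cons h1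
        obtain ⟨a₂, t₂, c₂, rfl, -, ht₂, -⟩ := proj_eq_cons hc₁
        simp only [Bool.false_eq_true, if_false] at ht₁ ht₂
        obtain ⟨h3, h4⟩ := hmx a₁.length t₁ (by rw [hm₁]; simp)
        obtain ⟨h5, h6⟩ := hmx (a₁.length + (a₂.length + 1)) t₂ (by
          rw [hm₁, List.getElem?_append_right (by omega)]; simp)
        exact hgap' _ _ (by omega) (by omega) (by omega) (h4 ▸ ht₁) (h6 ▸ ht₂)
  -- Either the gap ends at a second occurrence of `s` in the word, or `s` occurs only once and the
  -- gap is the whole turn.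
  rcases Nat.lt_or_ge d u.length with hdu | hdu
  · have hud : u = m ++ s :: u.drop (d + 1) := by
      have e1 : u[d] = s := by
        rw [hux d hdu, show i + 1 + d = j by omega, hxj]
      rw [hm, ← e1, ← List.drop_eq_getElem_cons hdu, List.take_append_drop]
    right
    rw [hud, proj_append, proj_cons_self]
    rcases hmproj with h | h
    · left; rw [h]; simp
    · right; rw [h]; simp
  · have hum : m = u := List.take_of_length_le hdu
    have h2 : proj (graph n) s u ≠ [] := by
      have h1 : x r ∈ s :: u := (hrot.mem_iff).2 (hxw r)
      have h2 : (graph n).Adj s (x r) := (graph_adj_iff _ _).2 (by rw [hi]; exact hr)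
      rcases List.mem_cons.1 h1 with h3 | h3
      · exact absurd h3 h2.ne'
      · have := (false_mem_proj (G := graph n)).2 ⟨_, h3, h2⟩
        exact List.ne_nil_of_mem this
    rw [hum] at hmproj
    exact .inl (hmproj.resolve_left h2)

/-! ### Induction on cyclic words -/

section

variable {V : Type*} {G : SimpleGraph V}

/-- An induction principle: up to commutations, rotations and the reductions of the
Temperley-Lieb monoid, each word is a product of distinct pairwise commuting letters. -/
theorem CyclicallyReducible.induction (hG : CyclicallyReducible G) {P : List V → Prop}
    (indep : ∀ u, Indep G u → P u) (comm : ∀ u v, CommEq G u v → P u → P v)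
    (rot : ∀ u v, P (u ++ v) → P (v ++ u))
    (sq : ∀ s u, P (s :: s :: u) ↔ P (s :: u))
    (braid : ∀ s t u, G.Adj s t → P (s :: u) → P (s :: t :: s :: u)) (w : List V) : P w := by
  induction hl : w.length using Nat.strong_induction_on generalizing w with
  | _ l ih =>
    subst hl
    have hrot : ∀ u v : List V, u ~r v → P u → P v := by
      intro u v huv hu
      obtain ⟨k, rfl⟩ := huv
      rw [List.rotate_eq_drop_append_take_mod]
      refine rot _ _ ?_
      rwa [List.take_append_drop]
    have hfc : ∀ w' : List V, w'.length = w.length → ¬ FC G w' → P w' := by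
      intro w' hlen h
      rcases FC.sq_or_braid h with ⟨a, c, s, h'⟩ | ⟨a, c, s, t, hst, h'⟩
      · refine comm _ _ h'.symm (rot (s :: s :: c) a ((sq s (c ++ a)).2 ?_))
        have := h'.length
        exact ih _ (by simp at this ⊢; omega) _ rfl
      · refine comm _ _ h'.symm (rot (s :: t :: s :: c) a (braid s t (c ++ a) hst ?_))
        have := h'.length
        exact ih _ (by simp at this ⊢; omega) _ rfl
    by_cases hw : FC G w
    swap
    · exact hfc w rfl hw
    by_cases hadj : ∃ s ∈ w, ∃ t ∈ w, G.Adj s t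
    swap
    · push Not at hadj
      exact indep w (hw.indep hadj)
    obtain ⟨s, u, hsu, -, h⟩ := hG w hadj
    refine hrot _ _ hsu ?_
    have hlen : (s :: u).length = w.length := hsu.perm.length_eq
    rcases h with h | h | h
    · obtain ⟨a, t, c, rfl, ha, hst, hc⟩ := proj_eq_cons h
      rw [proj_eq_nil_iff] at hc
      simp only [Bool.false_eq_true, if_false] at hst
      -- `s a t c ~ a s t c`, rotate to `s t c a`
      have h1 : P (s :: c ++ a) := ih _ (by simp at hlen ⊢; omega) _ rfl
      -- The single neighbour `t` is inserted between two letters `s`; the second is carried past `c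
      -- ++ a` and around the cycle, and the resulting square is cancelled. For this the hypothesis
      -- `sq` must be an equivalence.
      have h2 := braid s t (c ++ a) hst h1
      have hca : Apart G s (c ++ a) := Apart.append.2 ⟨hc, ha⟩
      have h3 : P (s :: t :: (c ++ a) ++ [s]) :=
        comm _ _ ((hca.symm_comm.cons t).cons s) h2
      have h4 : P (s :: s :: t :: (c ++ a)) := rot _ [s] h3
      have h5 := (sq _ _).1 h4
      have h6 : P (a ++ s :: t :: c) := rot (s :: t :: c) a (by simpa using h5)
      exact comm _ _ (ha.comm (t :: c)) h6
    · refine hfc _ hlen fun hf => ?_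
      have := hf s
      rw [proj_cons_self, Good.cons_true] at this
      exact this.1 h
    · refine hfc _ hlen fun hf => ?_
      have := hf s
      rw [proj_cons_self, Good.cons_true] at this
      exact this.2.1 h

end

/-! ### Star reductions -/

section Star

variable {V : Type*} {G : SimpleGraph V}

/-- The maximal elements of a word can be moved to the front. -/
theorem exists_top (w : List V) : ∃ a u, CommEq G w (a ++ u) ∧ Indep G a ∧
    ∀ s, [true] <+: proj G s w → s ∈ a := by
  suffices h : ∀ k (a u : List V), u.length = k → CommEq G w (a ++ u) → Indep G a →
      ∃ a u, CommEq G w (a ++ u) ∧ Indep G a ∧ ∀ s, [true] <+: proj G s w → s ∈ a from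
    h _ [] w rfl (.refl _) List.Pairwise.nil
  intro k
  induction k with
  | zero =>
    intro a u hu hw ha
    obtain rfl := List.length_eq_zero_iff.1 hu
    refine ⟨a, [], hw, ha, fun s hs => ?_⟩
    have : s ∈ w := true_mem_proj.1 (hs.subset (by simp))
    simpa using hw.perm.mem_iff.1 this
  | succ k ih =>
    intro a u hu hw ha
    by_cases h : ∀ s, [true] <+: proj G s w → s ∈ a
    · exact ⟨a, u, hw, ha, h⟩
    push Not at h
    obtain ⟨s, hs, hsa⟩ := h
    rw [hw.proj_eq, proj_append] at hs
    have hnil : proj G s a = [] := by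
      rcases hp : proj G s a with _ | ⟨x, l⟩
      · rfl
      · have := Indep.proj_of_notMem (G := G) hsa x (by simp [hp])
        subst this
        simp [hp] at hs
    rw [hnil, List.nil_append] at hs
    obtain ⟨u', hu'⟩ := exists_cons_of_proj hs
    have hap := proj_eq_nil_iff.1 hnil
    refine ih (s :: a) u' ?_ ?_ (Indep.cons_iff.2 ⟨hap, ha⟩)
    · have := hu'.length
      simp at this
      omega
    · exact hw.trans ((hu'.append_left a).trans (hap.comm u'))

theorem Indep.reverse {a : List V} (ha : Indep G a) : Indep G a.reverse :=
  ha.of_perm (List.reverse_perm a).symm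

theorem Indep.proj_reverse {a : List V} (ha : Indep G a) (s : V) :
    (proj G s a).reverse = proj G s a := by
  rw [← TLE.proj_reverse]
  exact (ha.reverse.commEq_of_perm (List.reverse_perm a)).proj_eq s

/-- The minimal elements of a word can be moved to the end. -/
theorem exists_bottom (w : List V) : ∃ b u, CommEq G w (u ++ b) ∧ Indep G b ∧
    ∀ s, [true] <:+ proj G s w → s ∈ b := by
  obtain ⟨a, u, h1, h2, h3⟩ := exists_top (G := G) w.reverse
  refine ⟨a.reverse, u.reverse, by simpa using h1.reverse, h2.reverse, fun s hs => ?_⟩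
  rw [List.mem_reverse]
  refine h3 s ?_
  rw [proj_reverse]
  simpa using List.reverse_prefix.2 hs

theorem exists_append_of_proj {a w : List V} (ha : Indep G a)
    (h : ∀ t ∈ a, [true] <:+ proj G t w) : ∃ m, CommEq G w (m ++ a) := by
  induction a with
  | nil => exact ⟨w, by simpa using CommEq.refl w⟩
  | cons t a ih =>
    obtain ⟨h1, h2⟩ := Indep.cons_iff.1 ha
    obtain ⟨m, hm⟩ := ih h2 fun r hr => h r (by simp [hr])
    have ht := h t (by simp)
    rw [hm.proj_eq, proj_append, proj_eq_nil_iff.2 h1, List.append_nil] at ht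
    obtain ⟨m', hm'⟩ := exists_concat_of_proj ht
    exact ⟨m', hm.trans (by simpa using hm'.append_right a)⟩

/-- A left star reduction. -/
theorem exists_left_star {a u w : List V} {s : V} (hw : CommEq G w (a ++ u)) (ha : Indep G a)
    (hs : proj G s a = [false]) (hu : [true] <+: proj G s u) :
    ∃ t v, t ∈ a ∧ G.Adj s t ∧ CommEq G w (t :: s :: v) := by
  obtain ⟨a₁, t, a₂, rfl, h1, ht, h2⟩ := proj_eq_cons hs
  rw [proj_eq_nil_iff] at h2
  simp only [Bool.false_eq_true, if_false] at ht
  obtain ⟨v, hv⟩ := exists_cons_of_proj hu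
  refine ⟨t, a₁ ++ a₂ ++ v, by simp, ht, ?_⟩
  have e1 := (ha.commEq_of_perm (List.perm_middle)).append hv
  have e2 := ((Apart.append.2 ⟨h1, h2⟩).comm v).cons t
  exact hw.trans (e1.trans (by simpa using e2))

theorem exists_right_star {b u w : List V} {s : V} (hw : CommEq G w (u ++ b)) (hb : Indep G b)
    (hs : proj G s b = [false]) (hu : [true] <:+ proj G s u) :
    ∃ t v, t ∈ b ∧ G.Adj s t ∧ CommEq G w (v ++ [s, t]) := by
  obtain ⟨t, v, h1, h2, h3⟩ := exists_left_star (a := b.reverse) (u := u.reverse)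
    (by simpa using hw.reverse) hb.reverse (s := s) (by rw [proj_reverse, hs]; rfl)
    (by rw [proj_reverse]; simpa using List.reverse_prefix.2 hu)
  exact ⟨t, v.reverse, by simpa using h1, h2, by simpa using h3.reverse⟩

/-- A rotation of `c` is a factor of `c ++ c`. If `s` occurs only once, with a single neighbour, the
forbidden factor `true, false, true` appears only in the doubled word. -/
theorem not_good_of_rotation {s : V} {u c : List V} (h : (s :: u) ~r c)
    (h' : proj G s u = [false] ∨ [true] <+: proj G s u ∨ [false, true] <+: proj G s u) :
    ¬ Good (proj G s c ++ proj G s c) := by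
  intro hg
  have hsplit : ∃ c₁ c₂, c = c₁ ++ c₂ ∧ s :: u = c₂ ++ c₁ := by
    obtain ⟨k, hk⟩ := h.symm
    rw [List.rotate_eq_drop_append_take_mod] at hk
    exact ⟨_, _, (List.take_append_drop _ _).symm, hk.symm⟩
  obtain ⟨c₁, c₂, rfl, h2⟩ := hsplit
  have h3 : true :: proj G s u = proj G s c₂ ++ proj G s c₁ := by
    rw [← proj_append, ← h2, proj_cons_self]
  have h4 : Good (true :: proj G s u) := by
    rw [h3]
    exact hg.of_infix ⟨proj G s c₁, proj G s c₂, by simp⟩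
  rw [Good.cons_true] at h4
  rcases h' with h' | h' | h'
  · rw [h'] at h3
    rw [proj_append] at hg
    rcases h5 : proj G s c₂ with _ | ⟨x, l⟩
    · rw [h5, List.nil_append] at h3
      rw [h5, ← h3] at hg
      simp [Good.cons_true] at hg
    · rw [h5] at h3
      simp only [List.cons_append, List.cons.injEq] at h3
      obtain ⟨rfl, h3⟩ := h3
      rcases l with _ | ⟨y, l⟩
      · simp only [List.nil_append] at h3
        rw [h5, ← h3] at hg
        simp [Good.cons_true, Good.cons_false] at hg
      · simp only [List.cons_append, List.cons.injEq] at h3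
        obtain ⟨rfl, h3⟩ := h3
        have h6 := List.append_eq_nil_iff.1 h3.symm
        rw [h5, h6.1, h6.2] at hg
        simp [Good.cons_true, Good.cons_false] at hg
  · exact h4.1 h'
  · exact h4.2.1 h'

theorem suffix_singleton_append {x : Bool} {l l' : List Bool} (h : l' ≠ []) :
    [x] <:+ l ++ l' ↔ [x] <:+ l' := by
  obtain ⟨k, y, rfl⟩ := List.eq_nil_or_concat l' |>.resolve_left h
  constructor
  · rintro ⟨p, hp⟩
    rw [List.concat_eq_append, ← List.append_assoc] at hp
    have := List.append_inj_right' hp rfl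
    exact ⟨k, by rw [this, List.concat_eq_append]⟩
  · exact fun h => h.trans (List.suffix_append _ _)

theorem prefix_singleton_append {x : Bool} {l l' : List Bool} (h : l ≠ []) :
    [x] <+: l ++ l' ↔ [x] <+: l := by
  rcases l with _ | ⟨y, l⟩
  · exact absurd rfl h
  · simp

/-- A fully commutative word is a product of commuting letters or admits a left or a right star
reduction. -/
theorem FC.star (hG : CyclicallyReducible G) {w : List V} (hw : FC G w) :
    Indep G w ∨ (∃ s t u, G.Adj s t ∧ CommEq G w (s :: t :: u)) ∨
      ∃ s t u, G.Adj s t ∧ CommEq G w (u ++ [t, s]) := by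
  by_contra! hcon
  obtain ⟨h1, h2, h3⟩ := hcon
  have hadj : ∃ s ∈ w, ∃ t ∈ w, G.Adj s t := by
    by_contra! h
    exact h1 (hw.indep h)
  obtain ⟨a, u, hau, ha, hatop⟩ := exists_top (G := G) w
  obtain ⟨b, m, hmb, hb, hbot⟩ := exists_bottom (G := G) u
  have hamb : CommEq G w (a ++ m ++ b) := by simpa using hau.trans (hmb.append_left a)
  -- The word is closed up by reflection in its maximal letters `a` and its minimal letters `b`. If
  -- no star reduction exists, all projections of `c ++ c` are good, against cyclic reducibility.
  set c := a ++ m ++ b ++ m.reverse with hc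
  have hmem : ∀ s, s ∈ c ↔ s ∈ w := fun s => by
    rw [hamb.perm.mem_iff]
    simp only [hc, List.mem_append, List.mem_reverse]
    tauto
  obtain ⟨s, r, hrot, hfalse, hbad⟩ := hG c (by simpa [hmem] using hadj)
  have hnis : false ∈ proj G s w := by
    obtain ⟨t, ht, ht'⟩ := false_mem_proj.1 hfalse
    exact false_mem_proj.2 ⟨t, (hmem t).1 (hrot.mem_iff.1 (by simp [ht])), ht'⟩
  have hgood := hw s
  rw [hamb.proj_eq, proj_append, proj_append] at hgood
  have hprojw := hamb.proj_eq s
  have hproju := hmb.proj_eq s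
  rw [proj_append, proj_append] at hprojw
  rw [proj_append] at hproju
  refine not_good_of_rotation hrot hbad ?_
  have hpc : proj G s c =
      proj G s a ++ proj G s m ++ proj G s b ++ (proj G s m).reverse := by simp [hc]
  rw [hpc]
  have hα := ha.proj_reverse s
  have hβ := hb.proj_reverse s
  have hα1 : s ∈ a → proj G s a = [true] := ha.proj_self
  have hβ1 : s ∈ b → proj G s b = [true] := hb.proj_self
  have hau' : proj G s a = [false] → ¬ [true] <+: proj G s u := fun h4 h5 => by
    obtain ⟨t, v, -, h6, h7⟩ := exists_left_star hau ha h4 h5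
    exact h2 t s v h6.symm h7
  have hbu' : proj G s b = [false] → ¬ [true] <:+ proj G s (a ++ m) := fun h4 h5 => by
    obtain ⟨t, v, -, h6, h7⟩ := exists_right_star hamb hb h4 h5
    exact h3 t s v h6.symm h7
  have hb2 := hbot s
  have ha2 := hatop s
  rw [hprojw] at ha2 hnis
  rw [hproju] at hb2 hau'
  rw [proj_append] at hbu'
  generalize proj G s a = α at *
  generalize proj G s m = μ at *
  generalize proj G s b = β at *
  -- Reflection at the bottom: `α μ β` is glued to its reverse along `β`. A bad factor across `β =
  -- [false]` would give a right star reduction.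
  have d1 : Good ((α ++ μ) ++ (β ++ (α ++ μ).reverse)) := by
    refine Good.append_append hgood ?_ ?_ fun h => ?_
    · rw [← Good.reverse]
      simpa [hβ] using hgood
    · rintro rfl
      -- An `s` at the end would be minimal in `u`, hence in `b`; if `μ` is empty, it would be the
      -- only visible letter, although `s` has a neighbour in `w`.
      have : ¬ [true] <:+ α ++ μ := by
        intro h
        by_cases hμ : μ = []
        · subst hμ
          rw [List.append_nil] at h
          obtain rfl : α = [true] := by
            rcases α with _ | ⟨x, α⟩
            · simp at h
            · have : true ∈ x :: α := h.subset (by simp)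
              cases x
              · obtain ⟨y, hy⟩ := h
                rw [← hy] at hα
                simp only [List.reverse_append, List.reverse_cons, List.reverse_nil,
                  List.nil_append, List.singleton_append] at hα
                rw [hy] at hα
                simp at hα
              · exact hα1 (ha2 (by simp))
          simp at hnis
        · rw [suffix_singleton_append hμ] at h
          exact absurd (hβ1 (hb2 (by simpa using h))) (by simp)
      refine ⟨this, fun h => this ?_⟩
      simpa using List.reverse_suffix.2 h
    · exact fun k => hbu' h k.1
  -- Reflection at the top, glued along `α`; the case `α = [false]` is excluded by the absence of
  -- left star reductions.
  have d2 : Good ((α ++ μ ++ β ++ μ.reverse) ++ (α ++ (μ ++ β ++ μ.reverse ++ α))) := by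
    have hR : ∀ x : List Bool, α ≠ [true] → (α = [] ∨ α = [false]) →
        ¬ [true] <+: μ ++ β ++ μ.reverse ++ α := by
      rintro - - hα' h
      by_cases hn : μ ++ β = []
      · obtain ⟨rfl, rfl⟩ := List.append_eq_nil_iff.1 hn
        rcases hα' with rfl | rfl <;> simp at h
      · rw [List.append_assoc, prefix_singleton_append hn] at h
        rcases hα' with rfl | rfl
        · exact absurd (hα1 (ha2 (by simpa using h))) (by simp)
        · exact hau' rfl h
    refine Good.append_append ?_ ?_ ?_ ?_
    · simpa [hα] using d1
    · simpa [hα] using d1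
    · rintro rfl
      have := hR [] (by simp) (.inl rfl)
      refine ⟨fun h => this ?_, this⟩
      simpa [hβ] using List.reverse_prefix.2 h
    · rintro rfl
      exact fun h => hR [] (by simp) (.inr rfl) h.2
  refine d2.of_infix ⟨[], α, ?_⟩
  simp

/-- A fully commutative word with the same maximal and minimal elements is a product of commuting
letters, or can be conjugated to a shorter word. -/
theorem FC.conj (hG : CyclicallyReducible G) {w : List V} (hw : FC G w) (hind : ¬ Indep G w)
    (h : ∀ s, [true] <+: proj G s w ↔ [true] <:+ proj G s w) :
    ∃ s t u v, G.Adj s t ∧ CommEq G w (t :: s :: u) ∧ CommEq G (s :: u) (v ++ [s, t]) := by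
  have hadj : ∃ s ∈ w, ∃ t ∈ w, G.Adj s t := by
    by_contra! h
    exact hind (hw.indep h)
  obtain ⟨a, w₂, haw, ha, hatop⟩ := exists_top (G := G) w
  -- A maximal letter without neighbours in `w` occurs only once, so it cannot be split off at both
  -- ends. The others can, and `w` takes the form `a m a₀`.
  set a₀ := a.filter (fun t => false ∈ proj G t w) with ha₀
  have hind₀ : Indep G a₀ := ha.sublist List.filter_sublist
  obtain ⟨m, hm⟩ : ∃ m, CommEq G w₂ (m ++ a₀) := by
    refine exists_append_of_proj hind₀ fun t ht => ?_
    simp only [ha₀, List.mem_filter, decide_eq_true_eq] at ht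
    obtain ⟨h1, h2⟩ := ht
    have h3 := h t
    rw [haw.proj_eq, proj_append, ha.proj_self h1] at h3 h2
    have h4 : proj G t w₂ ≠ [] := by
      intro h4
      simp [h4] at h2
    rw [suffix_singleton_append h4] at h3
    exact h3.1 (by simp)
  have hamb : CommEq G w (a ++ m ++ a₀) := by simpa using haw.trans (hm.append_left a)
  have hmem : ∀ s, s ∈ a ++ m ↔ s ∈ w := fun s => by
    rw [hamb.perm.mem_iff]
    simp only [List.mem_append, ha₀, List.mem_filter]
    tauto
  obtain ⟨s, r, hrot, hfalse, hbad⟩ := hG (a ++ m) (by simpa only [hmem] using hadj)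
  have hsw : s ∈ w := (hmem s).1 (hrot.mem_iff.1 (by simp))
  have hα₀ : proj G s a₀ = proj G s a := by
    have hnis : false ∈ proj G s w := by
      obtain ⟨t, ht, ht'⟩ := false_mem_proj.1 hfalse
      exact false_mem_proj.2 ⟨t, (hmem t).1 (hrot.mem_iff.1 (by simp [ht])), ht'⟩
    simp only [proj, ha₀, List.filterMap_filter]
    refine List.filterMap_congr fun t _ => ?_
    by_cases h1 : t = s
    · subst h1; simpa [proj] using hnis
    · by_cases h2 : G.Adj s t
      · have h3 : false ∈ proj G t w := false_mem_proj.2 ⟨s, hsw, h2.symm⟩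
        simpa [proj] using fun h4 => absurd h3 (by simpa [proj] using h4)
      · simp [h1, h2]
  have hgood := hw s
  have hprojw := hamb.proj_eq s
  rw [proj_append, proj_append, hα₀] at hprojw
  by_contra! hcon
  refine not_good_of_rotation hrot hbad ?_
  have hα1 : s ∈ a → proj G s a = [true] := ha.proj_self
  have ha2 := hatop s
  have hs := h s
  -- If `s` admits both a left and a right star reduction, then, since `α = [false]`, the same `t`
  -- serves at both ends, and this gives the excluded conjugation.
  have hstar : proj G s a = [false] →
      ¬ ([true] <:+ proj G s (a ++ m) ∧ [true] <+: proj G s (m ++ a₀)) := by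
    rintro h1 ⟨h2, h3⟩
    obtain ⟨t, u, ht, hst, htu⟩ := exists_left_star haw ha h1 (by rwa [hm.proj_eq])
    obtain ⟨t', v, ht', hst', htv⟩ := exists_right_star hamb hind₀ (hα₀.trans h1) h2
    obtain rfl : t = t' := by
      by_contra hne
      obtain ⟨a₁, a₂, rfl⟩ := List.append_of_mem ht
      have hp : (a₁ ++ t :: a₂).Perm (t :: (a₁ ++ a₂)) := List.perm_middle
      rw [(ha.commEq_of_perm hp).proj_eq, proj_cons_adj hst] at h1
      simp only [List.cons.injEq, true_and] at h1
      rw [proj_eq_nil_iff] at h1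
      have h4 : t' ∈ a₁ ++ t :: a₂ := (List.mem_filter.1 ht').1
      rcases List.mem_cons.1 (hp.mem_iff.1 h4) with h5 | h5
      · exact hne h5.symm
      · exact (h1 t' h5).2 hst'
    have h4 := (h t).1 (by rw [htu.proj_eq]; simp)
    rw [htu.proj_eq, proj_cons_self,
      ← List.singleton_append (x := true) (l := proj G t (s :: u)),
      suffix_singleton_append (by rw [proj_cons_adj hst.symm]; simp)] at h4
    obtain ⟨v', hv'⟩ := exists_concat_of_proj h4
    have h5 : [true] <:+ proj G s v' := by
      have h6 := htu.proj_eq s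
      rw [htv.proj_eq, proj_cons_adj hst, hv'.proj_eq, proj_append, proj_append,
        proj_cons_self, proj_cons_adj hst, proj_nil] at h6
      have h7 : [true, false] <:+ proj G s v' ++ [false] := by
        have h8 : [true, false] <:+ [false] ++ (proj G s v' ++ [false]) := ⟨_, h6⟩
        rcases hv : proj G s v' with _ | ⟨x, l⟩
        · rw [hv] at h8
          have := List.IsSuffix.eq_of_length h8 rfl
          simp at this
        · rw [hv] at h8
          exact List.suffix_of_suffix_length_le h8 (List.suffix_append _ _) (by simp)
      obtain ⟨q, hq⟩ := h7
      have : (q ++ [true]) ++ [false] = proj G s v' ++ [false] := by simpa using hq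
      exact ⟨q, List.append_cancel_right this⟩
    obtain ⟨v'', hv''⟩ := exists_concat_of_proj h5
    exact hcon s t u v'' hst htu (hv'.trans (by simpa using hv''.append_right [t]))
  rw [hprojw] at hgood ha2 hs
  rw [proj_append, proj_append, hα₀] at hstar
  rw [proj_append]
  generalize proj G s a = α at *
  generalize proj G s m = μ at *
  -- Two copies of `α μ α` are glued along `α`; the result contains the doubled projection of the
  -- cyclic word `a ++ m`.
  have d : Good ((α ++ μ) ++ (α ++ (μ ++ α))) := by
    refine Good.append_append hgood (by simpa using hgood) ?_ hstar
    rintro rfl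
    simp only [List.nil_append, List.append_nil] at *
    have : ¬ [true] <+: μ := fun h => absurd (hα1 (ha2 h)) (by simp)
    exact ⟨fun h => this (hs.2 h), this⟩
  exact d.of_infix ⟨[], α, by simp⟩

end Star

/-! ### Temperley-Lieb families -/

section Family

variable {V R A : Type*} {G : SimpleGraph V} [CommRing R] [Ring A] [Algebra R A]

/-- The elements `B s` satisfy the Temperley-Lieb relations with parameter `d`. -/
structure IsTLFamily (G : SimpleGraph V) (d : R) (B : V → A) : Prop where
  sq : ∀ s, B s * B s = d • B s
  comm : ∀ s t, s ≠ t → ¬ G.Adj s t → B s * B t = B t * B s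
  braid : ∀ s t, G.Adj s t → B s * B t * B s = B s

/-- The product of the elements `B s` along a word. -/
def wprod (B : V → A) (u : List V) : A := (u.map B).prod

@[simp] theorem wprod_nil (B : V → A) : wprod B [] = 1 := rfl

@[simp] theorem wprod_cons (B : V → A) (s : V) (u : List V) :
    wprod B (s :: u) = B s * wprod B u := by simp [wprod]

@[simp] theorem wprod_append (B : V → A) (u v : List V) :
    wprod B (u ++ v) = wprod B u * wprod B v := by simp [wprod]

namespace IsTLFamily

variable {d : R} {B : V → A}

theorem wprod_eq (hB : IsTLFamily G d B) {u v : List V} (h : CommEq G u v) :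
    wprod B u = wprod B v := by
  induction h with
  | refl u => rfl
  | swap h h' u => simp only [wprod_cons, ← mul_assoc, hB.comm _ _ h h']
  | cons s _ ih => simp only [wprod_cons, ih]
  | trans _ _ ih ih' => exact ih.trans ih'

theorem sq_assoc (hB : IsTLFamily G d B) (s : V) (x : A) : B s * (B s * x) = d • (B s * x) := by
  rw [← mul_assoc, hB.sq, smul_mul_assoc]

theorem braid_assoc (hB : IsTLFamily G d B) {s t : V} (h : G.Adj s t) (x : A) :
    B s * (B t * (B s * x)) = B s * x := by
  rw [← mul_assoc, ← mul_assoc, hB.braid s t h]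

theorem comm_assoc (hB : IsTLFamily G d B) {s t : V} (h : s ≠ t) (h' : ¬ G.Adj s t) (x : A) :
    B s * (B t * x) = B t * (B s * x) := by
  rw [← mul_assoc, hB.comm s t h h', mul_assoc]

theorem mul_wprod_of_apart (hB : IsTLFamily G d B) {s : V} {u : List V} (h : Apart G s u) :
    B s * wprod B u = wprod B u * B s := by
  have := hB.wprod_eq h.symm_comm
  simpa using this

theorem wprod_mul_self (hB : IsTLFamily G d B) {a : List V} (ha : Indep G a) :
    wprod B a * wprod B a = d ^ a.length • wprod B a := by
  induction a with
  | nil => simp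
  | cons s a ih =>
    obtain ⟨h1, h2⟩ := Indep.cons_iff.1 ha
    rw [wprod_cons, mul_assoc, ← mul_assoc (wprod B a), ← hB.mul_wprod_of_apart h1, mul_assoc (B s),
      ih h2, ← mul_assoc, hB.sq, smul_mul_assoc, mul_smul_comm, smul_smul, List.length_cons,
      pow_succ']

end IsTLFamily

end Family

/-! ### The Clifford representation at `δ = √2` -/

section Clifford

variable {V : Type*} [Fintype V] [LinearOrder V] (G : SimpleGraph V)

/-- The sign character of `ZMod 2`. -/
def sgn (a : ZMod 2) : ℝ := if a = 0 then 1 else -1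

theorem sgn_add (a b : ZMod 2) : sgn (a + b) = sgn a * sgn b := by
  have : ∀ a b : ZMod 2, (a + b = 0 ↔ (a = 0 ↔ b = 0)) := by decide
  simp only [sgn, this]
  by_cases h : a = 0 <;> by_cases h' : b = 0 <;> simp [h, h']

theorem sgn_mul_self (a : ZMod 2) : sgn a * sgn a = 1 := by
  unfold sgn; split_ifs <;> norm_num

/-- The sum of the coordinates of `x` at the neighbours of `s` that precede `s`. -/
def lowerSum (s : V) : (V → ZMod 2) →+ ZMod 2 :=
  ∑ t ∈ Finset.univ.filter (fun t => t < s ∧ G.Adj s t), Pi.evalAddMonoidHom _ t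

theorem lowerSum_single (s t : V) :
    lowerSum G s (Pi.single t 1) = if t < s ∧ G.Adj s t then 1 else 0 := by
  simp only [lowerSum, AddMonoidHom.finsetSum_apply, Pi.evalAddMonoidHom_apply, Pi.single_apply,
    Finset.sum_ite_eq', Finset.mem_filter, Finset.mem_univ, true_and]

/-- Anticommuting involutions attached to the vertices of `G`: `cliff s` and `cliff t` anticommute
if `s` and `t` are adjacent, and commute otherwise. -/
def cliff (s : V) : Matrix (V → ZMod 2) (V → ZMod 2) ℝ :=
  Matrix.of fun x y => if y = x + Pi.single s 1 then sgn (lowerSum G s x) else 0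

theorem cliff_mul_apply (s : V) (M : Matrix (V → ZMod 2) (V → ZMod 2) ℝ) (x y : V → ZMod 2) :
    (cliff G s * M) x y = sgn (lowerSum G s x) * M (x + Pi.single s 1) y := by
  simp [Matrix.mul_apply, cliff]

theorem single_add_self {U : Type*} [DecidableEq U] (s : U) :
    (Pi.single s 1 + Pi.single s 1 : U → ZMod 2) = 0 := by
  rw [← Pi.single_add, show (1 + 1 : ZMod 2) = 0 by decide, Pi.single_zero]

theorem cliff_mul_self (s : V) : cliff G s * cliff G s = 1 := by
  have h : cliff G s * (cliff G s * 1) = 1 := by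
    ext x y
    rw [cliff_mul_apply, cliff_mul_apply, map_add, lowerSum_single, sgn_add, add_assoc,
      single_add_self, add_zero, ← mul_assoc, ← mul_assoc, sgn_mul_self]
    simp [sgn]
  rwa [mul_one] at h

/-- For an edge, only the larger endpoint reads the coordinate flipped by the other, so exactly one
of the two products acquires an extra sign. -/
theorem cliff_mul_cliff (s t : V) :
    cliff G s * cliff G t = (if G.Adj s t then (-1 : ℝ) else 1) • (cliff G t * cliff G s) := by
  have h : cliff G s * (cliff G t * 1) =
      (if G.Adj s t then (-1 : ℝ) else 1) • (cliff G t * (cliff G s * 1)) := by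
    ext x y
    rw [Matrix.smul_apply]
    simp only [cliff_mul_apply, map_add, lowerSum_single, sgn_add, smul_eq_mul]
    rw [show x + Pi.single t 1 + Pi.single s 1 = x + Pi.single s 1 + Pi.single t 1 by abel]
    have h0 : sgn 0 = 1 := by simp [sgn]
    have h1 : sgn 1 = -1 := by simp [sgn]
    by_cases ha : G.Adj s t
    · have hb := ha.symm
      rcases lt_or_gt_of_ne ha.ne with h | h
      · simp [ha, hb, h, h.not_gt, h0, h1]; ring
      · simp [ha, hb, h, h.not_gt, h0, h1]; ring
    · have hb : ¬ G.Adj t s := fun k => ha k.symm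
      simp [ha, hb, h0]; ring
  simpa only [mul_one] using h

theorem cliff_transpose (s : V) : (cliff G s).transpose = cliff G s := by
  ext x y
  simp only [cliff, Matrix.transpose_apply, Matrix.of_apply]
  have h : x = y + Pi.single s 1 ↔ y = x + Pi.single s 1 := by
    constructor <;> rintro rfl <;> rw [add_assoc, single_add_self, add_zero]
  by_cases hx : y = x + Pi.single s 1
  · rw [if_pos hx, if_pos (h.2 hx), hx, map_add, lowerSum_single]
    simp [sgn]
  · rw [if_neg hx, if_neg (fun k => hx (h.1 k))]

/-- The images of the generators of the Temperley-Lieb algebra with `δ = √2`. -/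
def cgen (s : V) : Matrix (V → ZMod 2) (V → ZMod 2) ℝ := (√2)⁻¹ • (1 + cliff G s)

theorem cgen_transpose (s : V) : (cgen G s).transpose = cgen G s := by
  simp [cgen, cliff_transpose]

theorem inv_sqrt_two_mul_self : (√2)⁻¹ * (√2)⁻¹ = (2 : ℝ)⁻¹ := by
  rw [← mul_inv, Real.mul_self_sqrt (by norm_num)]

/-- The square relation uses `(1 + e)² = 2 (1 + e)` for an involution `e`. For adjacent vertices
`e_s e_t e_s = -e_t`, and in the expansion of the triple product all terms with `e_t` cancel. -/
theorem isTLFamily_cgen : IsTLFamily G (√2) (cgen G) where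
  sq s := by
    have h : (1 + cliff G s) * (1 + cliff G s) = (2 : ℝ) • (1 + cliff G s) := by
      rw [mul_add, mul_one, add_mul, one_mul, cliff_mul_self, two_smul]; abel
    rw [cgen, smul_mul_smul_comm, h, smul_smul, smul_smul, inv_sqrt_two_mul_self]
    congr 1
    rw [mul_inv_cancel₀ (by positivity)]
    norm_num
  comm s t _ h := by
    have h := cliff_mul_cliff G s t
    simp only [if_neg ‹¬ G.Adj s t›, one_smul] at h
    rw [cgen, cgen, smul_mul_smul_comm, smul_mul_smul_comm]
    congr 1
    rw [mul_add, mul_one, add_mul, one_mul, h, mul_add, mul_one, add_mul, one_mul]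
    abel
  braid s t hst := by
    have h := cliff_mul_cliff G t s
    simp only [if_pos hst.symm, neg_smul, one_smul] at h
    have hs := cliff_mul_self G s
    have h3 : cliff G s * cliff G t * cliff G s = - cliff G t := by
      rw [mul_assoc, h, mul_neg, ← mul_assoc, hs, one_mul]
    have h2 : (1 + cliff G s) * (1 + cliff G t) * (1 + cliff G s) = (2 : ℝ) • (1 + cliff G s) := by
      have : (1 + cliff G s) * (1 + cliff G t) * (1 + cliff G s) =
          1 + cliff G s + cliff G t + cliff G s * cliff G t + cliff G s + cliff G s * cliff G s +
            cliff G t * cliff G s + cliff G s * cliff G t * cliff G s := by noncomm_ring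
      rw [this, hs, h, h3, two_smul]
      abel
    rw [cgen, cgen, smul_mul_smul_comm, smul_mul_smul_comm, h2, smul_smul, inv_sqrt_two_mul_self]
    congr 1
    ring

theorem wprod_cgen_transpose (u : List V) :
    (wprod (cgen G) u).transpose = wprod (cgen G) u.reverse := by
  induction u with
  | nil => simp
  | cons s u ih => simp [ih, cgen_transpose]

/-- The diagonal sign matrix attached to a vertex. -/
def dsgn (s : V) : Matrix (V → ZMod 2) (V → ZMod 2) ℝ := Matrix.diagonal fun x => sgn (x s)

theorem dsgn_mul_cliff (s t : V) :
    dsgn s * cliff G t = (if s = t then (-1 : ℝ) else 1) • (cliff G t * dsgn s) := by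
  ext x y
  simp only [dsgn, Matrix.diagonal_mul, Matrix.smul_apply, Matrix.mul_diagonal, cliff,
    Matrix.of_apply, smul_eq_mul]
  have h0 : sgn 0 = 1 := by simp [sgn]
  have h1 : sgn 1 = -1 := by simp [sgn]
  by_cases h : y = x + Pi.single t 1
  · rw [if_pos h, h, Pi.add_apply, sgn_add]
    by_cases hst : s = t
    · subst hst
      simp only [Pi.single_eq_same, if_true, h1]; ring
    · simp only [Pi.single_eq_of_ne hst, if_neg hst, h0]; ring
  · simp [h]

theorem dsgn_mul_self (s : V) : (dsgn s : Matrix (V → ZMod 2) (V → ZMod 2) ℝ) * dsgn s = 1 := by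
  simp [dsgn, Matrix.diagonal_mul_diagonal, sgn_mul_self]

theorem dsgn_mul_wprod {s : V} {u : List V} (h : s ∉ u) :
    dsgn s * wprod (cgen G) u = wprod (cgen G) u * dsgn s := by
  induction u with
  | nil => simp
  | cons t u ih =>
    simp only [List.mem_cons, not_or] at h
    have h1 : dsgn s * cgen G t = cgen G t * dsgn s := by
      rw [cgen, mul_smul_comm, smul_mul_assoc, mul_add, add_mul, dsgn_mul_cliff, if_neg h.1,
        one_smul, mul_one, one_mul]
    rw [wprod_cons, ← mul_assoc, h1, mul_assoc, ih h.2, mul_assoc]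

/-- Conjugation by `dsgn s` negates `cliff G s` and fixes the other factors, so the trace equals its
own negative. -/
theorem trace_cliff_mul_wprod {s : V} {u : List V} (h : s ∉ u) :
    Matrix.trace (cliff G s * wprod (cgen G) u) = 0 := by
  have h1 : Matrix.trace (cliff G s * wprod (cgen G) u) =
      Matrix.trace (dsgn s * (cliff G s * wprod (cgen G) u) * dsgn s) := by
    rw [Matrix.trace_mul_comm (dsgn s * _), ← mul_assoc, dsgn_mul_self, one_mul]
  have h2 : dsgn s * (cliff G s * wprod (cgen G) u) * dsgn s = - (cliff G s * wprod (cgen G) u) := by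
    rw [← mul_assoc, dsgn_mul_cliff, if_pos rfl, mul_assoc, ← dsgn_mul_wprod G h, neg_smul, one_smul,
      neg_mul, mul_assoc, ← mul_assoc (dsgn s) (dsgn s), dsgn_mul_self, one_mul]
  rw [h2, Matrix.trace_neg] at h1
  linarith

/-- The normalized trace of the product of the generators along a word. -/
def ctr (u : List V) : ℝ :=
  (Matrix.trace (1 : Matrix (V → ZMod 2) (V → ZMod 2) ℝ))⁻¹ * Matrix.trace (wprod (cgen G) u)

theorem trace_one_pos : 0 < Matrix.trace (1 : Matrix (V → ZMod 2) (V → ZMod 2) ℝ) := by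
  rw [Matrix.trace_one]
  exact_mod_cast Fintype.card_pos

/-- Expanding the first factor `(1 + cliff s)/√2`, the second term has trace zero because `s` does
not recur. Commutation of the letters plays no role. -/
theorem ctr_indep {a : List V} (ha : a.Nodup) : ctr G a = (√2)⁻¹ ^ a.length := by
  induction a with
  | nil => simp [ctr]
  | cons s a ih =>
    obtain ⟨h1, h2⟩ := List.nodup_cons.1 ha
    have ih := ih h2
    rw [ctr] at ih ⊢
    rw [wprod_cons, cgen, smul_mul_assoc, add_mul, one_mul, Matrix.trace_smul, Matrix.trace_add,
      trace_cliff_mul_wprod G h1, add_zero, smul_eq_mul, mul_left_comm, ih, List.length_cons,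
      pow_succ']

variable {G}

theorem ctr_comm {u v : List V} (h : CommEq G u v) : ctr G u = ctr G v := by
  rw [ctr, ctr, (isTLFamily_cgen G).wprod_eq h]

theorem ctr_rot (u v : List V) : ctr G (u ++ v) = ctr G (v ++ u) := by
  rw [ctr, ctr, wprod_append, wprod_append, Matrix.trace_mul_comm]

theorem ctr_sq (s : V) (u : List V) : ctr G (s :: s :: u) = √2 * ctr G (s :: u) := by
  simp only [ctr, wprod_cons, (isTLFamily_cgen G).sq_assoc, Matrix.trace_smul, smul_eq_mul]
  ring

theorem ctr_braid {s t : V} (h : G.Adj s t) (u : List V) :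
    ctr G (s :: t :: s :: u) = ctr G (s :: u) := by
  simp only [ctr, wprod_cons, (isTLFamily_cgen G).braid_assoc h]

/-- The normalized trace of a word is an integral power of `√2`. -/
theorem exists_ctr_eq (hG : CyclicallyReducible G) (w : List V) : ∃ k : ℤ, ctr G w = (√2) ^ k := by
  have h2 : (√2 : ℝ) ≠ 0 := by positivity
  refine hG.induction (P := fun w => ∃ k : ℤ, ctr G w = (√2) ^ k) ?_ ?_ ?_ ?_ ?_ w
  · intro u hu
    exact ⟨-u.length, by rw [ctr_indep G hu.nodup]; simp⟩
  · intro u v h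
    simp [ctr_comm h]
  · intro u v
    simp [ctr_rot u v]
  · intro s u
    rw [ctr_sq]
    constructor
    · rintro ⟨k, hk⟩
      refine ⟨k - 1, ?_⟩
      rw [zpow_sub_one₀ h2, ← hk]
      field_simp
    · rintro ⟨k, hk⟩
      exact ⟨k + 1, by rw [hk, zpow_add_one₀ h2, mul_comm]⟩
  · intro s t u h
    simp [ctr_braid h]

/-- The exponent of `√2` in the normalized trace of a word. -/
def expo (hG : CyclicallyReducible G) (w : List V) : ℤ := (exists_ctr_eq hG w).choose

theorem ctr_eq (hG : CyclicallyReducible G) (w : List V) : ctr G w = (√2) ^ expo hG w :=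
  (exists_ctr_eq hG w).choose_spec

theorem one_lt_sqrt_two : (1 : ℝ) < √2 := by
  rw [Real.lt_sqrt (by norm_num)]; norm_num

theorem expo_eq (hG : CyclicallyReducible G) {w : List V} {k : ℤ} (h : ctr G w = (√2) ^ k) :
    expo hG w = k := by
  rw [ctr_eq hG] at h
  exact zpow_right_injective₀ (by positivity) one_lt_sqrt_two.ne' h

end Clifford

/-! ### Norms and faithfulness on fully commutative words -/

section Injectivity

variable {V : Type*} [Fintype V] [LinearOrder V] {G : SimpleGraph V}

/-- The squared Frobenius norm. -/
def nsq (M : Matrix (V → ZMod 2) (V → ZMod 2) ℝ) : ℝ := Matrix.trace (M * M.transpose)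

theorem nsq_nonneg (M : Matrix (V → ZMod 2) (V → ZMod 2) ℝ) : 0 ≤ nsq M := by
  simp only [nsq, Matrix.trace, Matrix.diag, Matrix.mul_apply, Matrix.transpose_apply]
  exact Finset.sum_nonneg fun i _ => Finset.sum_nonneg fun j _ => mul_self_nonneg _

theorem nsq_eq_zero {M : Matrix (V → ZMod 2) (V → ZMod 2) ℝ} (h : nsq M = 0) : M = 0 := by
  rw [nsq, ← Matrix.conjTranspose_eq_transpose_of_trivial] at h
  exact Matrix.trace_mul_conjTranspose_self_eq_zero_iff.1 h

theorem nsq_transpose (M : Matrix (V → ZMod 2) (V → ZMod 2) ℝ) : nsq M.transpose = nsq M := by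
  rw [nsq, nsq, Matrix.transpose_transpose, Matrix.trace_mul_comm]

theorem nsq_smul (c : ℝ) (M : Matrix (V → ZMod 2) (V → ZMod 2) ℝ) :
    nsq (c • M) = c * c * nsq M := by
  simp [nsq, mul_assoc]

theorem nsq_sub (M N : Matrix (V → ZMod 2) (V → ZMod 2) ℝ) :
    nsq (M - N) = nsq M + nsq N - 2 * Matrix.trace (M * N.transpose) := by
  have h : Matrix.trace (N * M.transpose) = Matrix.trace (M * N.transpose) := by
    rw [← Matrix.trace_transpose, Matrix.transpose_mul, Matrix.transpose_transpose]
  simp only [nsq, Matrix.transpose_sub, sub_mul, mul_sub, Matrix.trace_sub, h]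
  ring

/-- Since `b_t b_s b_s b_t = √2 b_t b_s b_t = √2 b_t = b_t b_t`, both norms are traces of the same
matrix. Star reductions therefore preserve the norm. -/
theorem nsq_left_star {s t : V} (h : G.Adj s t) (X : Matrix (V → ZMod 2) (V → ZMod 2) ℝ) :
    nsq (cgen G s * (cgen G t * X)) = nsq (cgen G t * X) := by
  have hB := isTLFamily_cgen G
  simp only [nsq, Matrix.transpose_mul, cgen_transpose, mul_assoc]
  rw [Matrix.trace_mul_comm]
  conv_rhs => rw [Matrix.trace_mul_comm]
  simp only [mul_assoc, hB.sq, mul_smul_comm, Matrix.trace_smul]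
  rw [Matrix.trace_mul_comm]
  simp only [mul_assoc, hB.braid t s h.symm]

theorem nsq_wprod_reverse (u : List V) :
    nsq (wprod (cgen G) u.reverse) = nsq (wprod (cgen G) u) := by
  rw [← wprod_cgen_transpose, nsq_transpose]

/-- The image of a fully commutative word has norm one, for the normalized trace. -/
theorem FC.nsq_wprod (hG : CyclicallyReducible G) {w : List V} (hw : FC G w) :
    nsq (wprod (cgen G) w) = Matrix.trace (1 : Matrix (V → ZMod 2) (V → ZMod 2) ℝ) := by
  have hB := isTLFamily_cgen G
  induction hl : w.length using Nat.strong_induction_on generalizing w with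
  | _ l ih =>
    subst hl
    have left : ∀ w' s t u, w'.length = w.length → FC G w' → G.Adj s t →
        CommEq G w' (s :: t :: u) → nsq (wprod (cgen G) w') =
          Matrix.trace (1 : Matrix (V → ZMod 2) (V → ZMod 2) ℝ) := by
      intro w' s t u hlen hw' hst h
      rw [hB.wprod_eq h, wprod_cons, wprod_cons, nsq_left_star hst, ← wprod_cons]
      have := h.length
      exact ih _ (by simp at this ⊢; omega) (hw'.of_commEq h).of_cons rfl
    rcases hw.star hG with h | ⟨s, t, u, hst, h⟩ | ⟨s, t, u, hst, h⟩
    · have h1 := hB.wprod_mul_self h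
      have h2 := ctr_indep G h.nodup
      rw [nsq, wprod_cgen_transpose, hB.wprod_eq (h.reverse.commEq_of_perm (List.reverse_perm w)),
        h1, Matrix.trace_smul, smul_eq_mul]
      rw [ctr, inv_mul_eq_iff_eq_mul₀ trace_one_pos.ne'] at h2
      rw [h2, mul_left_comm, ← mul_pow, mul_inv_cancel₀ (by positivity), one_pow, mul_one]
    · exact left w s t u rfl hw hst h
    · rw [← nsq_wprod_reverse]
      exact left _ s t u.reverse (by simp) hw.reverse hst (by simpa using h.reverse)

theorem FC.wprod_ne_zero (hG : CyclicallyReducible G) {w : List V} (hw : FC G w) :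
    wprod (cgen G) w ≠ 0 := by
  intro h
  have h1 := hw.nsq_wprod hG
  have h2 := trace_one_pos (V := V)
  rw [h, nsq, zero_mul, Matrix.trace_zero] at h1
  linarith

/-- The matrix `b_s / √2` is an orthogonal projection, so a vector whose norm it preserves is fixed.
-/
theorem mul_eq_smul_of_nsq {s : V} {X : Matrix (V → ZMod 2) (V → ZMod 2) ℝ}
    (h : nsq (cgen G s * X) = 2 * nsq X) : cgen G s * X = √2 • X := by
  have hB := isTLFamily_cgen G
  have h2 : √2 * √2 = 2 := Real.mul_self_sqrt (by norm_num)
  rw [← sub_eq_zero]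
  apply nsq_eq_zero
  have h3 : nsq (cgen G s * X) = √2 * Matrix.trace (cgen G s * X * X.transpose) := by
    rw [nsq, Matrix.transpose_mul, cgen_transpose, ← mul_assoc, Matrix.trace_mul_comm, mul_assoc,
      hB.sq_assoc, Matrix.trace_smul, smul_eq_mul]
  have h4 : Matrix.trace (cgen G s * X * (√2 • X).transpose) = 2 * nsq X := by
    rw [Matrix.transpose_smul, mul_smul_comm, Matrix.trace_smul, smul_eq_mul, ← h3, h]
  rw [nsq_sub, h4, h, nsq_smul, h2]
  ring

/-- Prepending `s` would double the squared norm, but fully commutative words all have the same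
norm. -/
theorem FC.not_fc_cons (hG : CyclicallyReducible G) {s : V} {w : List V} (hw : FC G w)
    (h : cgen G s * wprod (cgen G) w = √2 • wprod (cgen G) w) : ¬ FC G (s :: w) := by
  intro hs
  have h1 := hs.nsq_wprod hG
  rw [wprod_cons, h, nsq_smul, Real.mul_self_sqrt (by norm_num), hw.nsq_wprod hG] at h1
  have := trace_one_pos (V := V)
  linarith

/-- The image of a fully commutative word determines its maximal elements. -/
theorem FC.prefix_of_mul_eq (hG : CyclicallyReducible G) {w : List V} (hw : FC G w) {s : V}
    (h : cgen G s * wprod (cgen G) w = √2 • wprod (cgen G) w) : [true] <+: proj G s w := by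
  have hB := isTLFamily_cgen G
  have h2 : √2 * √2 = 2 := Real.mul_self_sqrt (by norm_num)
  induction hl : w.length using Nat.strong_induction_on generalizing w s with
  | _ l ih =>
    subst hl
    rcases hw.star hG with ha | ⟨r, t, u, hrt, hu⟩ | ⟨r, t, u, hrt, hu⟩
    · by_contra hcon
      have hs : s ∉ w := fun hs => hcon (by rw [ha.proj_self hs])
      refine hw.not_fc_cons hG h (hw.cons hcon fun h3 => ?_)
      exact hs (true_mem_proj.1 (h3.subset (by simp)))
    · have hfu := hw.of_commEq hu
      have hlen := hu.length
      simp only [List.length_cons] at hlen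
      by_cases hsr : s = r
      · subst hsr
        rw [hu.proj_eq, proj_cons_self]
        simp
      have hr : cgen G r * wprod (cgen G) w = √2 • wprod (cgen G) w := by
        rw [hB.wprod_eq hu, wprod_cons, hB.sq_assoc]
      -- If `s` and `r` were adjacent, evaluating `b_s b_r b_s` on a nonzero common eigenvector
      -- would give `2√2 = √2`.
      by_cases har : G.Adj s r
      · exfalso
        have h3 := hB.braid_assoc har (wprod (cgen G) w)
        rw [h, mul_smul_comm, hr, mul_smul_comm, mul_smul_comm, h, smul_smul, smul_smul, h2] at h3
        have h4 : (2 * √2 - √2) • wprod (cgen G) w = 0 := by rw [sub_smul, h3, sub_self]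
        rcases smul_eq_zero.1 h4 with h5 | h5
        · have := one_lt_sqrt_two
          linarith
        · exact hw.wprod_ne_zero hG h5
      have hst : s ≠ t := by
        rintro rfl
        exact har hrt.symm
      have hsu : proj G s w = proj G s (t :: u) := by
        rw [hu.proj_eq, proj_cons_apart hsr har]
      by_cases hat : G.Adj s t
      · by_cases h3 : [true] <+: proj G s w
        · exact h3
        exfalso
        have h4 : [false, true] <+: proj G s w := by
          by_contra h4
          exact hw.not_fc_cons hG h (hw.cons h3 h4)
        rw [hsu, proj_cons_adj hat, List.cons_prefix_cons] at h4
        obtain ⟨y, hy⟩ := exists_cons_of_proj h4.2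
        have hwy : CommEq G w (r :: t :: s :: y) := hu.trans ((hy.cons t).cons r)
        have hfy := hw.of_commEq hwy
        have hly := hy.length
        simp only [List.length_cons] at hly
        -- Applying `b_s` to `r t s y` and using the braid relation gives `b_r` times the image of
        -- `s y`. The norms then force `r` to be maximal in `s y`, and `w` would contain `r t r`.
        have h5 : cgen G r * wprod (cgen G) (s :: y) = √2 • wprod (cgen G) (s :: y) := by
          apply mul_eq_smul_of_nsq
          have h6 : cgen G r * wprod (cgen G) (s :: y) = √2 • wprod (cgen G) w := by
            rw [← h, hB.wprod_eq hwy]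
            simp only [wprod_cons]
            rw [hB.comm_assoc hsr har, hB.braid_assoc hat]
          rw [h6, nsq_smul, h2, hw.nsq_wprod hG, hfy.of_cons.of_cons.nsq_wprod hG]
        have h7 := ih (s :: y).length (by simp; omega) hfy.of_cons.of_cons h5 rfl
        have har' : ¬ G.Adj r s := fun k => har k.symm
        have h8 := hfy r
        rw [proj_cons_self, proj_cons_adj hrt, Good.cons_true] at h8
        refine h8.2.1 ?_
        rw [List.cons_prefix_cons]
        exact ⟨rfl, h7⟩
      · rw [hsu]
        refine ih (t :: u).length (by simp; omega) hfu.of_cons ?_ rfl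
        have h3 : wprod (cgen G) (t :: u) = cgen G t * wprod (cgen G) w := by
          rw [hB.wprod_eq hu, wprod_cons, wprod_cons, wprod_cons, hB.braid_assoc hrt.symm]
        rw [h3, hB.comm_assoc hst hat, h, mul_smul_comm]
    · have hlen := hu.length
      simp only [List.length_append, List.length_cons, List.length_nil] at hlen
      have hu' : CommEq G w ((u ++ [t]) ++ [r]) := by simpa using hu
      have h3 : wprod (cgen G) (u ++ [t]) = wprod (cgen G) w * cgen G t := by
        rw [hB.wprod_eq hu]
        simp only [wprod_append, wprod_cons, wprod_nil, mul_one, mul_assoc]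
        rw [← mul_assoc (cgen G t), hB.braid t r hrt.symm]
      have h4 := ih (u ++ [t]).length (by simp; omega) (hw.of_commEq hu').of_append_left
        (s := s) (by rw [h3, ← mul_assoc, h, smul_mul_assoc]) rfl
      rw [hu'.proj_eq, proj_append]
      exact h4.trans (List.prefix_append _ _)

theorem FC.mul_eq_of_prefix {s : V} {w : List V} (h : [true] <+: proj G s w) :
    cgen G s * wprod (cgen G) w = √2 • wprod (cgen G) w := by
  have hB := isTLFamily_cgen G
  obtain ⟨v, hv⟩ := exists_cons_of_proj h
  rw [hB.wprod_eq hv, wprod_cons, hB.sq_assoc]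

/-- The image of a fully commutative word equals that of a product of distinct commuting letters
only if the word is that product. -/
theorem FC.commEq_of_indep (hG : CyclicallyReducible G) {w a : List V} (hw : FC G w)
    (ha : Indep G a) (h : wprod (cgen G) w = wprod (cgen G) a) : CommEq G w a := by
  have hB := isTLFamily_cgen G
  induction hl : w.length using Nat.strong_induction_on generalizing w a with
  | _ l ih =>
    subst hl
    have top : ∀ w' : List V, FC G w' → wprod (cgen G) w' = wprod (cgen G) a → ∀ s,
        [true] <+: proj G s w' ↔ s ∈ a := by
      intro w' hw' h s
      constructor
      · intro h1
        have h2 := FC.mul_eq_of_prefix h1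
        rw [h] at h2
        exact true_mem_proj.1 ((ha.fc.prefix_of_mul_eq hG h2).subset (by simp))
      · intro h1
        have h2 : [true] <+: proj G s a := by rw [ha.proj_self h1]
        have h3 := FC.mul_eq_of_prefix h2
        rw [← h] at h3
        exact hw'.prefix_of_mul_eq hG h3
    have hrev : wprod (cgen G) w.reverse = wprod (cgen G) a := by
      rw [← wprod_cgen_transpose, h, wprod_cgen_transpose]
      exact hB.wprod_eq (ha.reverse.commEq_of_perm (List.reverse_perm a))
    have htop := top w hw h
    have hbot : ∀ s, [true] <:+ proj G s w ↔ s ∈ a := fun s => by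
      rw [← top _ hw.reverse hrev, proj_reverse, ← List.reverse_suffix, List.reverse_reverse]
      rfl
    by_cases hind : Indep G w
    · refine hind.commEq_of_perm ((List.perm_ext_iff_of_nodup hind.nodup ha.nodup).2 fun s => ?_)
      rw [← htop]
      constructor
      · intro hs
        rw [hind.proj_self hs]
      · exact fun hs => true_mem_proj.1 (hs.subset (by simp))
    · exfalso
      -- Multiplication by `b_s` on both sides turns `w` into the shorter word `v s`, and replaces
      -- `t` by `s` in the independent word. By induction these agree, so `w` would contain `t s t`.
      obtain ⟨s, t, u, v, hst, hu, hv⟩ := hw.conj hG hind fun s => by rw [htop, hbot]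
      have hta : t ∈ a := (htop t).1 (by rw [hu.proj_eq, proj_cons_self]; simp)
      obtain ⟨a₁, a₂, rfl⟩ := List.append_of_mem hta
      have hp := ha.commEq_of_perm (List.perm_middle (a := t) (l₁ := a₁) (l₂ := a₂))
      have ha' := ha.of_perm (List.perm_middle (a := t) (l₁ := a₁) (l₂ := a₂))
      obtain ⟨hta', ha''⟩ := Indep.cons_iff.1 ha'
      have hsa : Apart G s (a₁ ++ a₂) := by
        intro r hr
        have hrt := hta' r hr
        have h3 := (htop r).2 (hp.perm.mem_iff.2 (by simp [hr]))
        have h4 : ∀ q, [true] <+: proj G q w → ¬ G.Adj s q ∨ q = t := by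
          intro q hq
          by_contra! hcon
          rw [hu.proj_eq] at hq
          by_cases hqt : G.Adj q t
          · rw [proj_cons_adj hqt] at hq
            simp at hq
          · rw [proj_cons_apart hcon.2 hqt, proj_cons_adj hcon.1.symm] at hq
            simp at hq
        refine ⟨?_, ?_⟩
        · rintro rfl
          rw [hu.proj_eq, proj_cons_adj hst] at h3
          simp at h3
        · exact (h4 r h3).resolve_right hrt.1.symm
      have hF1 : wprod (cgen G) (v ++ [s]) = cgen G s * wprod (cgen G) w * cgen G s := by
        have e1 : cgen G s * wprod (cgen G) w = wprod (cgen G) (s :: u) := by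
          rw [hB.wprod_eq hu, wprod_cons, wprod_cons, hB.braid_assoc hst]
        rw [e1, hB.wprod_eq hv]
        simp only [wprod_append, wprod_cons, wprod_nil, mul_one, mul_assoc]
        rw [← mul_assoc (cgen G s), hB.braid s t hst]
      have hF2 : wprod (cgen G) (s :: (a₁ ++ a₂)) =
          cgen G s * wprod (cgen G) (a₁ ++ t :: a₂) * cgen G s := by
        rw [hB.wprod_eq hp, wprod_cons, wprod_cons, mul_assoc, mul_assoc,
          ← hB.mul_wprod_of_apart hsa, hB.braid_assoc hst]
      have hfu := hw.of_commEq hu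
      have hfv : FC G (v ++ [s] ++ [t]) := by
        have := hfu.of_cons.of_commEq hv
        simpa using this
      have hlen1 := hu.length
      have hlen2 := hv.length
      simp only [List.length_append, List.length_cons, List.length_nil] at hlen1 hlen2
      have h5 := ih (v ++ [s]).length (by simp; omega) hfv.of_append_left
        (Indep.cons_iff.2 ⟨hsa, ha''⟩) (hF1.trans (by rw [h, hF2])) rfl
      have h6 : CommEq G w (t :: s :: t :: (a₁ ++ a₂)) := by
        refine hu.trans (.cons t (hv.trans ?_))
        have e1 := h5.append_right [t]
        have e2 := hta'.symm_comm.symm.cons s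
        exact .trans (by simpa using e1) (by simpa using e2)
      exact FC.not_braid (a := []) hst.symm (hw.of_commEq h6)

/-- Fully commutative words with the same image are commutation equivalent. -/
theorem FC.commEq_of_wprod_eq (hG : CyclicallyReducible G) {w w' : List V} (hw : FC G w)
    (hw' : FC G w') (h : wprod (cgen G) w = wprod (cgen G) w') : CommEq G w w' := by
  have hB := isTLFamily_cgen G
  induction hl : w.length using Nat.strong_induction_on generalizing w w' with
  | _ l ih =>
    subst hl
    have left : ∀ z z' s t u, z.length = w.length → FC G z → FC G z' → G.Adj s t →
        CommEq G z (s :: t :: u) → wprod (cgen G) z = wprod (cgen G) z' → CommEq G z z' := by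
      intro z z' s t u hlen hz hz' hst hu h
      have hfu := hz.of_commEq hu
      have hlu := hu.length
      simp only [List.length_cons] at hlu
      have h1 : [true] <+: proj G s z' := by
        refine hz'.prefix_of_mul_eq hG ?_
        rw [← h]
        exact FC.mul_eq_of_prefix (by rw [hu.proj_eq, proj_cons_self]; simp)
      obtain ⟨v, hv⟩ := exists_cons_of_proj h1
      have hfv := hz'.of_commEq hv
      have hF : wprod (cgen G) (t :: u) = cgen G t * wprod (cgen G) z := by
        rw [hB.wprod_eq hu, wprod_cons, wprod_cons, wprod_cons, hB.braid_assoc hst.symm]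
      by_cases h2 : [true] <+: proj G t v
      · obtain ⟨y, hy⟩ := exists_cons_of_proj h2
        have hzy : CommEq G z' (s :: t :: y) := hv.trans (hy.cons s)
        have hF' : wprod (cgen G) (t :: y) = cgen G t * wprod (cgen G) z' := by
          rw [hB.wprod_eq hzy, wprod_cons, wprod_cons, wprod_cons, hB.braid_assoc hst.symm]
        have h3 := ih (t :: u).length (by simp; omega) hfu.of_cons
          (hz'.of_commEq hzy).of_cons (by rw [hF, hF', h]) rfl
        exact hu.trans ((h3.cons s).trans hzy.symm)
      -- If `t` cannot be moved next to `s`, the word `t s v` is still fully commutative and has the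
      -- image of `t u`. By induction the two agree, so `z` would contain `s t s`.
      · exfalso
        have h3 : FC G (t :: s :: v) := by
          refine hfv.cons ?_ ?_
          · rw [proj_cons_adj hst.symm]; simp
          · rw [proj_cons_adj hst.symm, List.cons_prefix_cons]
            exact fun h => h2 h.2
        have h4 := ih (t :: u).length (by simp; omega) hfu.of_cons h3
          (by rw [hF, h, hB.wprod_eq hv, wprod_cons]; rfl) rfl
        exact FC.not_braid (a := []) hst ((hz.of_commEq hu).of_commEq (h4.cons s))
    rcases hw.star hG with ha | ⟨s, t, u, hst, hu⟩ | ⟨s, t, u, hst, hu⟩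
    · exact (hw'.commEq_of_indep hG ha h.symm).symm
    · exact left w w' s t u rfl hw hw' hst hu h
    · rw [← CommEq.reverse_iff]
      refine left _ _ s t u.reverse (by simp) hw.reverse hw'.reverse hst
        (by simpa using hu.reverse) ?_
      rw [← wprod_cgen_transpose, ← wprod_cgen_transpose, h]

theorem ctr_append_reverse (u v : List V) : ctr G (u ++ v.reverse) =
    (Matrix.trace (1 : Matrix (V → ZMod 2) (V → ZMod 2) ℝ))⁻¹ *
      Matrix.trace (wprod (cgen G) u * (wprod (cgen G) v).transpose) := by
  rw [ctr, wprod_append, wprod_cgen_transpose]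

theorem FC.expo_self (hG : CyclicallyReducible G) {w : List V} (hw : FC G w) :
    expo hG (w ++ w.reverse) = 0 := by
  refine expo_eq hG ?_
  rw [ctr_append_reverse]
  have := hw.nsq_wprod hG
  rw [nsq] at this
  rw [this, inv_mul_cancel₀ trace_one_pos.ne', zpow_zero]

/-- The monomials are almost orthonormal. -/
theorem FC.expo_neg (hG : CyclicallyReducible G) {w w' : List V} (hw : FC G w) (hw' : FC G w')
    (h : ¬ CommEq G w w') : expo hG (w ++ w'.reverse) < 0 := by
  have h1 : nsq (wprod (cgen G) w - wprod (cgen G) w') ≠ 0 := fun h0 =>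
    h (hw.commEq_of_wprod_eq hG hw' (sub_eq_zero.1 (nsq_eq_zero h0)))
  have h2 := lt_of_le_of_ne (nsq_nonneg _) h1.symm
  rw [nsq_sub, hw.nsq_wprod hG, hw'.nsq_wprod hG] at h2
  have h3 : ctr G (w ++ w'.reverse) < 1 := by
    rw [ctr_append_reverse, inv_mul_lt_iff₀ trace_one_pos]
    linarith
  rw [ctr_eq hG] at h3
  by_contra! h4
  exact absurd (one_le_zpow₀ one_lt_sqrt_two.le h4) (not_le.2 h3)

end Injectivity

/-! ### The exchange property -/

section Group

variable {H : Type*} [Group H]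

theorem conj_eq_iff_of_sq {x : H} (hx : x * x = 1) (t r : H) :
    x * t * x = r ↔ t = x * r * x := by
  have h : x⁻¹ = x := inv_eq_of_mul_eq_one_right hx
  constructor
  · rintro rfl
    calc t = (x * x) * t * (x * x) := by simp [hx]
      _ = _ := by simp only [mul_assoc]
  · rintro rfl
    calc _ = (x * x) * r * (x * x) := by simp only [mul_assoc]
      _ = r := by simp [hx]

/-- The action of an involution on signed elements of a group. -/
def reflAct (a : H) (p : H × ZMod 2) : H × ZMod 2 :=
  (a * p.1 * a, p.2 + if p.1 = a then 1 else 0)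

theorem reflAct_reflAct {a : H} (ha : a * a = 1) (p : H × ZMod 2) :
    reflAct a (reflAct a p) = p := by
  obtain ⟨t, e⟩ := p
  have h : a * t * a = a ↔ t = a := by
    rw [conj_eq_iff_of_sq ha, ha, one_mul]
  refine Prod.ext ?_ ?_
  · calc a * (a * t * a) * a = (a * a) * t * (a * a) := by simp only [mul_assoc]
      _ = t := by rw [ha, one_mul, mul_one]
  · simp only [reflAct, h]
    rw [add_assoc]
    have : ∀ x : ZMod 2, x + x = 0 := by decide
    rw [this, add_zero]

theorem reflAct_comm {a c : H} (ha : a * a = 1) (hc : c * c = 1) (h : a * c = c * a)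
    (p : H × ZMod 2) : reflAct a (reflAct c p) = reflAct c (reflAct a p) := by
  have h1 : a * c * a = c := by rw [h, mul_assoc, ha, mul_one]
  have h2 : c * a * c = a := by rw [← h, mul_assoc, hc, mul_one]
  obtain ⟨t, e⟩ := p
  refine Prod.ext ?_ ?_
  · calc a * (c * t * c) * a = (a * c) * t * (c * a) := by simp only [mul_assoc]
      _ = (c * a) * t * (a * c) := by rw [h]
      _ = _ := by simp only [reflAct, mul_assoc]
  · simp only [reflAct, conj_eq_iff_of_sq ha, conj_eq_iff_of_sq hc, h1, h2]
    ring

theorem reflAct_braid {a c : H} (ha : a * a = 1) (hc : c * c = 1) (h : a * c * a = c * a * c)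
    (p : H × ZMod 2) :
    reflAct a (reflAct c (reflAct a p)) = reflAct c (reflAct a (reflAct c p)) := by
  have h1 : a * (c * a * c) * a = c := by
    rw [← h]
    calc a * (a * c * a) * a = (a * a) * c * (a * a) := by simp only [mul_assoc]
      _ = c := by rw [ha, one_mul, mul_one]
  have h2 : c * (c * a * c) * c = a := by
    calc c * (c * a * c) * c = (c * c) * a * (c * c) := by simp only [mul_assoc]
      _ = a := by rw [hc, one_mul, mul_one]
  obtain ⟨t, e⟩ := p
  refine Prod.ext ?_ ?_
  · calc a * (c * (a * t * a) * c) * a = (a * c * a) * t * (a * c * a) := by simp only [mul_assoc]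
      _ = _ := by rw [h]; simp only [reflAct, mul_assoc]
  · simp only [reflAct, conj_eq_iff_of_sq ha, conj_eq_iff_of_sq hc, h1, h2, h]
    ring

end Group

/-! ### Fully commutative words and elements of the Coxeter group -/

section Coxeter

variable {n : ℕ}

theorem cox_adj {s t : Fin n} (h : (graph n).Adj s t) : cox n s t = 3 := by
  change (if s = t then 1 else if (graph n).Adj s t then 3 else 2) = 3
  rw [if_neg h.ne, if_pos h]

theorem cox_not_adj {s t : Fin n} (h : s ≠ t) (h' : ¬ (graph n).Adj s t) : cox n s t = 2 := by
  change (if s = t then 1 else if (graph n).Adj s t then 3 else 2) = 2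
  rw [if_neg h, if_neg h']

theorem adj_of_cox {s t : Fin n} (h : cox n s t = 3) : (graph n).Adj s t := by
  by_contra h'
  by_cases hst : s = t
  · subst hst; simp at h
  · rw [cox_not_adj hst h'] at h; omega

theorem ne_of_cox {s t : Fin n} (h : cox n s t = 2) : s ≠ t ∧ ¬ (graph n).Adj s t := by
  refine ⟨?_, fun h' => ?_⟩
  · rintro rfl; simp at h
  · rw [cox_adj h'] at h; omega

theorem isLiftable_of_relations {N : Type*} [Monoid N] {f : Fin n → N} (h1 : ∀ s, f s * f s = 1)
    (h2 : ∀ s t, s ≠ t → ¬ (graph n).Adj s t → f s * f t = f t * f s)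
    (h3 : ∀ s t, (graph n).Adj s t → f s * f t * f s = f t * f s * f t) :
    (cox n).IsLiftable f := by
  intro s t
  by_cases hst : s = t
  · subst hst
    rw [CoxeterMatrix.diagonal, pow_one, h1]
  by_cases ha : (graph n).Adj s t
  · rw [cox_adj ha, pow_succ, pow_two]
    calc f s * f t * (f s * f t) * (f s * f t)
        = f s * f t * f s * (f t * f s * f t) := by simp only [mul_assoc]
      _ = f s * (f t * (f s * f s) * f t) * f s := by rw [← h3 s t ha]; simp only [mul_assoc]
      _ = 1 := by rw [h1, mul_one, h1, mul_one, h1]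
  · rw [cox_not_adj hst ha, pow_two]
    calc f s * f t * (f s * f t) = f s * (f t * f s) * f t := by simp only [mul_assoc]
      _ = (f s * f s) * (f t * f t) := by rw [← h2 s t hst ha]; simp only [mul_assoc]
      _ = 1 := by rw [h1, h1, mul_one]

theorem simple_comm {s t : Fin n} (h : s ≠ t) (h' : ¬ (graph n).Adj s t) :
    (cs n).simple s * (cs n).simple t = (cs n).simple t * (cs n).simple s := by
  have h1 := (cs n).simple_mul_simple_pow s t
  rw [cox_not_adj h h', pow_two] at h1
  have h2 := eq_inv_of_mul_eq_one_left h1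
  rwa [mul_inv_rev, CoxeterSystem.inv_simple, CoxeterSystem.inv_simple] at h2

theorem simple_braid {s t : Fin n} (h : (graph n).Adj s t) :
    (cs n).simple s * (cs n).simple t * (cs n).simple s =
      (cs n).simple t * (cs n).simple s * (cs n).simple t := by
  have h1 := (cs n).simple_mul_simple_pow s t
  rw [cox_adj h, pow_succ, pow_two] at h1
  have h2 : ((cs n).simple s * (cs n).simple t * (cs n).simple s) *
      ((cs n).simple t * (cs n).simple s * (cs n).simple t) = 1 := by
    rw [← h1]; simp only [mul_assoc]
  have h3 := eq_inv_of_mul_eq_one_left h2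
  rwa [mul_inv_rev, mul_inv_rev, CoxeterSystem.inv_simple, CoxeterSystem.inv_simple,
    ← mul_assoc] at h3

/-- The simple root coordinates of a reflection: the linear form `x ↦ 2 x_s - ∑_{t ∼ s} x_t`. -/
def coroot (s : Fin n) : (Fin n → ℤ) →ₗ[ℤ] ℤ :=
  (2 : ℤ) • LinearMap.proj s - ∑ t ∈ Finset.univ.filter (fun t => (graph n).Adj s t),
    LinearMap.proj t

theorem coroot_single (s t : Fin n) : coroot s (Pi.single t 1) =
    if s = t then 2 else if (graph n).Adj s t then -1 else 0 := by
  simp only [coroot, LinearMap.sub_apply, LinearMap.smul_apply, LinearMap.proj_apply,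
    LinearMap.sum_apply, Pi.single_apply, Finset.sum_ite_eq', Finset.mem_filter,
    Finset.mem_univ, true_and, smul_eq_mul]
  by_cases h : s = t
  · subst h; simp
  · by_cases h' : (graph n).Adj s t <;> simp [h, h']

/-- The simple reflections of the geometric representation. -/
def geomRefl (s : Fin n) (x : Fin n → ℤ) : Fin n → ℤ := x - coroot s x • Pi.single s 1

/-- `geomRefl` as an element of the monoid of self-maps. -/
def geomEnd (s : Fin n) : Function.End (Fin n → ℤ) := geomRefl s

theorem isLiftable_geomEnd : (cox n).IsLiftable (geomEnd (n := n)) := by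
  refine isLiftable_of_relations ?_ ?_ ?_
  · intro s
    funext x
    change geomRefl s (geomRefl s x) = x
    simp only [geomRefl, map_sub, map_smul, coroot_single, if_true, smul_eq_mul]
    module
  · intro s t hst ha
    have hb : ¬ (graph n).Adj t s := fun k => ha k.symm
    funext x
    change geomRefl s (geomRefl t x) = geomRefl t (geomRefl s x)
    simp only [geomRefl, map_sub, map_smul, coroot_single, if_neg hst, if_neg hst.symm, if_neg ha,
      if_neg hb, smul_eq_mul]
    module
  · intro s t ha
    have hst := ha.ne
    funext x
    change geomRefl s (geomRefl t (geomRefl s x)) = geomRefl t (geomRefl s (geomRefl t x))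
    simp only [geomRefl, map_sub, map_smul, coroot_single, if_true, if_neg hst, if_neg hst.symm,
      if_pos ha, if_pos ha.symm, smul_eq_mul]
    module

/-- In the geometric representation `s` negates its own simple root, while any other generator
leaves the `s`-coordinate of that root unchanged. -/
theorem simple_injective : Function.Injective (cs n).simple := by
  intro s t h
  have h1 := congrArg ((cs n).lift ⟨geomEnd, isLiftable_geomEnd⟩) h
  rw [CoxeterSystem.lift_apply_simple, CoxeterSystem.lift_apply_simple] at h1
  by_contra hst
  have h2 : geomRefl s (Pi.single s 1) s = geomRefl t (Pi.single s 1) s :=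
    congrFun (congrFun h1 (Pi.single s 1)) s
  simp only [geomRefl, coroot_single, if_true, Pi.sub_apply, Pi.smul_apply, Pi.single_eq_same,
    Pi.single_eq_of_ne hst, smul_eq_mul] at h2
  omega

/-- `reflAct` as an element of the monoid of self-maps. -/
def reflEnd (s : Fin n) : Function.End (W n × ZMod 2) := reflAct ((cs n).simple s)

theorem isLiftable_reflEnd : (cox n).IsLiftable (reflEnd (n := n)) :=
  isLiftable_of_relations
    (fun s => funext (reflAct_reflAct ((cs n).simple_mul_simple_self s)))
    (fun s t h h' => funext (reflAct_comm ((cs n).simple_mul_simple_self s)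
      ((cs n).simple_mul_simple_self t) (simple_comm h h')))
    (fun s t h => funext (reflAct_braid ((cs n).simple_mul_simple_self s)
      ((cs n).simple_mul_simple_self t) (simple_braid h)))

/-- The action of the Coxeter group on signed elements. -/
def reflHom : W n →* Function.End (W n × ZMod 2) :=
  (cs n).lift ⟨reflEnd, isLiftable_reflEnd⟩

/-- The left side depends only on the group element, so the parity of the multiplicity of `t` in the
inversion sequence is the same for all words with the same product. -/
theorem reflHom_wordProd_inv (u : List (Fin n)) (t : W n) (e : ZMod 2) :
    reflHom ((cs n).wordProd u)⁻¹ (t, e) = (((cs n).wordProd u)⁻¹ * t * (cs n).wordProd u,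
      e + (((cs n).leftInvSeq u).count t : ZMod 2)) := by
  induction u generalizing t e with
  | nil => simp [Function.End.one_def]
  | cons s u ih =>
    have h1 : reflHom ((cs n).simple s) = reflEnd s :=
      (cs n).lift_apply_simple _ s
    have h0 : reflHom ((cs n).wordProd (s :: u))⁻¹ (t, e) =
        reflHom ((cs n).wordProd u)⁻¹ (reflAct ((cs n).simple s) (t, e)) := by
      rw [CoxeterSystem.wordProd_cons, mul_inv_rev, CoxeterSystem.inv_simple, map_mul, h1]
      rfl
    rw [h0, reflAct, ih, CoxeterSystem.wordProd_cons, mul_inv_rev, CoxeterSystem.inv_simple]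
    have h2 : (cs n).leftInvSeq (s :: u) =
        (cs n).simple s :: ((cs n).leftInvSeq u).map (MulAut.conj ((cs n).simple s)) := rfl
    have h3 : t = MulAut.conj ((cs n).simple s) ((cs n).simple s * t * (cs n).simple s) := by
      rw [MulAut.conj_apply, CoxeterSystem.inv_simple]
      simp only [mul_assoc, CoxeterSystem.simple_mul_simple_self, mul_one,
        CoxeterSystem.simple_mul_simple_cancel_left]
    have hc : List.count t (((cs n).leftInvSeq u).map (MulAut.conj ((cs n).simple s))) =
        List.count ((cs n).simple s * t * (cs n).simple s) ((cs n).leftInvSeq u) := by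
      conv_lhs => rw [h3]
      exact List.count_map_of_injective _ _ (MulEquiv.injective _) _
    rw [h2, List.count_cons, hc]
    refine Prod.ext ?_ ?_
    · simp only [mul_assoc]
    · simp only [beq_iff_eq, eq_comm (a := (cs n).simple s) (b := t)]
      push_cast
      ring

/-- The exchange property. -/
theorem exists_eraseIdx {s : Fin n} {u : List (Fin n)}
    (h : (cs n).IsLeftDescent ((cs n).wordProd u) s) :
    ∃ j < u.length, (cs n).simple s * (cs n).wordProd u = (cs n).wordProd (u.eraseIdx j) := by
  obtain ⟨z, hz, hzu⟩ := (cs n).exists_isReduced ((cs n).simple s * (cs n).wordProd u)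
  have hprod : (cs n).wordProd (s :: z) = (cs n).wordProd u := by
    rw [CoxeterSystem.wordProd_cons, ← hzu, CoxeterSystem.simple_mul_simple_cancel_left]
  have hred : (cs n).IsReduced (s :: z) := by
    rw [CoxeterSystem.IsReduced, hprod, List.length_cons, ← hz.eq, ← hzu]
    exact ((cs n).isLeftDescent_iff.1 h).symm
  -- In the reduced word `s :: z` the reflection `s` is counted exactly once. By parity it occurs in
  -- the inversion sequence of `u`, and its position there is the letter to erase.
  have hnd := hred.nodup_leftInvSeq
  have h1 : ((cs n).leftInvSeq (s :: z)).count ((cs n).simple s) = 1 :=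
    List.count_eq_one_of_mem hnd (by simp [CoxeterSystem.leftInvSeq])
  have h2 := reflHom_wordProd_inv (s :: z) ((cs n).simple s) 0
  have h3 := reflHom_wordProd_inv u ((cs n).simple s) 0
  rw [hprod] at h2
  have h4 := congrArg Prod.snd (h2.symm.trans h3)
  simp only [h1, zero_add, Nat.cast_one] at h4
  have h5 : (cs n).simple s ∈ (cs n).leftInvSeq u := by
    by_contra hne
    rw [List.count_eq_zero_of_not_mem hne] at h4
    simp at h4
  obtain ⟨j, hj, hjs⟩ := List.getElem_of_mem h5
  rw [CoxeterSystem.length_leftInvSeq] at hj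
  refine ⟨j, hj, ?_⟩
  have h6 := (cs n).getD_leftInvSeq_mul_wordProd u j
  rwa [List.getD_eq_getElem _ _ (by simpa using hj), hjs] at h6

theorem wordProd_eq {u v : List (Fin n)} (h : CommEq (graph n) u v) :
    (cs n).wordProd u = (cs n).wordProd v := by
  induction h with
  | refl u => rfl
  | swap h h' u =>
    simp only [CoxeterSystem.wordProd_cons, ← mul_assoc, simple_comm h h']
  | cons s _ ih => simp only [CoxeterSystem.wordProd_cons, ih]
  | trans _ _ ih ih' => exact ih.trans ih'

theorem isLeftDescent_of_isReduced {s : Fin n} {u v : List (Fin n)}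
    (h : (cs n).wordProd (s :: u) = (cs n).wordProd v) (hu : (cs n).IsReduced (s :: u)) :
    (cs n).IsLeftDescent ((cs n).wordProd v) s := by
  rw [← h, CoxeterSystem.IsLeftDescent, hu.eq, CoxeterSystem.wordProd_cons,
    CoxeterSystem.simple_mul_simple_cancel_left, List.length_cons]
  exact Nat.lt_succ_of_le ((cs n).length_wordProd_le u)

/-- A fully commutative word is reduced, and commutation equivalent to each reduced word with the
same product. -/
theorem FC.isReduced_and {u : List (Fin n)} (hu : FC (graph n) u) : (cs n).IsReduced u ∧
    ∀ u', (cs n).IsReduced u' → (cs n).wordProd u = (cs n).wordProd u' →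
      CommEq (graph n) u u' := by
  induction hl : u.length using Nat.strong_induction_on generalizing u with
  | _ l ih =>
  subst hl
  rcases u with _ | ⟨s, y⟩
  · refine ⟨by simp [CoxeterSystem.IsReduced], fun u' hu' h => ?_⟩
    have := hu'.eq
    rw [← h] at this
    simp only [CoxeterSystem.wordProd_nil, CoxeterSystem.length_one] at this
    rw [List.length_eq_zero_iff.1 this.symm]
    exact .refl _
  obtain ⟨hy1, hy2⟩ := ih y.length (by simp) hu.of_cons rfl
  have hred : (cs n).IsReduced (s :: y) := by
    rcases (cs n).length_simple_mul ((cs n).wordProd y) s with h | h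
    · rw [CoxeterSystem.IsReduced, CoxeterSystem.wordProd_cons, h, hy1.eq, List.length_cons]
    · exfalso
      obtain ⟨j, hj, hjy⟩ := exists_eraseIdx (s := s) (u := y) (by
        rw [CoxeterSystem.isLeftDescent_iff]; exact h)
      have h1 : (cs n).wordProd y = (cs n).wordProd (s :: y.eraseIdx j) := by
        rw [CoxeterSystem.wordProd_cons, ← hjy, CoxeterSystem.simple_mul_simple_cancel_left]
      have h2 := hy2 (s :: y.eraseIdx j) (by
        rw [CoxeterSystem.IsReduced, ← h1, hy1.eq, List.length_cons, List.length_eraseIdx_of_lt hj]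
        omega) h1
      exact FC.not_sq (a := []) (hu.of_commEq (h2.cons s))
  refine ⟨hred, fun u' hu' huu' => ?_⟩
  have hlen : u'.length = y.length + 1 := by
    rw [← hu'.eq, ← huu', hred.eq, List.length_cons]
  rcases u' with _ | ⟨t, z⟩
  · simp at hlen
  simp only [List.length_cons, Nat.add_right_cancel_iff] at hlen
  have hz : (cs n).IsReduced z := by simpa using hu'.drop 1
  by_cases hst : s = t
  · subst hst
    refine (hy2 z hz ?_).cons s
    simpa [CoxeterSystem.wordProd_cons] using huu'
  -- Exchange removes from `t :: z` either `t`, which forces `s = t`, or a letter of `z`, so that by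
  -- induction `y` is equivalent to a word beginning with `t`.
  obtain ⟨j, hj, hju⟩ := exists_eraseIdx (isLeftDescent_of_isReduced huu' hred)
  rw [← huu', CoxeterSystem.wordProd_cons, CoxeterSystem.simple_mul_simple_cancel_left] at hju
  rcases j with _ | j
  · exfalso
    rw [CoxeterSystem.wordProd_cons, CoxeterSystem.wordProd_cons, hju] at huu'
    simp only [List.eraseIdx_cons_zero, mul_left_inj] at huu'
    exact hst (simple_injective huu')
  simp only [List.length_cons, Nat.add_lt_add_iff_right] at hj
  rw [List.eraseIdx_cons_succ] at hju
  set z' := z.eraseIdx j with hz'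
  have hz'len : z'.length + 1 = y.length := by
    rw [hz', List.length_eraseIdx_of_lt hj]; omega
  have hy3 := hy2 (t :: z') (by
    rw [CoxeterSystem.IsReduced, ← hju, hy1.eq, List.length_cons]; omega) hju
  have hu2 : CommEq (graph n) (s :: y) (s :: t :: z') := hy3.cons s
  by_cases ha : (graph n).Adj s t
  · exfalso
    have hred2 : (cs n).IsReduced (s :: t :: z') := by
      rw [CoxeterSystem.IsReduced, ← wordProd_eq hu2, hred.eq, hu2.length]
    -- A second exchange, with `t` on `s t z'`: erasing one of the first two letters is impossible,
    -- and otherwise the braid relation shows that `z'` can begin with `s`, producing the factor `s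
    -- t s`.
    obtain ⟨i, hi, hiu⟩ := exists_eraseIdx (isLeftDescent_of_isReduced
      (huu'.symm.trans (wordProd_eq hu2)) hu')
    have hne : (cs n).simple s ≠ (cs n).simple t := fun h => hst (simple_injective h)
    rcases i with _ | _ | i
    · simp only [List.eraseIdx_cons_zero, CoxeterSystem.wordProd_cons] at hiu
      have h1 : (cs n).wordProd (s :: t :: z') = (cs n).wordProd z' := by
        simpa [CoxeterSystem.wordProd_cons] using hiu
      have h2 := hred2.eq
      rw [h1] at h2
      have := (cs n).length_wordProd_le z'
      simp only [List.length_cons] at h2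
      omega
    · simp only [List.eraseIdx_cons_succ, List.eraseIdx_cons_zero, zero_add,
        CoxeterSystem.wordProd_cons, ← mul_assoc, mul_left_inj] at hiu
      rw [← simple_braid ha, mul_assoc, mul_eq_left, ← CoxeterSystem.inv_simple (cs n) s,
        mul_eq_one_iff_eq_inv, inv_inv] at hiu
      exact hne hiu.symm
    · simp only [List.eraseIdx_cons_succ] at hiu
      simp only [List.length_cons, Nat.add_lt_add_iff_right] at hi
      have h1 : (cs n).wordProd z' = (cs n).wordProd (s :: z'.eraseIdx i) := by
        have h2 := congrArg (fun x => (cs n).simple t * ((cs n).simple s *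
          ((cs n).simple t * x))) hiu
        simp only [CoxeterSystem.wordProd_cons, CoxeterSystem.simple_mul_simple_cancel_left] at h2
        have h3 := simple_braid ha
        rw [h2]
        rw [CoxeterSystem.wordProd_cons]
        have h4 : ∀ x, (cs n).simple t * ((cs n).simple s * ((cs n).simple t * x)) =
            (cs n).simple s * ((cs n).simple t * ((cs n).simple s * x)) := fun x => by
          simp only [← mul_assoc, h3]
        rw [h4, CoxeterSystem.simple_mul_simple_cancel_left,
          CoxeterSystem.simple_mul_simple_cancel_left]
      have hfz : FC (graph n) z' := (hu.of_commEq hu2).of_cons.of_cons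
      obtain ⟨h5, h6⟩ := ih z'.length (by simp; omega) hfz rfl
      have h7 := h6 (s :: z'.eraseIdx i) (by
        rw [CoxeterSystem.IsReduced, ← h1, h5.eq, List.length_cons,
          List.length_eraseIdx_of_lt hi]; omega) h1
      exact FC.not_braid (a := []) ha (hu.of_commEq (hu2.trans ((h7.cons t).cons s)))
  · have hu3 : CommEq (graph n) (s :: y) (t :: s :: z') := hu2.trans (.swap hst ha z')
    have h1 := ih (s :: z').length (by simp; omega) (hu.of_commEq hu3).of_cons rfl
    have h2 : (cs n).wordProd (s :: z') = (cs n).wordProd z := by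
      have h3 := (wordProd_eq hu3).symm.trans huu'
      rw [CoxeterSystem.wordProd_cons, CoxeterSystem.wordProd_cons (cs n) t z] at h3
      exact mul_left_cancel h3
    exact hu3.trans ((h1.2 z hz h2).cons t)

theorem fc_pair {s t : Fin n} (hst : (graph n).Adj s t) : FC (graph n) [s, t] := by
  intro r
  rw [proj_cons, proj]
  by_cases h1 : r = s
  · subst h1
    simp [proj, hst.ne', hst, Good.cons_true, Good.nil, Good.cons_false]
  · by_cases h2 : r = t
    · subst h2
      simp [proj, hst.ne, hst.symm, Good.cons_true, Good.nil, Good.cons_false]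
    · have h3 : s ≠ r := fun h => h1 h.symm
      have h4 : t ≠ r := fun h => h2 h.symm
      by_cases h5 : (graph n).Adj r s <;> by_cases h6 : (graph n).Adj r t <;>
        simp [proj, h3, h4, h5, h6, Good.nil, Good.cons_false]

/-- If `s t s` had length one, then `s t` and some `r s` would be reduced words of one fully
commutative element, but their projections to `s` end differently. This supplies the length used in
`IsComplex`. -/
theorem isReduced_braid {s t : Fin n} (hst : (graph n).Adj s t) :
    (cs n).IsReduced [s, t, s] := by
  have hfc := fc_pair hst
  have h := hfc.isReduced_and.1
  have h5 : (cs n).wordProd [s, t] * (cs n).simple s = (cs n).wordProd [s, t, s] := by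
    simp only [CoxeterSystem.wordProd_cons, CoxeterSystem.wordProd_nil, mul_one, mul_assoc]
  rcases (cs n).length_mul_simple ((cs n).wordProd [s, t]) s with h4 | h4
  · rw [CoxeterSystem.IsReduced, ← h5, h4, h.eq]
    rfl
  · exfalso
    rw [h.eq] at h4
    have h6 : (cs n).length ((cs n).wordProd [s, t] * (cs n).simple s) = 1 := by
      simp only [List.length_cons, List.length_nil] at h4
      omega
    obtain ⟨r, hr⟩ := (cs n).length_eq_one_iff.1 h6
    have h7 : (cs n).wordProd [s, t] = (cs n).wordProd [r, s] := by
      have := congrArg (· * (cs n).simple s) hr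
      simp only [CoxeterSystem.simple_mul_simple_cancel_right] at this
      rw [this]
      simp only [CoxeterSystem.wordProd_cons, CoxeterSystem.wordProd_nil, mul_one]
    have h8 := hfc.isReduced_and.2 [r, s] (by
      rw [CoxeterSystem.IsReduced, ← h7, h.eq]; rfl) h7
    have h9 := h8.proj_eq s
    rw [proj_cons_self, proj_cons_adj hst, proj_cons, proj_cons_self] at h9
    have h10 := congrArg List.getLast? h9
    simp at h10

/-- All reduced words of the element are commutation equivalent to `u`, hence fully commutative, and
none contains a factor `s t s`. -/
theorem FC.not_isComplex {u : List (Fin n)} (hu : FC (graph n) u) :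
    ¬ IsComplex ((cs n).wordProd u) := by
  rintro ⟨x₁, x₂, s, t, hst, hw, hl⟩
  obtain ⟨u₁, h1, rfl⟩ := (cs n).exists_isReduced x₁
  obtain ⟨u₂, h2, rfl⟩ := (cs n).exists_isReduced x₂
  have h3 : (cs n).simple s * (cs n).simple t * (cs n).simple s =
      (cs n).wordProd [s, t, s] := by
    simp only [CoxeterSystem.wordProd_cons, CoxeterSystem.wordProd_nil, mul_one, mul_assoc]
  have hred3 := isReduced_braid hst
  have hlen : ((cs n).wordProd u₁ * ((cs n).simple s * (cs n).simple t * (cs n).simple s) *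
      (cs n).wordProd u₂) = (cs n).wordProd (u₁ ++ s :: t :: s :: u₂) := by
    simp [CoxeterSystem.wordProd_append, CoxeterSystem.wordProd_cons, mul_assoc]
  have hred : (cs n).IsReduced (u₁ ++ s :: t :: s :: u₂) := by
    rw [CoxeterSystem.IsReduced, ← hlen, ← hw, hl, h1.eq, h2.eq, h3, hred3.eq]
    simp; omega
  exact FC.not_braid hst (hu.of_commEq (hu.isReduced_and.2 _ hred (hw.trans hlen)))

theorem fc_of_isReduced {u : List (Fin n)} (hu : (cs n).IsReduced u)
    (h : ¬ IsComplex ((cs n).wordProd u)) : FC (graph n) u := by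
  by_contra hcon
  rcases FC.sq_or_braid hcon with ⟨a, c, s, hs⟩ | ⟨a, c, s, t, hst, hs⟩
  · have h1 : (cs n).wordProd u = (cs n).wordProd (a ++ c) := by
      rw [wordProd_eq hs]
      simp only [CoxeterSystem.wordProd_append, CoxeterSystem.wordProd_cons,
        CoxeterSystem.simple_mul_simple_cancel_left]
    have h2 := hu.eq
    have h3 := hs.length
    have h4 := (cs n).length_wordProd_le (a ++ c)
    rw [h1] at h2
    simp only [List.length_append, List.length_cons] at h3 h4
    omega
  · have h1 : (cs n).wordProd u = (cs n).wordProd a *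
        ((cs n).simple s * (cs n).simple t * (cs n).simple s) * (cs n).wordProd c := by
      rw [wordProd_eq hs]
      simp [CoxeterSystem.wordProd_append, CoxeterSystem.wordProd_cons, mul_assoc]
    have h2 := hu.eq
    have h3 := hs.length
    have h4 := (cs n).length_wordProd_le a
    have h5 := (cs n).length_wordProd_le c
    have h6 := (cs n).length_wordProd_le [s, t, s]
    have h7 : (cs n).simple s * (cs n).simple t * (cs n).simple s =
      (cs n).wordProd [s, t, s] := by simp [CoxeterSystem.wordProd_cons, mul_assoc]
    have h8 := (cs n).length_mul_le ((cs n).wordProd a * (cs n).wordProd [s, t, s])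
      ((cs n).wordProd c)
    have h9 := (cs n).length_mul_le ((cs n).wordProd a) ((cs n).wordProd [s, t, s])
    refine h ⟨_, _, s, t, hst, h1, ?_⟩
    rw [h7] at h1 ⊢
    rw [h1] at h2 ⊢
    simp only [List.length_append, List.length_cons, List.length_nil] at h3 h6
    omega

/-- The chosen reduced word of a fully commutative element. -/
def redWord (w : Wc n) : List (Fin n) := ((cs n).exists_isReduced w.1).choose

theorem redWord_isReduced (w : Wc n) : (cs n).IsReduced (redWord w) :=
  ((cs n).exists_isReduced w.1).choose_spec.1

theorem wordProd_redWord (w : Wc n) : (cs n).wordProd (redWord w) = w.1 :=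
  ((cs n).exists_isReduced w.1).choose_spec.2.symm

theorem fc_redWord (w : Wc n) : FC (graph n) (redWord w) :=
  fc_of_isReduced (redWord_isReduced w) (by rw [wordProd_redWord]; exact w.2)

/-- The fully commutative element with a given word. -/
def FC.toWc {u : List (Fin n)} (hu : FC (graph n) u) : Wc n :=
  ⟨(cs n).wordProd u, hu.not_isComplex⟩

theorem FC.commEq_redWord {u : List (Fin n)} (hu : FC (graph n) u) :
    CommEq (graph n) u (redWord hu.toWc) :=
  hu.isReduced_and.2 _ (redWord_isReduced _) (wordProd_redWord hu.toWc).symm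

theorem eq_of_commEq {w w' : Wc n} (h : CommEq (graph n) (redWord w) (redWord w')) : w = w' := by
  apply Subtype.ext
  rw [← wordProd_redWord w, ← wordProd_redWord w', wordProd_eq h]

theorem redWord_inv (w : Wc n) : CommEq (graph n) (redWord w⁻¹) (redWord w).reverse := by
  refine ((fc_redWord w).reverse.isReduced_and.2 _ (redWord_isReduced _) ?_).symm
  rw [CoxeterSystem.wordProd_reverse, wordProd_redWord, wordProd_redWord]
  rfl

end Coxeter

/-! ### The parameter `δ` -/

theorem expand_algebraMap (f : PowerSeries ℤ) :
    expand (algebraMap (PowerSeries ℤ) K f) = intSeriesToLaurent f :=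
  IsFractionRing.lift_algebraMap intSeriesToLaurent_injective f

/-- The inverse of `δ` is a power series in `v⁻¹` without constant term. -/
theorem expand_delta_mul : expand δ * HahnSeries.ofPowerSeries ℤ ℚ
    (PowerSeries.X * (1 + PowerSeries.X ^ 2)⁻¹) = 1 := by
  have hX : intSeriesToLaurent PowerSeries.X = HahnSeries.ofPowerSeries ℤ ℚ PowerSeries.X := by
    simp [intSeriesToLaurent]
  have h0 : HahnSeries.ofPowerSeries ℤ ℚ PowerSeries.X ≠ 0 := by
    rw [HahnSeries.ofPowerSeries_X]
    exact HahnSeries.single_ne_zero one_ne_zero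
  have h1 : ((1 + PowerSeries.X ^ 2 : PowerSeries ℚ)) * (1 + PowerSeries.X ^ 2)⁻¹ = 1 :=
    PowerSeries.mul_inv_cancel _ (by simp)
  have h2 := congrArg (HahnSeries.ofPowerSeries ℤ ℚ) h1
  rw [map_mul, map_add, map_pow, map_one] at h2
  rw [δ, v, inv_inv, map_add, map_inv₀, expand_algebraMap, hX, map_mul, ← h2]
  field_simp

theorem delta_ne_zero : δ ≠ 0 := by
  intro h
  have := expand_delta_mul
  rw [h, map_zero, zero_mul] at this
  exact zero_ne_one this

theorem isSmall_zero : IsSmall 0 := ⟨0, by simp⟩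

theorem IsSmall.mul {x y : K} (hx : IsSmall x) (hy : IsSmall y) : IsSmall (x * y) := by
  obtain ⟨f, hf⟩ := hx
  obtain ⟨g, hg⟩ := hy
  exact ⟨f * (PowerSeries.X * g), by rw [map_mul, hf, hg, ← map_mul, mul_assoc]⟩

theorem isSmall_inv_delta : IsSmall δ⁻¹ :=
  ⟨(1 + PowerSeries.X ^ 2)⁻¹, by
    rw [map_inv₀, eq_comm]
    exact eq_inv_of_mul_eq_one_right expand_delta_mul⟩

theorem isSmall_zpow {k : ℤ} (hk : k < 0) : IsSmall (δ ^ k) := by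
  obtain ⟨m, rfl⟩ : ∃ m : ℕ, k = -((m + 1 : ℕ) : ℤ) := ⟨(-k - 1).toNat, by omega⟩
  rw [zpow_neg, zpow_natCast, ← inv_pow]
  induction m with
  | zero => simpa using isSmall_inv_delta
  | succ m ih =>
    rw [pow_succ]
    exact (ih (by omega)).mul isSmall_inv_delta

/-- The order of the expansion of an element of `K` in powers of `v⁻¹`. -/
def ordK : AddValuation K (WithTop ℤ) := (HahnSeries.addVal ℤ ℚ).comap expand

theorem IsSmall.ordK_pos {x : K} (hx : IsSmall x) : 0 < ordK x := by
  obtain ⟨f, hf⟩ := hx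
  change 0 < HahnSeries.addVal ℤ ℚ (expand x)
  rw [hf, map_mul, AddValuation.map_mul, HahnSeries.ofPowerSeries_X]
  have h1 : HahnSeries.addVal ℤ ℚ (HahnSeries.single 1 1) = 1 := by
    rw [HahnSeries.addVal_apply, HahnSeries.orderTop_single one_ne_zero]; rfl
  have h2 : 0 ≤ HahnSeries.addVal ℤ ℚ (HahnSeries.ofPowerSeries ℤ ℚ f) := by
    rw [HahnSeries.addVal_apply, HahnSeries.orderTop]
    split_ifs with h
    · exact le_top
    · norm_cast
      refine Set.IsWF.le_min_iff _ _ |>.2 fun i hi => ?_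
      by_contra hi'
      exact hi (HahnSeries.embDomain_of_notMem_range (by
        rintro ⟨k, hk⟩
        simp at hk
        omega))
  rw [h1]
  calc (0 : WithTop ℤ) < 1 := by norm_num
    _ ≤ 1 + _ := le_add_of_nonneg_right h2

section TL

variable {n : ℕ}

/-! ### The monomial spanning set -/

theorem isTLFamily_gen : IsTLFamily (graph n) δ (gen : Fin n → TL n) where
  sq s := by
    have h := RingQuot.mkAlgHom_rel K (Rel.sq (n := n) s)
    rwa [map_mul, map_smul] at h
  comm s t hst h := by
    have h := RingQuot.mkAlgHom_rel K (Rel.comm (n := n) s t (cox_not_adj hst h))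
    rwa [map_mul, map_mul] at h
  braid s t h := by
    have h := RingQuot.mkAlgHom_rel K (Rel.braid (n := n) s t (cox_adj h))
    rwa [map_mul, map_mul] at h

theorem b_eq (w : Wc n) : b w = wprod gen (redWord w) := rfl

theorem mem_span_wprod (x : TL n) :
    x ∈ Submodule.span K (Set.range (wprod (gen : Fin n → TL n))) := by
  obtain ⟨y, rfl⟩ := RingQuot.mkAlgHom_surjective K (Rel n) x
  induction y using FreeAlgebra.induction with
  | grade0 r =>
    rw [AlgHom.commutes, Algebra.algebraMap_eq_smul_one]
    exact Submodule.smul_mem _ _ (Submodule.subset_span ⟨[], rfl⟩)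
  | grade1 s => exact Submodule.subset_span ⟨[s], by simp [gen]⟩
  | mul p q hp hq =>
    rw [map_mul]
    have h := Submodule.mul_mem_mul hp hq
    rw [Submodule.span_mul_span] at h
    refine Submodule.span_mono ?_ h
    rintro _ ⟨_, ⟨u, rfl⟩, _, ⟨w, rfl⟩, rfl⟩
    exact ⟨u ++ w, wprod_append _ _ _⟩
  | add p q hp hq =>
    rw [map_add]
    exact Submodule.add_mem _ hp hq

theorem ext_wprod {N : Type*} [AddCommGroup N] [Module K N] {f g : TL n →ₗ[K] N}
    (h : ∀ u, f (wprod gen u) = g (wprod gen u)) : f = g := by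
  ext x
  exact LinearMap.eqOn_span (s := Set.range (wprod (gen : Fin n → TL n)))
    (by rintro _ ⟨u, rfl⟩; exact h u) (mem_span_wprod x)

/-- Each square or braid factor can be shortened until the word is fully commutative. The reversed
word is carried along so that reversal of words matches inversion in `W_c`. -/
theorem exists_wprod_eq (u : List (Fin n)) : ∃ (m : ℕ) (w : Wc n),
    wprod gen u = δ ^ m • b w ∧ wprod gen u.reverse = δ ^ m • b w⁻¹ := by
  have hB := isTLFamily_gen (n := n)
  induction hl : u.length using Nat.strong_induction_on generalizing u with
  | _ l ih =>
  subst hl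
  by_cases hu : FC (graph n) u
  · refine ⟨0, hu.toWc, ?_, ?_⟩
    · rw [pow_zero, one_smul, b_eq, hB.wprod_eq hu.commEq_redWord]
    · rw [pow_zero, one_smul, b_eq, hB.wprod_eq hu.commEq_redWord.reverse,
        hB.wprod_eq (redWord_inv _)]
  rcases FC.sq_or_braid hu with ⟨a, c, s, hs⟩ | ⟨a, c, s, t, hst, hs⟩
  · obtain ⟨m, w, h, h'⟩ := ih (a ++ s :: c).length (by rw [hs.length]; simp) (a ++ s :: c) rfl
    refine ⟨m + 1, w, ?_, ?_⟩
    · rw [pow_succ', mul_smul, ← h, hB.wprod_eq hs]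
      simp only [wprod_append, wprod_cons, hB.sq_assoc, mul_smul_comm]
    · rw [pow_succ', mul_smul, ← h', hB.wprod_eq hs.reverse]
      simp only [List.reverse_append, List.reverse_cons, List.append_assoc, List.singleton_append,
        wprod_append, wprod_cons, wprod_nil, mul_one, mul_assoc, hB.sq_assoc, mul_smul_comm]
  · obtain ⟨m, w, h, h'⟩ := ih (a ++ s :: c).length (by rw [hs.length]; simp) (a ++ s :: c) rfl
    refine ⟨m, w, ?_, ?_⟩
    · rw [← h, hB.wprod_eq hs]
      simp only [wprod_append, wprod_cons, hB.braid_assoc hst]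
    · rw [← h', hB.wprod_eq hs.reverse]
      simp only [List.reverse_append, List.reverse_cons, List.append_assoc, List.singleton_append,
        wprod_append, wprod_cons, wprod_nil, mul_one, mul_assoc, hB.braid_assoc hst]

theorem exists_finsupp_eq (x : TL n) : ∃ g : Wc n →₀ K, x = g.sum fun z c => c • b z := by
  have h : x ∈ Submodule.span K (Set.range (b : Wc n → TL n)) := by
    refine Submodule.span_le.2 ?_ (mem_span_wprod x)
    rintro _ ⟨u, rfl⟩
    obtain ⟨m, w, h, -⟩ := exists_wprod_eq u
    rw [h]
    exact Submodule.smul_mem _ _ (Submodule.subset_span ⟨w, rfl⟩)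
  obtain ⟨g, hg⟩ := Finsupp.mem_span_range_iff_exists_finsupp.1 h
  exact ⟨g, hg.symm⟩

/-! ### The trace -/

/-- The exponent of `δ` in the trace of a word. -/
def trExp (u : List (Fin n)) : ℤ := expo (cyclicallyReducible_graph n) u

theorem ctr_eq_trExp (u : List (Fin n)) : ctr (graph n) u = (√2) ^ trExp u := ctr_eq _ u

theorem trExp_eq {u : List (Fin n)} {k : ℤ} (h : ctr (graph n) u = (√2) ^ k) : trExp u = k :=
  expo_eq _ h

theorem trExp_comm {u w : List (Fin n)} (h : CommEq (graph n) u w) : trExp u = trExp w :=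
  trExp_eq (by rw [ctr_comm h, ctr_eq_trExp])

theorem trExp_rot (u w : List (Fin n)) : trExp (u ++ w) = trExp (w ++ u) :=
  trExp_eq (by rw [ctr_rot, ctr_eq_trExp])

/-- The exponent of `√2` shifts under this relation as the exponent of `δ` must. This is how the
trace passes from `δ = √2` to `K`. -/
theorem trExp_sq (s : Fin n) (u w : List (Fin n)) :
    trExp (u ++ s :: s :: w) = trExp (u ++ s :: w) + 1 := by
  rw [trExp_rot u, trExp_rot u]
  refine trExp_eq ?_
  rw [List.cons_append, List.cons_append, ctr_sq, ← List.cons_append, ctr_eq_trExp,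
    zpow_add_one₀ (by positivity), mul_comm]

theorem trExp_braid {s t : Fin n} (h : (graph n).Adj s t) (u w : List (Fin n)) :
    trExp (u ++ s :: t :: s :: w) = trExp (u ++ s :: w) := by
  rw [trExp_rot u, trExp_rot u]
  refine trExp_eq ?_
  rw [List.cons_append, List.cons_append, List.cons_append, ctr_braid h, ← List.cons_append,
    ctr_eq_trExp]

theorem trExp_nodup {u : List (Fin n)} (h : u.Nodup) : trExp u = -u.length :=
  trExp_eq (by rw [ctr_indep _ h]; simp)

variable (n) in
/-- The functions on words that are compatible with the Temperley-Lieb relations. -/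
def wordFunctions : Submodule K (List (Fin n) → K) where
  carrier := {f | (∀ s u w, f (u ++ s :: s :: w) = δ * f (u ++ s :: w)) ∧
    (∀ s t u w, s ≠ t → ¬ (graph n).Adj s t → f (u ++ s :: t :: w) = f (u ++ t :: s :: w)) ∧
    ∀ s t u w, (graph n).Adj s t → f (u ++ s :: t :: s :: w) = f (u ++ s :: w)}
  zero_mem' := by simp
  add_mem' := by
    rintro f g ⟨h1, h2, h3⟩ ⟨k1, k2, k3⟩
    refine ⟨fun s u w => ?_, fun s t u w h h' => ?_, fun s t u w h => ?_⟩
    · simp only [Pi.add_apply, h1, k1]; ring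
    · simp only [Pi.add_apply, h2 s t u w h h', k2 s t u w h h']
    · simp only [Pi.add_apply, h3 s t u w h, k3 s t u w h]
  smul_mem' := by
    rintro c f ⟨h1, h2, h3⟩
    refine ⟨fun s u w => ?_, fun s t u w h h' => ?_, fun s t u w h => ?_⟩
    · simp only [Pi.smul_apply, smul_eq_mul, h1]; ring
    · simp only [Pi.smul_apply, h2 s t u w h h']
    · simp only [Pi.smul_apply, h3 s t u w h]

/-- The generators act on word functions by translation. -/
def translate (s : Fin n) : Module.End K (wordFunctions n) where
  toFun f := ⟨fun u => f.1 (u ++ [s]), by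
    obtain ⟨f, h1, h2, h3⟩ := f
    refine ⟨fun s' u w => ?_, fun s' t u w h h' => ?_, fun s' t u w h => ?_⟩
    · simpa using h1 s' u (w ++ [s])
    · simpa using h2 s' t u (w ++ [s]) h h'
    · simpa using h3 s' t u (w ++ [s]) h⟩
  map_add' _ _ := rfl
  map_smul' _ _ := rfl

theorem translate_rel {x y : FreeAlgebra K (Fin n)} (h : Rel n x y) :
    FreeAlgebra.lift K translate x = FreeAlgebra.lift K translate y := by
  refine LinearMap.ext fun f => Subtype.ext (funext fun u => ?_)
  obtain ⟨f, h1, h2, h3⟩ := f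
  rcases h with s | ⟨s, t, h⟩ | ⟨s, t, h⟩
  · rw [map_mul, map_smul, FreeAlgebra.lift_ι_apply]
    change f (u ++ [s] ++ [s]) = δ * f (u ++ [s])
    simpa using h1 s u []
  · rw [map_mul, map_mul, FreeAlgebra.lift_ι_apply, FreeAlgebra.lift_ι_apply]
    change f (u ++ [s] ++ [t]) = f (u ++ [t] ++ [s])
    simpa using h2 s t u [] (ne_of_cox h).1 (ne_of_cox h).2
  · rw [map_mul, map_mul, FreeAlgebra.lift_ι_apply, FreeAlgebra.lift_ι_apply]
    change f (u ++ [s] ++ [t] ++ [s]) = f (u ++ [s])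
    simpa using h3 s t u [] (adj_of_cox h)

variable (n) in
/-- The action of the Temperley-Lieb algebra on word functions. -/
def wordAction : TL n →ₐ[K] Module.End K (wordFunctions n) :=
  RingQuot.liftAlgHom K ⟨FreeAlgebra.lift K translate, fun _ _ h => translate_rel h⟩

theorem wordAction_gen (s : Fin n) : wordAction n (gen s) = translate s := by
  rw [wordAction, gen, RingQuot.liftAlgHom_mkAlgHom_apply, FreeAlgebra.lift_ι_apply]

theorem wordAction_wprod (w : List (Fin n)) (f : wordFunctions n) (u : List (Fin n)) :
    (wordAction n (wprod gen w) f).1 u = f.1 (u ++ w) := by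
  induction w generalizing u with
  | nil => simp
  | cons s w ih =>
    rw [wprod_cons, map_mul, wordAction_gen]
    change (wordAction n (wprod gen w) f).1 (u ++ [s]) = _
    rw [ih]
    simp

variable (n) in
/-- The trace of words. -/
def wordTrace : wordFunctions n := ⟨fun u => δ ^ trExp u, by
  refine ⟨fun s u w => ?_, fun s t u w h h' => ?_, fun s t u w h => ?_⟩
  · beta_reduce
    rw [trExp_sq, zpow_add_one₀ delta_ne_zero, mul_comm]
  · beta_reduce
    rw [trExp_comm ((CommEq.swap h h' w).append_left u)]
  · beta_reduce
    rw [trExp_braid h]⟩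

variable (n) in
/-- The trace on the Temperley-Lieb algebra. -/
def trace : TL n →ₗ[K] K where
  -- Evaluation at the empty word turns the action on word functions into a linear functional, with
  -- no need to know that the monomials are independent.
  toFun x := (wordAction n x (wordTrace n)).1 []
  map_add' x y := by rw [map_add]; rfl
  map_smul' c x := by rw [map_smul]; rfl

theorem trace_wprod (u : List (Fin n)) : trace n (wprod gen u) = δ ^ trExp u :=
  wordAction_wprod u (wordTrace n) []

theorem isTrace_trace : IsTrace (trace n) := by
  intro x y
  have h : (LinearMap.mul K (TL n)).compr₂ (trace n) =
      (LinearMap.mul K (TL n)).flip.compr₂ (trace n) := by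
    refine ext_wprod fun u => ext_wprod fun w => ?_
    change trace n (wprod gen u * wprod gen w) = trace n (wprod gen w * wprod gen u)
    rw [← wprod_append, ← wprod_append, trace_wprod, trace_wprod, trExp_rot]
  exact LinearMap.congr_fun (LinearMap.congr_fun h x) y

theorem isTr_trace : IsTr (trace n) := by
  refine ⟨isTrace_trace, fun A _ => ?_⟩
  have h := trace_wprod (A.sort (· ≤ ·))
  rw [trExp_nodup (A.sort_nodup _), Finset.length_sort, zpow_neg, zpow_natCast] at h
  exact h

theorem wprod_eq_iProd {u : List (Fin n)} (hu : Indep (graph n) u) :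
    wprod gen u = iProd u.toFinset := by
  refine isTLFamily_gen.wprod_eq (hu.commEq_of_perm ?_)
  rw [List.perm_ext_iff_of_nodup hu.nodup (Finset.sort_nodup _ _)]
  simp

theorem Indep.isIndepSet {u : List (Fin n)} (hu : Indep (graph n) u) :
    (graph n).IsIndepSet (u.toFinset : Set (Fin n)) := by
  intro s hs t ht hst
  rw [List.coe_toFinset] at hs ht
  refine List.Pairwise.forall_of_forall_of_flip (R := fun s t => s ≠ t → ¬ (graph n).Adj s t)
    (fun s _ h => absurd rfl h) (hu.imp fun h _ => h.2)
    (hu.imp fun h _ k => h.2 k.symm) hs ht hst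

/-- A trace is determined on all words by its values on independent ones through cyclic reduction;
the step that removes a square divides by `δ`. -/
theorem IsTr.eq_trace {t : TL n →ₗ[K] K} (ht : IsTr t) : t = trace n := by
  have hB := isTLFamily_gen (n := n)
  refine ext_wprod fun w => ?_
  refine (cyclicallyReducible_graph n).induction
    (P := fun w => t (wprod gen w) = trace n (wprod gen w)) ?_ ?_ ?_ ?_ ?_ w
  · intro u hu
    rw [wprod_eq_iProd hu, ht.2 _ hu.isIndepSet, isTr_trace.2 _ hu.isIndepSet]
  · intro u w h
    simp only [hB.wprod_eq h, imp_self]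
  · intro u w h
    rw [wprod_append] at h ⊢
    rw [ht.1, isTrace_trace, h]
  · intro s u
    simp only [wprod_cons, hB.sq_assoc, map_smul]
    exact ⟨fun h => smul_right_injective K delta_ne_zero h, fun h => by rw [h]⟩
  · intro s r u h
    simp only [wprod_cons, hB.braid_assoc h, imp_self]

theorem trace_b_mul_b_inv (w : Wc n) : trace n (b w * b w⁻¹) = 1 := by
  rw [b_eq, b_eq, isTLFamily_gen.wprod_eq (redWord_inv w), ← wprod_append, trace_wprod, trExp,
    (fc_redWord w).expo_self, zpow_zero]

theorem isSmall_trace_b_mul_b_inv {w w' : Wc n} (h : w ≠ w') :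
    IsSmall (trace n (b w * b w'⁻¹)) := by
  rw [b_eq, b_eq, isTLFamily_gen.wprod_eq (redWord_inv w'), ← wprod_append, trace_wprod]
  exact isSmall_zpow ((fc_redWord w).expo_neg _ (fc_redWord w') fun h' => h (eq_of_commEq h'))

/-- The monomial basis is nearly orthonormal, so the form defined by the trace has no kernel. -/
theorem eq_zero_of_trace {g : Wc n →₀ K}
    (h : ∀ w : Wc n, trace n ((g.sum fun z c => c • b z) * b w⁻¹) = 0) : g = 0 := by
  by_contra hg
  -- Choose a coefficient of least order in `v⁻¹`. When paired with `b w⁻¹`, every other term has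
  -- strictly larger order and cannot cancel it.
  obtain ⟨w, hw, hmin⟩ := Finset.exists_min_image g.support (fun z => ordK (g z))
    (Finsupp.support_nonempty_iff.2 hg)
  have h1 := h w
  rw [Finsupp.sum, Finset.sum_mul, map_sum, ← Finset.add_sum_erase _ _ hw, smul_mul_assoc,
    map_smul, trace_b_mul_b_inv, smul_eq_mul, mul_one] at h1
  have h2 : ordK (g w) ≠ ⊤ := by
    rw [ne_eq, AddValuation.top_iff]
    exact Finsupp.mem_support_iff.1 hw
  refine lt_irrefl (ordK (g w)) ?_
  conv_rhs => rw [eq_neg_of_add_eq_zero_left h1, AddValuation.map_neg]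
  refine AddValuation.map_lt_sum _ h2 fun z hz => ?_
  obtain ⟨hzw, hz⟩ := Finset.mem_erase.1 hz
  rw [smul_mul_assoc, map_smul, smul_eq_mul, AddValuation.map_mul]
  calc ordK (g w) < ordK (g w) + ordK (trace n (b z * b w⁻¹)) := by
        have := (isSmall_trace_b_mul_b_inv hzw).ordK_pos
        lift ordK (g w) to ℤ using h2 with a
        rcases eq_or_ne (ordK (trace n (b z * b w⁻¹))) ⊤ with h | h
        · rw [h, add_top]
          exact WithTop.coe_lt_top a
        · lift ordK (trace n (b z * b w⁻¹)) to ℤ using h with c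
          norm_cast at this ⊢
          omega
    _ ≤ _ := by gcongr; exact hmin z hz

theorem isNondegenerate_trace : IsNondegenerate (trace n) := by
  intro x hx
  obtain ⟨g, rfl⟩ := exists_finsupp_eq x
  rw [eq_zero_of_trace fun w => hx _]
  simp

theorem finsupp_eq {g g' : Wc n →₀ K}
    (h : (g.sum fun z c => c • b z) = g'.sum fun z c => c • b z) : g = g' := by
  rw [← sub_eq_zero]
  refine eq_zero_of_trace fun w => ?_
  have h1 : ((g - g' + g').sum fun z c => c • b z) =
      ((g - g').sum fun z c => c • b z) + g'.sum fun z c => c • b z :=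
    Finsupp.sum_add_index' (fun z => zero_smul K (b z)) (fun z c c' => add_smul c c' (b z))
  rw [sub_add_cancel, h] at h1
  have h2 : ∀ x y : TL n, y = x + y → x = 0 := fun x y h => by
    have hy : y + (-1 : K) • y = 0 := by
      rw [← one_smul K y, smul_smul, ← add_smul, mul_one, add_neg_cancel, zero_smul]
    rw [← hy]
    nth_rewrite 1 [h]
    rw [add_assoc, hy, add_zero]
  rw [h2 _ _ h1, zero_mul, map_zero]

theorem sum_single_b (z : Wc n) (c : K) :
    ((Finsupp.single z c).sum fun z c => c • b z) = c • b z :=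
  Finsupp.sum_single_index (zero_smul K (b z))

theorem eq_of_smul_b_eq {w w' : Wc n} {c c' : K} (hc : c ≠ 0) (h : c • b w = c' • b w') :
    w = w' := by
  have h1 : Finsupp.single w c = Finsupp.single w' c' := by
    refine finsupp_eq ?_
    rwa [sum_single_b, sum_single_b]
  rcases Finsupp.single_eq_single_iff _ _ _ _ |>.1 h1 with h | h
  · exact h.1
  · exact absurd h.1 hc

end TL

/-! ### The monoid of monomials up to scalars -/

section Monomials

variable {n : ℕ}

/-- The fully commutative element whose monomial is proportional to the product along a word. -/
def ofWord (u : List (Fin n)) : Wc n := (exists_wprod_eq u).choose_spec.choose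

theorem exists_wprod_eq_ofWord (u : List (Fin n)) : ∃ m : ℕ,
    wprod gen u = δ ^ m • b (ofWord u) ∧ wprod gen u.reverse = δ ^ m • b (ofWord u)⁻¹ :=
  ⟨_, (exists_wprod_eq u).choose_spec.choose_spec⟩

theorem ofWord_eq {u : List (Fin n)} {w : Wc n} {c : K} (hc : c ≠ 0)
    (h : wprod gen u = c • b w) : ofWord u = w := by
  obtain ⟨m, h1, -⟩ := exists_wprod_eq_ofWord u
  exact (eq_of_smul_b_eq hc (h.symm.trans h1)).symm

theorem ofWord_congr {u u' : List (Fin n)} {c : K} (hc : c ≠ 0)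
    (h : wprod gen u = c • wprod gen u') : ofWord u = ofWord u' := by
  obtain ⟨m, h1, -⟩ := exists_wprod_eq_ofWord u'
  rw [h1, smul_smul] at h
  exact ofWord_eq (mul_ne_zero hc (pow_ne_zero _ delta_ne_zero)) h

theorem ofWord_commEq {u u' : List (Fin n)} (h : CommEq (graph n) u u') : ofWord u = ofWord u' :=
  ofWord_congr one_ne_zero (by rw [one_smul, isTLFamily_gen.wprod_eq h])

@[simp] theorem ofWord_redWord (w : Wc n) : ofWord (redWord w) = w :=
  ofWord_eq one_ne_zero (by rw [one_smul, b_eq])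

theorem ofWord_reverse (u : List (Fin n)) : ofWord u.reverse = (ofWord u)⁻¹ := by
  obtain ⟨m, -, h⟩ := exists_wprod_eq_ofWord u
  exact ofWord_eq (pow_ne_zero _ delta_ne_zero) h

instance : Mul (Wc n) := ⟨fun x y => ofWord (redWord x ++ redWord y)⟩

theorem exists_b_mul_b (x y : Wc n) : ∃ m : ℕ, b x * b y = δ ^ m • b (x * y) := by
  obtain ⟨m, h, -⟩ := exists_wprod_eq_ofWord (redWord x ++ redWord y)
  exact ⟨m, by rw [b_eq, b_eq, ← wprod_append, h]; rfl⟩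

theorem ofWord_append (u u' : List (Fin n)) : ofWord (u ++ u') = ofWord u * ofWord u' := by
  obtain ⟨m, h, -⟩ := exists_wprod_eq_ofWord u
  obtain ⟨m', h', -⟩ := exists_wprod_eq_ofWord u'
  obtain ⟨k, hk⟩ := exists_b_mul_b (ofWord u) (ofWord u')
  refine ofWord_eq (c := δ ^ m * δ ^ m' * δ ^ k) (by simp [delta_ne_zero]) ?_
  rw [wprod_append, h, h', smul_mul_smul_comm, hk, smul_smul]

instance : Monoid (Wc n) where
  one := ofWord []
  mul_assoc x y z := by
    rw [← ofWord_redWord x, ← ofWord_redWord y, ← ofWord_redWord z]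
    simp only [← ofWord_append, List.append_assoc]
  one_mul x := by
    change ofWord [] * x = x
    rw [← ofWord_redWord x, ← ofWord_append, List.nil_append]
  mul_one x := by
    change x * ofWord [] = x
    rw [← ofWord_redWord x, ← ofWord_append, List.append_nil]

theorem monomial_inv_inv (w : Wc n) : w⁻¹⁻¹ = w := Subtype.ext (inv_inv w.1)

theorem monomial_mul_inv (x y : Wc n) : (x * y)⁻¹ = y⁻¹ * x⁻¹ := by
  rw [← ofWord_redWord x, ← ofWord_redWord y, ← ofWord_append, ← ofWord_reverse,
    List.reverse_append, ofWord_append, ofWord_reverse, ofWord_reverse]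

theorem ofWord_sq (s : Fin n) (u : List (Fin n)) : ofWord (s :: s :: u) = ofWord (s :: u) :=
  ofWord_congr delta_ne_zero (by simp only [wprod_cons, isTLFamily_gen.sq_assoc])

theorem ofWord_braid {s t : Fin n} (h : (graph n).Adj s t) (u : List (Fin n)) :
    ofWord (s :: t :: s :: u) = ofWord (s :: u) :=
  ofWord_congr one_ne_zero (by simp only [wprod_cons, isTLFamily_gen.braid_assoc h, one_smul])

theorem Indep.ofWord_mul_self {a : List (Fin n)} (ha : Indep (graph n) a) :
    ofWord a * ofWord a = ofWord a := by
  rw [← ofWord_append]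
  exact ofWord_congr (pow_ne_zero a.length delta_ne_zero)
    (by rw [wprod_append, isTLFamily_gen.wprod_mul_self ha])

/-- Independent words are idempotent up to a scalar, and stabilization of powers survives every step
of the cyclic induction. -/
theorem exists_pow_succ_eq (x : Wc n) : ∃ N, x ^ (N + 1) = x ^ N := by
  rw [← ofWord_redWord x]
  refine (cyclicallyReducible_graph n).induction
    (P := fun u => ∃ N, ofWord u ^ (N + 1) = ofWord u ^ N) ?_ ?_ ?_ ?_ ?_ (redWord x)
  · intro u hu
    exact ⟨1, by rw [pow_two, pow_one, hu.ofWord_mul_self]⟩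
  · intro u w h
    simp only [ofWord_commEq h, imp_self]
  · intro u w
    simp only [ofWord_append]
    rintro ⟨N, h⟩
    refine ⟨N + 1, ?_⟩
    -- Since `(wu)^(N+2) = w (uw)^(N+1) u`, a rotation raises the stable exponent by at most one.
    rw [pow_succ, ← mul_assoc, mul_pow_mul, h, ← mul_pow_mul, mul_assoc, ← pow_succ]
  · intro s u
    rw [ofWord_sq]
  · intro s t u h
    simp only [ofWord_braid h, imp_self]

/-- Induction along star reductions: for adjacent letters `t s s t` collapses to `t t` up to
scalars, which reduces the identity to the shorter word. The base case is idempotency. -/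
theorem FC.ofWord_mul_reverse_mul {u : List (Fin n)} (hu : FC (graph n) u) :
    ofWord (u ++ (u.reverse ++ u)) = ofWord u := by
  induction hl : u.length using Nat.strong_induction_on generalizing u with
  | _ l ih =>
  subst hl
  rcases FC.star (cyclicallyReducible_graph n) hu with h | ⟨s, t, x, hst, h⟩ | ⟨s, t, x, hst, h⟩
  · have h1 : ofWord u.reverse = ofWord u :=
      ofWord_commEq (h.commEq_of_perm u.reverse_perm.symm).symm
    rw [ofWord_append, ofWord_append, h1, h.ofWord_mul_self, h.ofWord_mul_self]
  · have h1 := ih (t :: x).length (by rw [h.length]; simp) (hu.of_commEq h).of_cons rfl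
    rw [ofWord_commEq h, ofWord_commEq (h.append (h.reverse.append h))]
    simp only [List.reverse_cons, List.append_assoc, List.cons_append, List.nil_append] at h1 ⊢
    have h2 := congrArg (fun z => ofWord [s] * z) h1
    simp only [← ofWord_append, List.singleton_append] at h2
    rw [← h2]
    change ofWord ([s, t] ++ (x ++ (x.reverse ++ (t :: s :: s :: t :: x)))) =
      ofWord ([s, t] ++ (x ++ (x.reverse ++ (t :: t :: x))))
    have h3 : ofWord (t :: s :: s :: t :: x) = ofWord (t :: t :: x) := by
      rw [ofWord_sq, ← List.singleton_append (x := t), ofWord_append, ofWord_sq, ← ofWord_append,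
        List.singleton_append, ofWord_braid hst.symm]
    simp only [ofWord_append _ (x ++ _), ofWord_append x, ofWord_append x.reverse, h3]
  · have h1 := ih (x ++ [t]).length (by rw [h.length]; simp)
      (FC.of_append_left (v := [s]) (by simpa using hu.of_commEq h)) rfl
    rw [ofWord_commEq h, ofWord_commEq (h.append (h.reverse.append h))]
    simp only [List.reverse_cons, List.reverse_append, List.reverse_nil, List.append_assoc,
      List.cons_append, List.nil_append] at h1 ⊢
    have h2 := congrArg (fun z => z * ofWord [s]) h1
    simp only [← ofWord_append, List.append_assoc, List.cons_append, List.nil_append] at h2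
    rw [← h2]
    have h3 : ∀ z, ofWord (t :: s :: s :: t :: z) = ofWord (t :: t :: z) := fun z => by
      rw [ofWord_sq, ← List.singleton_append (x := t), ofWord_append, ofWord_sq, ← ofWord_append,
        List.singleton_append, ofWord_braid hst.symm]
    simp only [ofWord_append x, h3]

theorem monomial_mul_inv_mul (w : Wc n) : w * (w⁻¹ * w) = w := by
  have h := (fc_redWord w).ofWord_mul_reverse_mul
  rwa [ofWord_append, ofWord_append, ofWord_reverse, ofWord_redWord] at h

/-- Iteration gives `p = x^N p y^N`, and stable powers absorb one more factor. This is the stability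
property behind the cell structure. -/
theorem mul_eq_of_eq_mul_mul {p x y : Wc n} (h : p = x * p * y) : x * p = p ∧ p * y = p := by
  have h1 : ∀ N, p = x ^ N * p * y ^ N := by
    intro N
    induction N with
    | zero => simp
    | succ N ih =>
      calc p = x ^ N * p * y ^ N := ih
        _ = x ^ N * (x * p * y) * y ^ N := by rw [← h]
        _ = _ := by rw [pow_succ, pow_succ']; simp only [mul_assoc]
  constructor
  · obtain ⟨N, hN⟩ := exists_pow_succ_eq x
    calc x * p = x * (x ^ N * p * y ^ N) := by rw [← h1]
      _ = x ^ (N + 1) * p * y ^ N := by rw [pow_succ']; simp only [mul_assoc]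
      _ = p := by rw [hN, ← h1]
  · obtain ⟨N, hN⟩ := exists_pow_succ_eq y
    calc p * y = x ^ N * p * y ^ N * y := by rw [← h1]
      _ = x ^ N * p * y ^ (N + 1) := by rw [pow_succ]; simp only [mul_assoc]
      _ = p := by rw [hN, ← h1]

/-! ### Cells -/

/-- A product of two monomials is a nonzero multiple of one monomial, and monomials are independent,
so the order is left divisibility in the monoid. -/
theorem leL_iff {w' w : Wc n} : LeL w' w ↔ ∃ x, w' = x * w := by
  constructor
  · rintro ⟨x, g, h, hg⟩
    obtain ⟨m, hm⟩ := exists_b_mul_b x w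
    have h1 : g = Finsupp.single (x * w) (δ ^ m) := by
      refine finsupp_eq ?_
      rw [← h, hm, sum_single_b]
    rw [h1, Finsupp.single_apply_ne_zero] at hg
    exact ⟨x, hg.1⟩
  · rintro ⟨x, rfl⟩
    obtain ⟨m, hm⟩ := exists_b_mul_b x w
    refine ⟨x, Finsupp.single (x * w) (δ ^ m), by rw [hm, sum_single_b], ?_⟩
    rw [Finsupp.single_eq_same]
    exact pow_ne_zero m delta_ne_zero

theorem leLR_iff {w' w : Wc n} : LeLR w' w ↔ ∃ x y, w' = x * w * y := by
  have key : ∀ x y : Wc n, ∃ c : K, c ≠ 0 ∧ b x * b w * b y = c • b (x * w * y) := by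
    intro x y
    obtain ⟨m, hm⟩ := exists_b_mul_b x w
    obtain ⟨k, hk⟩ := exists_b_mul_b (x * w) y
    exact ⟨δ ^ m * δ ^ k, by simp [delta_ne_zero], by rw [hm, smul_mul_assoc, hk, smul_smul]⟩
  constructor
  · rintro ⟨x, y, c, hc, h⟩
    obtain ⟨d, -, h'⟩ := key x y
    exact ⟨x, y, eq_of_smul_b_eq hc (h.symm.trans h')⟩
  · rintro ⟨x, y, rfl⟩
    exact ⟨x, y, key x y⟩

theorem LeL.refl (w : Wc n) : LeL w w := leL_iff.2 ⟨1, (one_mul w).symm⟩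

theorem LeL.trans {w w' w'' : Wc n} (h : LeL w w') (h' : LeL w' w'') : LeL w w'' := by
  obtain ⟨x, rfl⟩ := leL_iff.1 h
  obtain ⟨y, rfl⟩ := leL_iff.1 h'
  exact leL_iff.2 ⟨x * y, (mul_assoc _ _ _).symm⟩

theorem LeLR.trans {w w' w'' : Wc n} (h : LeLR w w') (h' : LeLR w' w'') : LeLR w w'' := by
  obtain ⟨x, y, rfl⟩ := leLR_iff.1 h
  obtain ⟨x', y', rfl⟩ := leLR_iff.1 h'
  exact leLR_iff.2 ⟨x * x', y' * y, by simp only [mul_assoc]⟩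

theorem IsLeftCell.eq_of_mem {T : Set (Wc n)} (hT : IsLeftCell T) {w : Wc n} (hw : w ∈ T) :
    T = {w' | LeL w' w ∧ LeL w w'} := by
  obtain ⟨t, rfl⟩ := hT
  ext z
  exact ⟨fun hz => ⟨hz.1.trans hw.2, hw.1.trans hz.2⟩, fun hz => ⟨hz.1.trans hw.1, hw.2.trans hz.2⟩⟩

theorem IsLeftCell.eq {T U : Set (Wc n)} (hT : IsLeftCell T) (hU : IsLeftCell U) {w : Wc n}
    (hw : w ∈ T) (hw' : w ∈ U) : T = U := by
  rw [hT.eq_of_mem hw, hU.eq_of_mem hw']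

theorem IsLeftCell.nonempty {T : Set (Wc n)} (hT : IsLeftCell T) : ∃ w, w ∈ T := by
  obtain ⟨t, rfl⟩ := hT
  exact ⟨t, LeL.refl t, LeL.refl t⟩

/-- Write `p = x q y` and `q = x' p y'`. Stability gives `p y' = x q`, and `p⁻¹ x q` lies in both
cells by `w w⁻¹ w = w`. For uniqueness, `w' = w d⁻¹` and `w = c w'` give `w = c w d⁻¹`, so `w d⁻¹ =
w` by stability. -/
theorem existsUnique_of_mem_M {Λ P Q : Set (Wc n)} (hΛ : IsTwoSidedCell Λ) (hP : P ∈ M Λ)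
    (hQ : Q ∈ M Λ) : ∃! w : Wc n, w⁻¹ ∈ P ∧ w ∈ Q := by
  obtain ⟨l, rfl⟩ := hΛ
  obtain ⟨p, hp⟩ := hP.1.nonempty
  obtain ⟨q, hq⟩ := hQ.1.nonempty
  have hpl := hP.2 hp
  have hql := hQ.2 hq
  obtain ⟨x, y, hpq⟩ := leLR_iff.1 (hpl.1.trans hql.2)
  obtain ⟨x', y', hqp⟩ := leLR_iff.1 (hql.1.trans hpl.2)
  have hqq : q = (x' * x) * q * (y * y') := by
    conv_lhs => rw [hqp, hpq]
    simp only [mul_assoc]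
  obtain ⟨h1, h2⟩ := mul_eq_of_eq_mul_mul hqq
  have hz : p * y' = x * q := by
    conv_rhs => rw [← h2]
    rw [hpq]; simp only [mul_assoc]
  have huniq : ∀ w w' : Wc n, w⁻¹ ∈ P ∧ w ∈ Q → w'⁻¹ ∈ P ∧ w' ∈ Q → w' = w := by
    rintro w w' ⟨hw1, hw2⟩ ⟨hw3, hw4⟩
    rw [hP.1.eq_of_mem hw1] at hw3
    rw [hQ.1.eq_of_mem hw2] at hw4
    obtain ⟨d, hd⟩ := leL_iff.1 hw3.1
    obtain ⟨c, hc⟩ := leL_iff.1 hw4.2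
    have hd' : w' = w * d⁻¹ := by
      rw [← monomial_inv_inv w', hd, monomial_mul_inv, monomial_inv_inv]
    rw [hd']
    exact (mul_eq_of_eq_mul_mul (by rw [mul_assoc, ← hd']; exact hc)).2
  refine existsUnique_of_exists_of_unique ⟨p⁻¹ * (x * q), ?_, ?_⟩ (fun w w' h h' => huniq w' w h' h)
  · rw [hP.1.eq_of_mem hp, monomial_mul_inv, monomial_inv_inv]
    refine ⟨leL_iff.2 ⟨_, rfl⟩, leL_iff.2 ⟨x * q, ?_⟩⟩
    conv_lhs => rw [hpq, ← monomial_mul_inv_mul (x * q)]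
    conv_rhs => rw [hpq]
    simp only [mul_assoc]
  · rw [hQ.1.eq_of_mem hq]
    refine ⟨leL_iff.2 ⟨p⁻¹ * x, (mul_assoc _ _ _).symm⟩, leL_iff.2 ⟨x' * p, ?_⟩⟩
    rw [← hz, mul_assoc, ← mul_assoc p⁻¹, ← mul_assoc p, monomial_mul_inv_mul, hz, ← mul_assoc, h1]

theorem exists_C_eq {Λ P Q : Set (Wc n)} (hΛ : IsTwoSidedCell Λ) (hP : P ∈ M Λ) (hQ : Q ∈ M Λ) :
    ∃ w : Wc n, (w⁻¹ ∈ P ∧ w ∈ Q) ∧ (∀ w' : Wc n, w'⁻¹ ∈ P ∧ w' ∈ Q → w' = w) ∧ C P Q = b w := by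
  have h := existsUnique_of_mem_M hΛ hP hQ
  refine ⟨h.choose, h.choose_spec.1, h.choose_spec.2, ?_⟩
  rw [C, dif_pos h]

/-- The product is `b w * b w'`, with trace `1` if `w = w'⁻¹` and small otherwise. As inversion
exchanges the two cells that index `w`, this equality holds exactly when `Q = R` and `P = S`. -/
theorem isSmall_trace_C_mul_C {Λ Λ' P Q R S : Set (Wc n)} (hΛ : IsTwoSidedCell Λ)
    (hΛ' : IsTwoSidedCell Λ') (hP : P ∈ M Λ) (hQ : Q ∈ M Λ) (hR : R ∈ M Λ') (hS : S ∈ M Λ') :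
    IsSmall (trace n (C P Q * C R S) - (if Q = R then 1 else 0) * (if P = S then 1 else 0)) := by
  obtain ⟨w, hw, -, hC⟩ := exists_C_eq hΛ hP hQ
  obtain ⟨w', hw', huniq, hC'⟩ := exists_C_eq hΛ' hR hS
  rw [hC, hC']
  by_cases h : w = w'⁻¹
  · subst h
    rw [monomial_inv_inv] at hw
    rw [if_pos (hQ.1.eq hR.1 hw.2 hw'.1), if_pos (hP.1.eq hS.1 hw.1 hw'.2)]
    have h1 := trace_b_mul_b_inv (w'⁻¹)
    rw [monomial_inv_inv] at h1
    rw [h1, mul_one, sub_self]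
    exact isSmall_zero
  · have h1 : ¬ (Q = R ∧ P = S) := by
      rintro ⟨rfl, rfl⟩
      refine h ?_
      rw [← huniq w⁻¹ ⟨by rw [monomial_inv_inv]; exact hw.2, hw.1⟩, monomial_inv_inv]
    have h2 : (if Q = R then (1 : K) else 0) * (if P = S then 1 else 0) = 0 := by
      rcases not_and_or.1 h1 with h1 | h1 <;> simp [h1]
    rw [h2, sub_zero]
    have h3 := isSmall_trace_b_mul_b_inv h
    rwa [monomial_inv_inv] at h3

end Monomials

end TLE

end

open scoped Classical in
theorem proposition6p5 (n : ℕ) (hn : 6 ≤ n) :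
    ∃ tr : TLE.TL n →ₗ[TLE.K] TLE.K,
      (TLE.IsTr tr ∧ ∀ t : TLE.TL n →ₗ[TLE.K] TLE.K, TLE.IsTr t → t = tr) ∧
      TLE.IsNondegenerate tr ∧
      ∀ Λ Λ' : Set (TLE.Wc n), TLE.IsTwoSidedCell Λ → TLE.IsTwoSidedCell Λ' →
        ∀ P ∈ TLE.M Λ, ∀ Q ∈ TLE.M Λ, ∀ R ∈ TLE.M Λ', ∀ S ∈ TLE.M Λ',
          TLE.IsSmall (tr (TLE.C P Q * TLE.C R S) -
            (if Q = R then 1 else 0) * (if P = S then 1 else 0)) :=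
  ⟨TLE.trace n, ⟨TLE.isTr_trace, fun _ ht => ht.eq_trace⟩, TLE.isNondegenerate_trace,
    fun _ _ hΛ hΛ' _ hP _ hQ _ hR _ hS => TLE.isSmall_trace_C_mul_C hΛ hΛ' hP hQ hR hS⟩
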